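/- **Setting.** Let $h^{\mu\nu}=h^{\nu\mu}$ be a free massless symmetric tensor field on Minkowski space and $u^\mu$, $\tilde u^\mu$ free massless fermionic ghost and anti-ghost fields, so that $\Box h^{\mu\nu}=\Box u^\mu=\Box\tilde u^\mu=0$. Put $h=h^\mu{}_\mu$, let $A_{,\nu}=\partial A/\partial x^\nu$, and contract repeated indices with $\eta=\mathrm{diag}(1,-1,-1,-1)$ (all field indices are written as superscripts, all derivative indices as subscripts). Products are normal products, i.e. elements of the graded-commutative complex algebra generated by all partial derivatives of the field components modulo the symmetry of $h^{\mu\nu}$ and the wave equations ($h$ commutes with everything, $u$ and $\tilde u$ anticommute). The gauge variation $d_Q$ is the complex-linear graded derivation, $d_Q(AB)=(d_QA)B+(-1)^{n_g(A)}A\,d_QB$ ($n_g$ = ghost number), commuting with $\partial_\mu$, with $$d_Qh^{\mu\nu}=-\tfrac i2\bigl(u^\mu_{,\nu}+u^\nu_{,\mu}-\eta^{\mu\nu}u^\alpha_{,\alpha}\bigr),\qquad d_Q\tilde u^\mu=i\,h^{\mu\nu}_{,\nu},\qquad d_Qu^\mu=0.$$ **Coupling.** For $a_1,\dots,a_{12},b_1,\dots,b_{21}\in\mathbb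 R$ let $T_1=T_1^h+T_1^u$ with $$\begin{aligned}T_1^h={}&a_1h^{\mu\nu}_{,\mu}h_{,\nu}h+a_2h^{\mu\nu}h_{,\mu}h_{,\nu}+a_3h^{\alpha\beta}_{,\alpha}h^{\beta\mu}_{,\mu}h+a_4h^{\alpha\beta}_{,\alpha}h^{\beta\mu}h_{,\mu}+a_5h^{\alpha\beta}h^{\beta\mu}_{,\alpha}h_{,\mu}+a_6h^{\alpha\beta}_{,\mu}h^{\beta\mu}_{,\alpha}h\\&+a_7h^{\mu\nu}_{,\mu}h^{\alpha\beta}_{,\nu}h^{\alpha\beta}+a_8h^{\mu\nu}h^{\alpha\beta}_{,\mu}h^{\alpha\beta}_{,\nu}+a_9h^{\mu\nu}_{,\alpha}h^{\nu\alpha}_{,\beta}h^{\mu\beta}+a_{10}h^{\mu\nu}_{,\alpha}h^{\nu\alpha}h^{\mu\beta}_{,\beta}+a_{11}h^{\mu\nu}h^{\nu\alpha}_{,\alpha}h^{\mu\beta}_{,\beta}+a_{12}h^{\mu\nu}h^{\nu\alpha}_{,\beta}h^{\mu\beta}_{,\alpha},\end{aligned}$$ $$\begin{aligned}T_1^u={}&b_1u^\rho_{,\nu}\tilde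 u^\mu_{,\rho}h^{\mu\nu}+b_2u^\rho_{,\nu}\tilde u^\mu h^{\mu\nu}_{,\rho}+b_3u^\rho\tilde u^\mu_{,\nu}h^{\mu\nu}_{,\rho}+b_4u^\rho_{,\rho}\tilde u^\mu_{,\nu}h^{\mu\nu}+b_5u^\rho_{,\rho}\tilde u^\mu h^{\mu\nu}_{,\nu}+b_6u^\rho\tilde u^\mu_{,\rho}h^{\mu\nu}_{,\nu}\\&+b_7u^\rho_{,\mu}\tilde u^\mu_{,\rho}h+b_8u^\rho_{,\mu}\tilde u^\mu h_{,\rho}+b_9u^\rho\tilde u^\mu_{,\mu}h_{,\rho}+b_{10}u^\rho_{,\rho}\tilde u^\mu_{,\mu}h+b_{11}u^\rho_{,\rho}\tilde u^\mu h_{,\mu}+b_{12}u^\rho\tilde u^\mu_{,\rho}h_{,\mu}\\&+b_{13}u^\rho_{,\mu}\tilde u^\mu_{,\nu}h^{\rho\nu}+b_{14}u^\rho_{,\mu}\tilde u^\mu h^{\rho\nu}_{,\nu}+b_{15}u^\rho\tilde u^\mu_{,\mu}h^{\rho\nu}_{,\nu}+b_{16}u^\rho_{,\nu}\tilde u^\mu_{,\mu}h^{\rho\nu}+b_{17}u^\rho_{,\nu}\tilde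 u^\mu h^{\rho\nu}_{,\mu}+b_{18}u^\rho\tilde u^\mu_{,\nu}h^{\rho\nu}_{,\mu}\\&+b_{19}u^\mu_{,\nu}\tilde u^\mu_{,\rho}h^{\rho\nu}+b_{20}u^\mu_{,\nu}\tilde u^\mu h^{\rho\nu}_{,\rho}+b_{21}u^\mu\tilde u^\mu_{,\nu}h^{\rho\nu}_{,\rho}.\end{aligned}$$ **Q-vertex.** $\tilde T^\mu_{1/1}$ is an arbitrary complex linear combination of the following 100 monomials with free index $\mu$. Type $A$: $u^{\mu}_{,\alpha}\,h^{\rho\sigma}_{,\alpha}\,h^{\rho\sigma}$, $u^{\mu}\,h^{\rho\sigma}_{,\alpha}\,h^{\rho\sigma}_{,\alpha}$, $u^{\alpha}_{,\alpha}\,h^{\rho\sigma}_{,\mu}\,h^{\rho\sigma}$, $u^{\alpha}\,h^{\rho\sigma}_{,\alpha}\,h^{\rho\sigma}_{,\mu}$, $u^{\alpha}_{,\mu}\,h^{\rho\sigma}_{,\alpha}\,h^{\rho\sigma}$. Type $B$: $u^{\mu}_{,\alpha}\,h_{,\alpha}\,h$, $u^{\mu}\,h_{,\alpha}\,h_{,\alpha}$,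 $u^{\alpha}_{,\alpha}\,h_{,\mu}\,h$, $u^{\alpha}\,h_{,\alpha}\,h_{,\mu}$, $u^{\alpha}_{,\mu}\,h_{,\alpha}\,h$. Type $C$: $u^{\alpha}_{,\nu}\,h^{\alpha\mu}_{,\nu}\,h$, $u^{\alpha}_{,\nu}\,h^{\alpha\mu}\,h_{,\nu}$, $u^{\alpha}\,h^{\alpha\mu}_{,\nu}\,h_{,\nu}$, $u^{\alpha}_{,\nu}\,h^{\alpha\nu}_{,\mu}\,h$, $u^{\alpha}_{,\nu}\,h^{\alpha\nu}\,h_{,\mu}$, $u^{\alpha}\,h^{\alpha\nu}_{,\nu}\,h_{,\mu}$, $u^{\alpha}_{,\mu}\,h^{\alpha\nu}_{,\nu}\,h$, $u^{\alpha}_{,\mu}\,h^{\alpha\nu}\,h_{,\nu}$, $u^{\alpha}\,h^{\alpha\nu}_{,\mu}\,h_{,\nu}$. Type $D$: $u^{\alpha}_{,\rho}\,h^{\alpha\sigma}_{,\rho}\,h^{\sigma\mu}$, $u^{\alpha}_{,\rho}\,h^{\alpha\sigma}\,h^{\sigma\mu}_{,\rho}$, $u^{\alpha}\,h^{\alpha\sigma}_{,\rho}\,h^{\sigma\mu}_{,\rho}$,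 $u^{\alpha}_{,\rho}\,h^{\alpha\sigma}_{,\mu}\,h^{\sigma\rho}$, $u^{\alpha}_{,\rho}\,h^{\alpha\sigma}\,h^{\sigma\rho}_{,\mu}$, $u^{\alpha}\,h^{\alpha\sigma}_{,\rho}\,h^{\sigma\rho}_{,\mu}$, $u^{\alpha}_{,\mu}\,h^{\alpha\sigma}_{,\rho}\,h^{\sigma\rho}$, $u^{\alpha}_{,\mu}\,h^{\alpha\sigma}\,h^{\sigma\rho}_{,\rho}$, $u^{\alpha}\,h^{\alpha\sigma}_{,\mu}\,h^{\sigma\rho}_{,\rho}$. Type $E$: $u^{\alpha}_{,\sigma\rho}\,h^{\alpha\rho}\,h^{\mu\sigma}$, $u^{\alpha}\,h^{\alpha\rho}_{,\sigma\rho}\,h^{\mu\sigma}$, $u^{\alpha}\,h^{\alpha\rho}\,h^{\mu\sigma}_{,\sigma\rho}$, $u^{\alpha}_{,\sigma}\,h^{\alpha\rho}_{,\rho}\,h^{\mu\sigma}$, $u^{\alpha}_{,\sigma}\,h^{\alpha\rho}\,h^{\mu\sigma}_{,\rho}$, $u^{\alpha}\,h^{\alpha\rho}_{,\sigma}\,h^{\mu\sigma}_{,\rho}$,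 $u^{\alpha}_{,\rho}\,h^{\alpha\rho}_{,\sigma}\,h^{\mu\sigma}$, $u^{\alpha}_{,\rho}\,h^{\alpha\rho}\,h^{\mu\sigma}_{,\sigma}$, $u^{\alpha}\,h^{\alpha\rho}_{,\rho}\,h^{\mu\sigma}_{,\sigma}$, $u^{\alpha}_{,\rho\sigma}\,h^{\alpha\mu}\,h^{\sigma\rho}$, $u^{\alpha}\,h^{\alpha\mu}_{,\rho\sigma}\,h^{\rho\sigma}$, $u^{\alpha}\,h^{\alpha\mu}\,h^{\rho\sigma}_{,\rho\sigma}$, $u^{\alpha}_{,\rho}\,h^{\alpha\mu}_{,\sigma}\,h^{\rho\sigma}$, $u^{\alpha}_{,\rho}\,h^{\alpha\mu}\,h^{\rho\sigma}_{,\sigma}$, $u^{\alpha}\,h^{\alpha\mu}_{,\rho}\,h^{\rho\sigma}_{,\sigma}$. Type $F$: $u^{\rho}_{,\sigma\rho}\,h^{\mu\nu}\,h^{\nu\sigma}$, $u^{\rho}\,h^{\mu\nu}_{,\sigma\rho}\,h^{\nu\sigma}$, $u^{\rho}\,h^{\mu\nu}\,h^{\nu\sigma}_{,\sigma\rho}$,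 $u^{\rho}_{,\sigma}\,h^{\mu\nu}_{,\rho}\,h^{\nu\sigma}$, $u^{\rho}_{,\sigma}\,h^{\mu\nu}\,h^{\nu\sigma}_{,\rho}$, $u^{\rho}\,h^{\mu\nu}_{,\sigma}\,h^{\nu\sigma}_{,\rho}$, $u^{\rho}_{,\rho}\,h^{\mu\nu}_{,\sigma}\,h^{\nu\sigma}$, $u^{\rho}_{,\rho}\,h^{\mu\nu}\,h^{\nu\sigma}_{,\sigma}$, $u^{\rho}\,h^{\mu\nu}_{,\rho}\,h^{\nu\sigma}_{,\sigma}$, $u^{\mu}_{,\rho\sigma}\,h^{\rho\nu}\,h^{\nu\sigma}$, $u^{\mu}\,h^{\rho\nu}_{,\rho\sigma}\,h^{\nu\sigma}$, $u^{\mu}\,h^{\rho\nu}_{,\sigma}\,h^{\nu\sigma}_{,\rho}$, $u^{\mu}_{,\rho}\,h^{\rho\nu}_{,\sigma}\,h^{\nu\sigma}$, $u^{\mu}_{,\rho}\,h^{\rho\nu}\,h^{\nu\sigma}_{,\sigma}$, $u^{\mu}\,h^{\rho\nu}_{,\rho}\,h^{\nu\sigma}_{,\sigma}$. Type $G$: $u^{\rho}_{,\sigma\rho}\,h^{\mu\sigma}\,h$,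 $u^{\rho}\,h^{\mu\sigma}_{,\sigma\rho}\,h$, $u^{\rho}\,h^{\mu\sigma}\,h_{,\sigma\rho}$, $u^{\rho}_{,\sigma}\,h^{\mu\sigma}_{,\rho}\,h$, $u^{\rho}_{,\sigma}\,h^{\mu\sigma}\,h_{,\rho}$, $u^{\rho}\,h^{\mu\sigma}_{,\sigma}\,h_{,\rho}$, $u^{\rho}_{,\rho}\,h^{\mu\sigma}_{,\sigma}\,h$, $u^{\rho}_{,\rho}\,h^{\mu\sigma}\,h_{,\sigma}$, $u^{\rho}\,h^{\mu\sigma}_{,\rho}\,h_{,\sigma}$, $u^{\mu}_{,\rho\sigma}\,h^{\rho\sigma}\,h$, $u^{\mu}\,h^{\rho\sigma}_{,\rho\sigma}\,h$, $u^{\mu}\,h^{\rho\sigma}\,h_{,\rho\sigma}$, $u^{\mu}_{,\rho}\,h^{\rho\sigma}_{,\sigma}\,h$, $u^{\mu}_{,\rho}\,h^{\rho\sigma}\,h_{,\sigma}$, $u^{\mu}\,h^{\rho\sigma}_{,\rho}\,h_{,\sigma}$. Type $H$: $u^{\mu}_{,\sigma}\,\tilde u^{\alpha}_{,\sigma}\,u^{\alpha}$,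 $u^{\mu}_{,\sigma}\,\tilde u^{\alpha}\,u^{\alpha}_{,\sigma}$, $u^{\mu}\,\tilde u^{\alpha}_{,\sigma}\,u^{\alpha}_{,\sigma}$, $u^{\sigma}_{,\sigma}\,\tilde u^{\alpha}_{,\mu}\,u^{\alpha}$, $u^{\sigma}_{,\sigma}\,\tilde u^{\alpha}\,u^{\alpha}_{,\mu}$, $u^{\sigma}\,\tilde u^{\alpha}_{,\sigma}\,u^{\alpha}_{,\mu}$, $u^{\sigma}_{,\mu}\,\tilde u^{\alpha}_{,\sigma}\,u^{\alpha}$, $u^{\sigma}_{,\mu}\,\tilde u^{\alpha}\,u^{\alpha}_{,\sigma}$, $u^{\sigma}\,\tilde u^{\alpha}_{,\mu}\,u^{\alpha}_{,\sigma}$. Type $J$: $u^{\alpha}_{,\rho}\,\tilde u^{\mu}_{,\alpha}\,u^{\rho}$, $u^{\alpha}_{,\alpha}\,\tilde u^{\mu}_{,\rho}\,u^{\rho}$, $u^{\alpha}\,\tilde u^{\mu}_{,\rho\alpha}\,u^{\rho}$, $u^{\alpha}_{,\rho\alpha}\,\tilde u^{\mu}\,u^{\rho}$, $u^{\rho}_{,\alpha\rho}\,\tilde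 u^{\alpha}\,u^{\mu}$, $u^{\rho}\,\tilde u^{\alpha}_{,\alpha\rho}\,u^{\mu}$, $u^{\rho}\,\tilde u^{\alpha}\,u^{\mu}_{,\alpha\rho}$, $u^{\rho}_{,\alpha}\,\tilde u^{\alpha}_{,\rho}\,u^{\mu}$, $u^{\rho}_{,\alpha}\,\tilde u^{\alpha}\,u^{\mu}_{,\rho}$, $u^{\rho}\,\tilde u^{\alpha}_{,\alpha}\,u^{\mu}_{,\rho}$, $u^{\rho}_{,\rho}\,\tilde u^{\alpha}_{,\alpha}\,u^{\mu}$, $u^{\rho}_{,\rho}\,\tilde u^{\alpha}\,u^{\mu}_{,\alpha}$, $u^{\rho}\,\tilde u^{\alpha}_{,\rho}\,u^{\mu}_{,\alpha}$, $u^{\mu}\,\tilde u^{\alpha}_{,\alpha\rho}\,u^{\rho}$. Type $K$: $u^{\sigma}_{,\alpha}\,\tilde u^{\mu}_{,\alpha}\,u^{\sigma}$, $u^{\sigma}_{,\alpha}\,\tilde u^{\alpha}_{,\mu}\,u^{\sigma}$, $u^{\sigma}_{,\alpha}\,\tilde u^{\alpha}\,u^{\sigma}_{,\mu}$, $u^{\sigma}_{,\mu}\,\tilde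 u^{\alpha}_{,\alpha}\,u^{\sigma}$. **Relations.** Let $V\subset\mathbb R^{33}$ be the space of vectors $(a_1,\dots,a_{12},b_1,\dots,b_{21})$ with $$\begin{aligned} 0&=a_7-2a_8-a_9+a_{12}-b_{16}+b_{17}-b_{18},\\ 0&=-2a_8-a_9-a_{10}+a_{11}+a_{12}+b_{14}-b_{15}+b_{17}-b_{18}+b_{20},\\ 0&=-2a_8-a_9-a_{10}+a_{11}+a_{12}+b_{14}+b_{17}+b_{20}-b_{21},\\ 0&=-2a_8-\tfrac32a_9-\tfrac12a_{10}+a_{12}+b_{13}+b_{17}-b_{18},\\ 0&=-2a_8-\tfrac12a_9-\tfrac32a_{10}+a_{11}+b_{14}+b_{17}+b_{19}+b_{20}-b_{21},\\ 0&=-a_{10}+a_{11}+b_{14}+b_{17}+b_{20}-b_{21},\\ 0&=-a_4-a_5-a_9-a_{10}-b_2+b_3-b_4,\\ 0&=-2a_3-2a_6-a_9-a_{10}-a_{11}-a_{12}+b_3-2b_4+2b_5-b_6,\\ 0&=a_5-a_6,\\ 0&=-a_4+a_5-2a_6-\tfrac12a_9-\tfrac12a_{10}-b_1-b_4,\\ 0&=-2a_2-a_5+a_6-a_8+b_8+b_{11},\\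 0&=-2a_1+2a_2-a_4+2a_5-3a_6-a_7+a_8-b_8-2b_{10}+b_{11}-2b_{12},\\ 0&=a_5-a_6-b_9-b_{12},\\ 0&=-\tfrac12a_4+\tfrac32a_5-2a_6+b_7-b_8-b_{12},\\ 0&=-2a_2+a_5-a_6-a_8-b_8-b_{11}. \end{aligned}$$ Let $L:\mathbb R^{18}\to\mathbb R^{33}$ be the linear map that sends $(a_6,a_{12},b_3,b_4,b_5,b_6,b_7,b_{10},b_{11},b_{12},b_{13},b_{14},b_{16},b_{17},b_{18},b_{19},b_{20},b_{21})$ to the vector $(a_1,\dots,a_{12},b_1,\dots,b_{21})$ with these entries and $$\begin{aligned} a_1&=-b_7-b_{10}-\tfrac12(b_{16}-b_{17}+b_{18}),\quad a_2=\tfrac14(b_{13}+b_{17}-b_{18}-b_{19}),\\ a_3&=-a_6+\tfrac12b_3-b_4+b_5-\tfrac12(b_6+3b_{13}-b_{14})-b_{17}+\tfrac12(3b_{18}-b_{19}+b_{20}-b_{21}),\\ a_4&=-a_6+2(b_7+b_{11}-b_{12}),\quad a_5=a_6,\quad a_7=b_{16}-b_{17}+b_{18},\quad a_8=\tfrac12(-b_{13}-b_{17}+b_{18}+b_{19}),\\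 a_9&=a_{12}+b_{13}+b_{17}-b_{18}-b_{19},\quad a_{10}=-a_{12}+b_{13}+b_{17}-b_{18}+b_{19},\\ a_{11}&=-a_{12}+b_{13}-b_{14}-b_{18}+b_{19}-b_{20}+b_{21},\\ b_1&=-b_4-2(b_7+b_{11}-b_{12})-b_{13}-b_{17}+b_{18},\quad b_2=b_3-b_4-2(b_7+b_{11}-b_{12}+b_{13}+b_{17}-b_{18}),\\ b_8&=-b_{11},\quad b_9=-b_{12},\quad b_{15}=-b_{18}+b_{21}. \end{aligned}$$ **Proposition 1.** The 33 monomials of $T_1$ are linearly independent over $\mathbb R$, so that the map $f:T_1\mapsto(a_1,\dots,a_{12},b_1,\dots,b_{21})$ is well defined. $V$ has dimension 18, $L$ is injective, and $V=\operatorname{im}(L)$. For every $T_1$ the following two statements are equivalent: (A1) for some choice of the 100 complex constants in $\tilde T^\mu_{1/1}$ one has $d_QT_1=\partial_\mu\tilde T^\mu_{1/1}$ and $d_Q(\partial_\mu\tilde T^\mu_{1/1})=0$; (A2) $f(T_1)\in V=\operatorname{im}(L)$. -/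

import Mathlib

namespace SpinTwo

/-!
### The algebra of Wick polynomials in the free fields

The Wick (normally ordered) polynomials in the free fields `h`, `u`, `ũ` and their derivatives at
one spacetime point form the graded-commutative complex algebra generated by the partial
derivatives of the field components, modulo the symmetry of `h` and the wave equations; the
product is the normal product.
-/

/-- Components (all tensor indices upper) of the fundamental fields: the tensor field `h^{μν}`,
the ghost field `u^μ` and the anti-ghost field `ũ^μ`. -/
inductive Comp where
  | h (μ ν : Fin 4) : Comp
  | u (μ : Fin 4) : Comp
  | ut (μ : Fin 4) : Comp

/-- Parity: `h` is a Bose field, the ghost and anti-ghost fields are Fermi fields. -/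
def parity : Comp → ℕ
  | .h _ _ => 0
  | .u _ => 1
  | .ut _ => 1

/-- `(φ, s)` stands for the iterated partial derivative `∂_{s₁} ⋯ ∂_{sₖ} φ` (lower derivative
indices). As `s` is a multiset, partial derivatives commute. -/
abbrev Jet := Comp × Multiset (Fin 4)

/-- Diagonal entries of the Minkowski metric `diag(1, -1, -1, -1)`. -/
def η (μ : Fin 4) : ℂ := if μ = 0 then 1 else -1

/-- Defining relations of the Wick algebra. -/
inductive WickRel : FreeAlgebra ℂ Jet → FreeAlgebra ℂ Jet → Prop
  /-- `h^{μν} = h^{νμ}` -/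
  | symm (μ ν : Fin 4) (s : Multiset (Fin 4)) :
      WickRel (FreeAlgebra.ι ℂ (Comp.h μ ν, s)) (FreeAlgebra.ι ℂ (Comp.h ν μ, s))
  /-- `□ φ = 0`, together with all its derivatives -/
  | wave (φ : Comp) (s : Multiset (Fin 4)) :
      WickRel (∑ μ, η μ • FreeAlgebra.ι ℂ (φ, μ ::ₘ μ ::ₘ s)) 0
  /-- Fermi fields anticommute with each other under the normal product; all else commutes -/
  | comm (φ ψ : Comp) (s t : Multiset (Fin 4)) :
      WickRel (FreeAlgebra.ι ℂ (φ, s) * FreeAlgebra.ι ℂ (ψ, t))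
        ((-1 : ℂ) ^ (parity φ * parity ψ) •
          (FreeAlgebra.ι ℂ (ψ, t) * FreeAlgebra.ι ℂ (φ, s)))

/-- The algebra of Wick polynomials. -/
abbrev Wick := RingQuot WickRel

/-- The Wick monomial `∂_{s₁} ⋯ ∂_{sₖ} φ` of degree one. -/
noncomputable def gen (φ : Comp) (s : Multiset (Fin 4)) : Wick :=
  RingQuot.mkAlgHom ℂ WickRel (FreeAlgebra.ι ℂ (φ, s))

theorem gen_symm (μ ν : Fin 4) (s : Multiset (Fin 4)) :
    gen (.h μ ν) s = gen (.h ν μ) s :=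
  RingQuot.mkAlgHom_rel ℂ (WickRel.symm μ ν s)

theorem gen_wave (φ : Comp) (s : Multiset (Fin 4)) :
    ∑ μ, η μ • gen φ (μ ::ₘ μ ::ₘ s) = 0 := by
  have := RingQuot.mkAlgHom_rel ℂ (WickRel.wave φ s)
  simpa [gen] using this

theorem gen_comm (φ ψ : Comp) (s t : Multiset (Fin 4)) :
    gen φ s * gen ψ t = (-1 : ℂ) ^ (parity φ * parity ψ) • (gen ψ t * gen φ s) := by
  have := RingQuot.mkAlgHom_rel ℂ (WickRel.comm φ ψ s t)
  simpa only [gen, map_mul, map_smul] using this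

/-!
### Graded derivations

An algebra homomorphism of the form `A ↦ !![σ A, D A; 0, A]` amounts to an algebra endomorphism
`σ` together with a linear map `D` such that `D (A B) = σ A · D B + D A · B`. With `σ = id` this
is used for `∂_μ`, and with `σ A = (-1)^{n_g(A)} A` for `d_Q`.
-/

/-- The `2 × 2` matrices associated with a generator. -/
noncomputable def derMat (ε : Comp → ℂ) (D : Comp → Multiset (Fin 4) → Wick) (j : Jet) :
    Matrix (Fin 2) (Fin 2) Wick :=
  !![ε j.1 • gen j.1 j.2, D j.1 j.2; 0, gen j.1 j.2]

/-- The algebra homomorphism `A ↦ !![σ A, D A; 0, A]` on the Wick algebra with `σ φ = ε φ • φ` and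
prescribed values of `D` on the generators, provided that these respect the relations. -/
noncomputable def derHom (ε : Comp → ℂ) (D : Comp → Multiset (Fin 4) → Wick)
    (hεsymm : ∀ μ ν, ε (.h μ ν) = ε (.h ν μ))
    (hsymm : ∀ μ ν s, D (.h μ ν) s = D (.h ν μ) s)
    (hwave : ∀ φ s, ∑ μ, η μ • D φ (μ ::ₘ μ ::ₘ s) = 0)
    (hcomm : ∀ φ ψ s t, (ε φ • gen φ s) * D ψ t + D φ s * gen ψ t =
      (-1 : ℂ) ^ (parity φ * parity ψ) • ((ε ψ • gen ψ t) * D φ s + D ψ t * gen φ s)) :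
    Wick →ₐ[ℂ] Matrix (Fin 2) (Fin 2) Wick :=
  RingQuot.liftAlgHom ℂ ⟨FreeAlgebra.lift ℂ (derMat ε D), by
    intro x y hxy
    cases hxy with
    | symm μ ν s =>
      simp only [FreeAlgebra.lift_ι_apply, derMat, hεsymm μ ν, hsymm μ ν s, gen_symm μ ν s]
    | wave φ s =>
      simp only [map_sum, map_smul, map_zero, FreeAlgebra.lift_ι_apply, derMat]
      have h1 := gen_wave φ s
      have h2 := hwave φ s
      ext i j
      fin_cases i <;> fin_cases j
      · simp only [Matrix.sum_apply, Matrix.smul_apply]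
        simp [smul_comm _ (ε φ), ← Finset.smul_sum, h1]
      · simpa [Matrix.sum_apply] using h2
      · simp [Matrix.sum_apply]
      · simpa [Matrix.sum_apply] using h1
    | comm φ ψ s t =>
      simp only [map_mul, map_smul, FreeAlgebra.lift_ι_apply, derMat, Matrix.mul_fin_two]
      have h1 := gen_comm φ ψ s t
      have h2 := hcomm φ ψ s t
      ext i j
      fin_cases i <;> fin_cases j
      · simp [h1, smul_smul, mul_left_comm, mul_comm, mul_assoc]
      · simpa using h2
      · simp
      · simpa using h1⟩

/-- The upper right entry of the homomorphism, as a linear map. -/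
noncomputable def upperRight (ρ : Wick →ₐ[ℂ] Matrix (Fin 2) (Fin 2) Wick) : Wick →ₗ[ℂ] Wick where
  toFun A := ρ A 0 1
  map_add' A B := by simp
  map_smul' r A := by simp

/-- Values of the partial derivative `∂_μ` on the generators. -/
noncomputable def partialGen (μ : Fin 4) (φ : Comp) (s : Multiset (Fin 4)) : Wick :=
  gen φ (μ ::ₘ s)

/-- The homomorphism belonging to `∂_μ`. -/
noncomputable def partialHom (μ : Fin 4) : Wick →ₐ[ℂ] Matrix (Fin 2) (Fin 2) Wick :=
  derHom (fun _ => 1) (partialGen μ) (fun _ _ => rfl) (fun α β s => gen_symm α β _)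
    (fun φ s => by
      have := gen_wave φ (μ ::ₘ s)
      simpa only [partialGen, Multiset.cons_swap μ] using this)
    (fun φ ψ s t => by
      simp only [partialGen, one_smul]
      rw [gen_comm φ ψ s, gen_comm φ ψ (μ ::ₘ s), smul_add, add_comm])

/-- The partial derivative `∂_μ = ∂/∂x^μ` of Wick polynomials. -/
noncomputable def partialD (μ : Fin 4) : Wick →ₗ[ℂ] Wick := upperRight (partialHom μ)

/-- Gauge variations of the fundamental fields and their derivatives:
`d_Q h^{μν} = -(i/2) (∂^ν u^μ + ∂^μ u^ν - η^{μν} ∂_α u^α)`, `d_Q u^μ = 0`,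
`d_Q ũ^μ = i ∂_ν h^{μν}`. -/
noncomputable def dQGen : Comp → Multiset (Fin 4) → Wick
  | .h μ ν, s => (-(Complex.I / 2)) •
      (η ν • gen (.u μ) (ν ::ₘ s) + η μ • gen (.u ν) (μ ::ₘ s)
        - (if μ = ν then η μ else 0) • ∑ α, gen (.u α) (α ::ₘ s))
  | .u _, _ => 0
  | .ut μ, s => Complex.I • ∑ ν, gen (.h μ ν) (ν ::ₘ s)

theorem dQGen_symm (μ ν : Fin 4) (s : Multiset (Fin 4)) :
    dQGen (.h μ ν) s = dQGen (.h ν μ) s := by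
  by_cases e : μ = ν
  · subst e; rfl
  · simp only [dQGen, e, Ne.symm e, if_false, zero_smul, add_comm]

theorem dQGen_wave (φ : Comp) (s : Multiset (Fin 4)) :
    ∑ μ, η μ • dQGen φ (μ ::ₘ μ ::ₘ s) = 0 := by
  have key : ∀ (ψ : Comp) (α : Fin 4), ∑ μ, η μ • gen ψ (α ::ₘ μ ::ₘ μ ::ₘ s) = 0 := by
    intro ψ α
    have := gen_wave ψ (α ::ₘ s)
    simpa only [Multiset.cons_swap α] using this
  cases φ with
  | h α β =>
    simp only [dQGen, smul_comm (η _) (-(Complex.I / 2)), ← Finset.smul_sum, smul_sub, smul_add,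
      Finset.sum_sub_distrib, Finset.sum_add_distrib]
    simp only [smul_comm (η _) (η α) (gen _ _), smul_comm (η _) (η β) (gen _ _),
      smul_comm (η _) (if α = β then η α else 0), ← Finset.smul_sum, key]
    have : ∑ μ, η μ • ∑ γ, gen (.u γ) (γ ::ₘ μ ::ₘ μ ::ₘ s) = 0 := by
      simp only [Finset.smul_sum]
      rw [Finset.sum_comm]
      simp [key]
    simp [this]
  | u α => simp [dQGen]
  | ut α =>
    simp only [dQGen, smul_comm (η _) Complex.I, ← Finset.smul_sum]
    have : ∑ μ, η μ • ∑ γ, gen (.h α γ) (γ ::ₘ μ ::ₘ μ ::ₘ s) = 0 := by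
      simp only [Finset.smul_sum]
      rw [Finset.sum_comm]
      simp [key]
    simp [this]

theorem dQGen_comm_gen (φ ψ : Comp) (s t : Multiset (Fin 4)) :
    dQGen φ s * gen ψ t = (-1 : ℂ) ^ ((parity φ + 1) * parity ψ) • (gen ψ t * dQGen φ s) := by
  cases φ with
  | h α β =>
    have key : ∀ (γ : Fin 4) (r : Multiset (Fin 4)), gen (.u γ) r * gen ψ t =
        (-1 : ℂ) ^ parity ψ • (gen ψ t * gen (.u γ) r) := by
      intro γ r
      simpa [parity] using gen_comm (.u γ) ψ r t
    have hp : (parity (.h α β) + 1) * parity ψ = parity ψ := by simp [parity]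
    rw [hp]
    simp only [dQGen, smul_mul_assoc, mul_smul_comm, add_mul, sub_mul, mul_add, mul_sub,
      Finset.sum_mul, Finset.mul_sum, key]
    simp only [smul_add, smul_sub, Finset.smul_sum, smul_comm ((-1 : ℂ) ^ parity ψ)]
  | u α => simp [dQGen]
  | ut α =>
    have key : ∀ (γ : Fin 4) (r : Multiset (Fin 4)), gen (.h α γ) r * gen ψ t =
        gen ψ t * gen (.h α γ) r := by
      intro γ r
      simpa [parity] using gen_comm (.h α γ) ψ r t
    simp only [dQGen, smul_mul_assoc, mul_smul_comm, Finset.sum_mul, Finset.mul_sum, key]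
    cases ψ <;> simp [parity]

/-- The homomorphism belonging to `d_Q`. -/
noncomputable def dQHom : Wick →ₐ[ℂ] Matrix (Fin 2) (Fin 2) Wick :=
  derHom (fun φ => (-1) ^ parity φ) dQGen (fun _ _ => rfl) dQGen_symm dQGen_wave
    (fun φ ψ s t => by
      rw [dQGen_comm_gen φ ψ s t, dQGen_comm_gen ψ φ t s]
      simp only [smul_mul_assoc, smul_add, smul_smul]
      rw [add_comm]
      congr 2
      · cases φ <;> cases ψ <;> simp [parity]
      · cases φ <;> cases ψ <;> simp [parity])

/-- The gauge variation `d_Q A = Q A - (-1)^{n_g(A)} A Q` of Wick polynomials: the graded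
derivation commuting with partial derivatives that has the given values on the fields. -/
noncomputable def dQ : Wick →ₗ[ℂ] Wick := upperRight dQHom

/-- The grading `A ↦ (-1)^{n_g(A)} A`. -/
noncomputable def grading : Wick →ₗ[ℂ] Wick where
  toFun A := dQHom A 0 0
  map_add' A B := by simp
  map_smul' r A := by simp

theorem lower_entries (ρ : Wick →ₐ[ℂ] Matrix (Fin 2) (Fin 2) Wick)
    (hρ : ∀ φ s, ρ (gen φ s) 1 0 = 0 ∧ ρ (gen φ s) 1 1 = gen φ s) (A : Wick) :
    ρ A 1 0 = 0 ∧ ρ A 1 1 = A := by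
  obtain ⟨x, rfl⟩ := RingQuot.mkAlgHom_surjective ℂ WickRel A
  induction x using FreeAlgebra.induction with
  | grade0 r => simp [Matrix.algebraMap_matrix_apply]
  | grade1 j => exact hρ j.1 j.2
  | mul a b ha hb =>
    simp [Matrix.mul_apply, Fin.sum_univ_two, ha.1, ha.2, hb.1, hb.2]
  | add a b ha hb => simp [ha.1, ha.2, hb.1, hb.2]

theorem derHom_gen {ε D h1 h2 h3 h4} (φ : Comp) (s : Multiset (Fin 4)) :
    derHom ε D h1 h2 h3 h4 (gen φ s) = !![ε φ • gen φ s, D φ s; 0, gen φ s] := by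
  simp [derHom, gen, derMat]

theorem partialHom_gen (μ : Fin 4) (φ : Comp) (s : Multiset (Fin 4)) :
    partialHom μ (gen φ s) = !![gen φ s, gen φ (μ ::ₘ s); 0, gen φ s] :=
  (derHom_gen φ s).trans (by rw [one_smul]; rfl)

theorem dQHom_gen (φ : Comp) (s : Multiset (Fin 4)) :
    dQHom (gen φ s) = !![(-1 : ℂ) ^ parity φ • gen φ s, dQGen φ s; 0, gen φ s] :=
  derHom_gen φ s

theorem partialD_gen (μ : Fin 4) (φ : Comp) (s : Multiset (Fin 4)) :
    partialD μ (gen φ s) = gen φ (μ ::ₘ s) := by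
  simp [partialD, upperRight, partialHom_gen]

theorem dQ_gen (φ : Comp) (s : Multiset (Fin 4)) : dQ (gen φ s) = dQGen φ s := by
  simp [dQ, upperRight, dQHom_gen]

theorem grading_gen (φ : Comp) (s : Multiset (Fin 4)) :
    grading (gen φ s) = (-1 : ℂ) ^ parity φ • gen φ s := by
  simp [grading, dQHom_gen]

theorem grading_mul (A B : Wick) : grading (A * B) = grading A * grading B := by
  have hB := lower_entries dQHom (fun φ s => by simp [dQHom_gen]) B
  simp [grading, Matrix.mul_apply, Fin.sum_univ_two, hB.1]

/-- The graded Leibniz rule of `d_Q`. -/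
theorem dQ_mul (A B : Wick) : dQ (A * B) = dQ A * B + grading A * dQ B := by
  have hB := lower_entries dQHom (fun φ s => by simp [dQHom_gen]) B
  simp [dQ, upperRight, grading, Matrix.mul_apply, Fin.sum_univ_two, hB.2, add_comm]

/-- The Leibniz rule of `∂_μ`. -/
theorem partialD_mul (μ : Fin 4) (A B : Wick) :
    partialD μ (A * B) = partialD μ A * B + A * partialD μ B := by
  have h0 : ∀ C : Wick, partialHom μ C 0 0 = C := by
    intro C
    obtain ⟨x, rfl⟩ := RingQuot.mkAlgHom_surjective ℂ WickRel C
    induction x using FreeAlgebra.induction with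
    | grade0 r => simp [Matrix.algebraMap_matrix_apply]
    | grade1 j =>
      change partialHom μ (gen j.1 j.2) 0 0 = gen j.1 j.2
      simp [partialHom_gen]
    | mul a b ha hb =>
      have hb' := lower_entries (partialHom μ) (fun φ s => by simp [partialHom_gen])
        (RingQuot.mkAlgHom ℂ WickRel b)
      simp [Matrix.mul_apply, Fin.sum_univ_two, ha, hb, hb'.1]
    | add a b ha hb => simp [ha, hb]
  have hB := lower_entries (partialHom μ) (fun φ s => by simp [partialHom_gen]) B
  simp [partialD, upperRight, Matrix.mul_apply, Fin.sum_univ_two, h0 A, hB.2, add_comm]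

/-!
### Couplings

From here on every index is an upper index: derivative indices are raised with the metric, and
each pair of equal indices is contracted with the metric (`Cₖ` contracts `k` pairs).
The list argument of a field collects its derivative indices.
-/

/-- `∂^{d₁} ⋯ ∂^{dₖ} h^{μν}` -/
noncomputable def h (μ ν : Fin 4) (d : List (Fin 4)) : Wick :=
  (d.map η).prod • gen (.h μ ν) (d : Multiset (Fin 4))

/-- `∂^{d₁} ⋯ ∂^{dₖ} u^μ` -/
noncomputable def u (μ : Fin 4) (d : List (Fin 4)) : Wick :=
  (d.map η).prod • gen (.u μ) (d : Multiset (Fin 4))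

/-- `∂^{d₁} ⋯ ∂^{dₖ} ũ^μ` -/
noncomputable def ut (μ : Fin 4) (d : List (Fin 4)) : Wick :=
  (d.map η).prod • gen (.ut μ) (d : Multiset (Fin 4))

/-- Derivatives `∂^{d₁} ⋯ ∂^{dₖ} h` of the trace `h = h^μ_μ`. -/
noncomputable def tr (d : List (Fin 4)) : Wick := ∑ μ, η μ • h μ μ d

/-- Metric contraction of one pair of upper indices. -/
noncomputable def C1 (f : Fin 4 → Wick) : Wick := ∑ μ, η μ • f μ

/-- Metric contraction of two pairs of upper indices. -/
noncomputable def C2 (f : Fin 4 → Fin 4 → Wick) : Wick := C1 fun μ => C1 (f μ)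

/-- Metric contraction of three pairs of upper indices. -/
noncomputable def C3 (f : Fin 4 → Fin 4 → Fin 4 → Wick) : Wick := C1 fun μ => C2 (f μ)

/-- Metric contraction of four pairs of upper indices. -/
noncomputable def C4 (f : Fin 4 → Fin 4 → Fin 4 → Fin 4 → Wick) : Wick := C1 fun μ => C3 (f μ)

/-- The trilinear graviton self-coupling `T₁ʰ` with parameters `a 1, …, a 12`. -/
noncomputable def T1h (a : ℕ → ℂ) : Wick :=
  a 1 • (C2 fun μ ν => h μ ν [μ] * tr [ν] * tr [])
    + a 2 • (C2 fun μ ν => h μ ν [] * tr [μ] * tr [ν])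
    + a 3 • (C3 fun α β μ => h α β [α] * h β μ [μ] * tr [])
    + a 4 • (C3 fun α β μ => h α β [α] * h β μ [] * tr [μ])
    + a 5 • (C3 fun α β μ => h α β [] * h β μ [α] * tr [μ])
    + a 6 • (C3 fun α β μ => h α β [μ] * h β μ [α] * tr [])
    + a 7 • (C4 fun μ ν α β => h μ ν [μ] * h α β [ν] * h α β [])
    + a 8 • (C4 fun μ ν α β => h μ ν [] * h α β [μ] * h α β [ν])
    + a 9 • (C4 fun μ ν α β => h μ ν [α] * h ν α [β] * h μ β [])
    + a 10 • (C4 fun μ ν α β => h μ ν [α] * h ν α [] * h μ β [β])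
    + a 11 • (C4 fun μ ν α β => h μ ν [] * h ν α [α] * h μ β [β])
    + a 12 • (C4 fun μ ν α β => h μ ν [] * h ν α [β] * h μ β [α])

/-- The ghost coupling `T₁ᵘ` with parameters `b 1, …, b 21`. -/
noncomputable def T1u (b : ℕ → ℂ) : Wick :=
  b 1 • (C3 fun ρ ν μ => u ρ [ν] * ut μ [ρ] * h μ ν [])
    + b 2 • (C3 fun ρ ν μ => u ρ [ν] * ut μ [] * h μ ν [ρ])
    + b 3 • (C3 fun ρ μ ν => u ρ [] * ut μ [ν] * h μ ν [ρ])
    + b 4 • (C3 fun ρ μ ν => u ρ [ρ] * ut μ [ν] * h μ ν [])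
    + b 5 • (C3 fun ρ μ ν => u ρ [ρ] * ut μ [] * h μ ν [ν])
    + b 6 • (C3 fun ρ μ ν => u ρ [] * ut μ [ρ] * h μ ν [ν])
    + b 7 • (C2 fun ρ μ => u ρ [μ] * ut μ [ρ] * tr [])
    + b 8 • (C2 fun ρ μ => u ρ [μ] * ut μ [] * tr [ρ])
    + b 9 • (C2 fun ρ μ => u ρ [] * ut μ [μ] * tr [ρ])
    + b 10 • (C2 fun ρ μ => u ρ [ρ] * ut μ [μ] * tr [])
    + b 11 • (C2 fun ρ μ => u ρ [ρ] * ut μ [] * tr [μ])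
    + b 12 • (C2 fun ρ μ => u ρ [] * ut μ [ρ] * tr [μ])
    + b 13 • (C3 fun ρ μ ν => u ρ [μ] * ut μ [ν] * h ρ ν [])
    + b 14 • (C3 fun ρ μ ν => u ρ [μ] * ut μ [] * h ρ ν [ν])
    + b 15 • (C3 fun ρ μ ν => u ρ [] * ut μ [μ] * h ρ ν [ν])
    + b 16 • (C3 fun ρ ν μ => u ρ [ν] * ut μ [μ] * h ρ ν [])
    + b 17 • (C3 fun ρ ν μ => u ρ [ν] * ut μ [] * h ρ ν [μ])
    + b 18 • (C3 fun ρ μ ν => u ρ [] * ut μ [ν] * h ρ ν [μ])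
    + b 19 • (C3 fun μ ν ρ => u μ [ν] * ut μ [ρ] * h ρ ν [])
    + b 20 • (C3 fun μ ν ρ => u μ [ν] * ut μ [] * h ρ ν [ρ])
    + b 21 • (C3 fun μ ν ρ => u μ [] * ut μ [ν] * h ρ ν [ρ])

/-- Terms of type `A` in the reduced Q-vertex. -/
noncomputable def vertexA (c : ℕ → ℂ) (μ : Fin 4) : Wick :=
  c 1 • (C3 fun α ρ σ => u μ [α] * h ρ σ [α] * h ρ σ [])
    + c 2 • (C3 fun ρ σ α => u μ [] * h ρ σ [α] * h ρ σ [α])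
    + c 5 • (C3 fun α ρ σ => u α [α] * h ρ σ [μ] * h ρ σ [])
    + c 6 • (C3 fun α ρ σ => u α [] * h ρ σ [α] * h ρ σ [μ])
    + c 7 • (C3 fun α ρ σ => u α [μ] * h ρ σ [α] * h ρ σ [])

/-- Terms of type `B` in the reduced Q-vertex. -/
noncomputable def vertexB (c : ℕ → ℂ) (μ : Fin 4) : Wick :=
  c 8 • (C1 fun α => u μ [α] * tr [α] * tr [])
    + c 9 • (C1 fun α => u μ [] * tr [α] * tr [α])
    + c 12 • (C1 fun α => u α [α] * tr [μ] * tr [])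
    + c 13 • (C1 fun α => u α [] * tr [α] * tr [μ])
    + c 14 • (C1 fun α => u α [μ] * tr [α] * tr [])

/-- Terms of type `C` in the reduced Q-vertex. -/
noncomputable def vertexC (c : ℕ → ℂ) (μ : Fin 4) : Wick :=
  c 15 • (C2 fun α ν => u α [ν] * h α μ [ν] * tr [])
    + c 16 • (C2 fun α ν => u α [ν] * h α μ [] * tr [ν])
    + c 17 • (C2 fun α ν => u α [] * h α μ [ν] * tr [ν])
    + c 21 • (C2 fun α ν => u α [ν] * h α ν [μ] * tr [])
    + c 22 • (C2 fun α ν => u α [ν] * h α ν [] * tr [μ])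
    + c 23 • (C2 fun α ν => u α [] * h α ν [ν] * tr [μ])
    + c 24 • (C2 fun α ν => u α [μ] * h α ν [ν] * tr [])
    + c 25 • (C2 fun α ν => u α [μ] * h α ν [] * tr [ν])
    + c 26 • (C2 fun α ν => u α [] * h α ν [μ] * tr [ν])

/-- Terms of type `D` in the reduced Q-vertex. -/
noncomputable def vertexD (c : ℕ → ℂ) (μ : Fin 4) : Wick :=
  c 27 • (C3 fun α ρ σ => u α [ρ] * h α σ [ρ] * h σ μ [])
    + c 28 • (C3 fun α ρ σ => u α [ρ] * h α σ [] * h σ μ [ρ])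
    + c 29 • (C3 fun α σ ρ => u α [] * h α σ [ρ] * h σ μ [ρ])
    + c 33 • (C3 fun α ρ σ => u α [ρ] * h α σ [μ] * h σ ρ [])
    + c 34 • (C3 fun α ρ σ => u α [ρ] * h α σ [] * h σ ρ [μ])
    + c 35 • (C3 fun α σ ρ => u α [] * h α σ [ρ] * h σ ρ [μ])
    + c 36 • (C3 fun α σ ρ => u α [μ] * h α σ [ρ] * h σ ρ [])
    + c 37 • (C3 fun α σ ρ => u α [μ] * h α σ [] * h σ ρ [ρ])
    + c 38 • (C3 fun α σ ρ => u α [] * h α σ [μ] * h σ ρ [ρ])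

/-- Terms of type `E` in the reduced Q-vertex. -/
noncomputable def vertexE (c : ℕ → ℂ) (μ : Fin 4) : Wick :=
  c 39 • (C3 fun α σ ρ => u α [σ, ρ] * h α ρ [] * h μ σ [])
    + c 40 • (C3 fun α ρ σ => u α [] * h α ρ [σ, ρ] * h μ σ [])
    + c 41 • (C3 fun α ρ σ => u α [] * h α ρ [] * h μ σ [σ, ρ])
    + c 42 • (C3 fun α σ ρ => u α [σ] * h α ρ [ρ] * h μ σ [])
    + c 43 • (C3 fun α σ ρ => u α [σ] * h α ρ [] * h μ σ [ρ])
    + c 44 • (C3 fun α ρ σ => u α [] * h α ρ [σ] * h μ σ [ρ])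
    + c 45 • (C3 fun α ρ σ => u α [ρ] * h α ρ [σ] * h μ σ [])
    + c 46 • (C3 fun α ρ σ => u α [ρ] * h α ρ [] * h μ σ [σ])
    + c 47 • (C3 fun α ρ σ => u α [] * h α ρ [ρ] * h μ σ [σ])
    + c 48 • (C3 fun α ρ σ => u α [ρ, σ] * h α μ [] * h σ ρ [])
    + c 49 • (C3 fun α ρ σ => u α [] * h α μ [ρ, σ] * h ρ σ [])
    + c 50 • (C3 fun α ρ σ => u α [] * h α μ [] * h ρ σ [ρ, σ])
    + c 51 • (C3 fun α ρ σ => u α [ρ] * h α μ [σ] * h ρ σ [])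
    + c 52 • (C3 fun α ρ σ => u α [ρ] * h α μ [] * h ρ σ [σ])
    + c 53 • (C3 fun α ρ σ => u α [] * h α μ [ρ] * h ρ σ [σ])

/-- Terms of type `F` in the reduced Q-vertex. -/
noncomputable def vertexF (c : ℕ → ℂ) (μ : Fin 4) : Wick :=
  c 54 • (C3 fun ρ σ ν => u ρ [σ, ρ] * h μ ν [] * h ν σ [])
    + c 55 • (C3 fun ρ ν σ => u ρ [] * h μ ν [σ, ρ] * h ν σ [])
    + c 56 • (C3 fun ρ ν σ => u ρ [] * h μ ν [] * h ν σ [σ, ρ])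
    + c 57 • (C3 fun ρ σ ν => u ρ [σ] * h μ ν [ρ] * h ν σ [])
    + c 58 • (C3 fun ρ σ ν => u ρ [σ] * h μ ν [] * h ν σ [ρ])
    + c 59 • (C3 fun ρ ν σ => u ρ [] * h μ ν [σ] * h ν σ [ρ])
    + c 60 • (C3 fun ρ ν σ => u ρ [ρ] * h μ ν [σ] * h ν σ [])
    + c 61 • (C3 fun ρ ν σ => u ρ [ρ] * h μ ν [] * h ν σ [σ])
    + c 62 • (C3 fun ρ ν σ => u ρ [] * h μ ν [ρ] * h ν σ [σ])
    + c 63 • (C3 fun ρ σ ν => u μ [ρ, σ] * h ρ ν [] * h ν σ [])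
    + c 64 • (C3 fun ρ ν σ => u μ [] * h ρ ν [ρ, σ] * h ν σ [])
    + c 65 • (C3 fun ρ ν σ => u μ [] * h ρ ν [σ] * h ν σ [ρ])
    + c 66 • (C3 fun ρ ν σ => u μ [ρ] * h ρ ν [σ] * h ν σ [])
    + c 67 • (C3 fun ρ ν σ => u μ [ρ] * h ρ ν [] * h ν σ [σ])
    + c 68 • (C3 fun ρ ν σ => u μ [] * h ρ ν [ρ] * h ν σ [σ])

/-- Terms of type `G` in the reduced Q-vertex. -/
noncomputable def vertexG (c : ℕ → ℂ) (μ : Fin 4) : Wick :=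
  c 69 • (C2 fun ρ σ => u ρ [σ, ρ] * h μ σ [] * tr [])
    + c 70 • (C2 fun ρ σ => u ρ [] * h μ σ [σ, ρ] * tr [])
    + c 71 • (C2 fun ρ σ => u ρ [] * h μ σ [] * tr [σ, ρ])
    + c 72 • (C2 fun ρ σ => u ρ [σ] * h μ σ [ρ] * tr [])
    + c 73 • (C2 fun ρ σ => u ρ [σ] * h μ σ [] * tr [ρ])
    + c 74 • (C2 fun ρ σ => u ρ [] * h μ σ [σ] * tr [ρ])
    + c 75 • (C2 fun ρ σ => u ρ [ρ] * h μ σ [σ] * tr [])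
    + c 76 • (C2 fun ρ σ => u ρ [ρ] * h μ σ [] * tr [σ])
    + c 77 • (C2 fun ρ σ => u ρ [] * h μ σ [ρ] * tr [σ])
    + c 78 • (C2 fun ρ σ => u μ [ρ, σ] * h ρ σ [] * tr [])
    + c 79 • (C2 fun ρ σ => u μ [] * h ρ σ [ρ, σ] * tr [])
    + c 80 • (C2 fun ρ σ => u μ [] * h ρ σ [] * tr [ρ, σ])
    + c 81 • (C2 fun ρ σ => u μ [ρ] * h ρ σ [σ] * tr [])
    + c 82 • (C2 fun ρ σ => u μ [ρ] * h ρ σ [] * tr [σ])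
    + c 83 • (C2 fun ρ σ => u μ [] * h ρ σ [ρ] * tr [σ])

/-- Terms of type `H` in the reduced Q-vertex. -/
noncomputable def vertexH (c : ℕ → ℂ) (μ : Fin 4) : Wick :=
  c 84 • (C2 fun σ α => u μ [σ] * ut α [σ] * u α [])
    + c 85 • (C2 fun σ α => u μ [σ] * ut α [] * u α [σ])
    + c 86 • (C2 fun α σ => u μ [] * ut α [σ] * u α [σ])
    + c 87 • (C2 fun σ α => u σ [σ] * ut α [μ] * u α [])
    + c 88 • (C2 fun σ α => u σ [σ] * ut α [] * u α [μ])
    + c 89 • (C2 fun σ α => u σ [] * ut α [σ] * u α [μ])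
    + c 90 • (C2 fun σ α => u σ [μ] * ut α [σ] * u α [])
    + c 91 • (C2 fun σ α => u σ [μ] * ut α [] * u α [σ])
    + c 92 • (C2 fun σ α => u σ [] * ut α [μ] * u α [σ])

/-- Terms of type `J` in the reduced Q-vertex. -/
noncomputable def vertexJ (c : ℕ → ℂ) (μ : Fin 4) : Wick :=
  c 96 • (C2 fun α ρ => u α [ρ] * ut μ [α] * u ρ [])
    + c 97 • (C2 fun α ρ => u α [α] * ut μ [ρ] * u ρ [])
    + c 98 • (C2 fun α ρ => u α [] * ut μ [ρ, α] * u ρ [])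
    + c 99 • (C2 fun α ρ => u α [ρ, α] * ut μ [] * u ρ [])
    + c 100 • (C2 fun ρ α => u ρ [α, ρ] * ut α [] * u μ [])
    + c 101 • (C2 fun ρ α => u ρ [] * ut α [α, ρ] * u μ [])
    + c 102 • (C2 fun ρ α => u ρ [] * ut α [] * u μ [α, ρ])
    + c 103 • (C2 fun ρ α => u ρ [α] * ut α [ρ] * u μ [])
    + c 104 • (C2 fun ρ α => u ρ [α] * ut α [] * u μ [ρ])
    + c 105 • (C2 fun ρ α => u ρ [] * ut α [α] * u μ [ρ])
    + c 106 • (C2 fun ρ α => u ρ [ρ] * ut α [α] * u μ [])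
    + c 107 • (C2 fun ρ α => u ρ [ρ] * ut α [] * u μ [α])
    + c 108 • (C2 fun ρ α => u ρ [] * ut α [ρ] * u μ [α])
    + c 109 • (C2 fun α ρ => u μ [] * ut α [α, ρ] * u ρ [])

/-- Terms of type `K` in the reduced Q-vertex. -/
noncomputable def vertexK (c : ℕ → ℂ) (μ : Fin 4) : Wick :=
  c 110 • (C2 fun σ α => u σ [α] * ut μ [α] * u σ [])
    + c 112 • (C2 fun σ α => u σ [α] * ut α [μ] * u σ [])
    + c 113 • (C2 fun σ α => u σ [α] * ut α [] * u σ [μ])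
    + c 114 • (C2 fun σ α => u σ [μ] * ut α [α] * u σ [])

/-- The reduced Q-vertex `T̃_{1/1}^μ`; the free constants keep the numbers they have in the full
ansatz with 114 monomials, of which 14 (numbers 3, 4, 10, 11, 18, 19, 20, 30, 31, 32, 93, 94, 95,
111) are eliminated. Only the remaining 100 values of `c` are used. -/
noncomputable def vertex (c : ℕ → ℂ) (μ : Fin 4) : Wick :=
  vertexA c μ + vertexB c μ + vertexC c μ + vertexD c μ + vertexE c μ + vertexF c μ
    + vertexG c μ + vertexH c μ + vertexJ c μ + vertexK c μ

/-- The divergence `∂_μ T^μ`. -/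
noncomputable def divergence (T : Fin 4 → Wick) : Wick := ∑ μ, partialD μ (T μ)

/-- The space of real coefficient vectors `(a₁, …, a₁₂, b₁, …, b₂₁)`. -/
abbrev Coeffs := Fin 33 → ℝ

/-- The coefficient `a_i` for `1 ≤ i ≤ 12`. -/
def aCoef (v : Coeffs) (i : ℕ) : ℝ := v (Fin.ofNat 33 (i - 1))

/-- The coefficient `b_j` for `1 ≤ j ≤ 21`. -/
def bCoef (v : Coeffs) (j : ℕ) : ℝ := v (Fin.ofNat 33 (j + 11))

/-- The first order coupling `T₁ = T₁ʰ + T₁ᵘ` with the given coefficients. -/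
noncomputable def T1 (v : Coeffs) : Wick :=
  T1h (fun i => (aCoef v i : ℂ)) + T1u (fun j => (bCoef v j : ℂ))

/-- The map reading off the coefficients of a coupling; meaningful because `T1` is injective,
which is part of the theorem. -/
noncomputable def f : Wick → Coeffs := Function.invFun T1

/-- Left hand sides of the fifteen linear relations. -/
noncomputable def relations : Coeffs →ₗ[ℝ] (Fin 15 → ℝ) where
  toFun v :=
    let a := aCoef v
    let b := bCoef v
    ![a 7 - 2 * a 8 - a 9 + a 12 - b 16 + b 17 - b 18,
      -2 * a 8 - a 9 - a 10 + a 11 + a 12 + b 14 - b 15 + b 17 - b 18 + b 20,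
      -2 * a 8 - a 9 - a 10 + a 11 + a 12 + b 14 + b 17 + b 20 - b 21,
      -2 * a 8 - 3 / 2 * a 9 - 1 / 2 * a 10 + a 12 + b 13 + b 17 - b 18,
      -2 * a 8 - 1 / 2 * a 9 - 3 / 2 * a 10 + a 11 + b 14 + b 17 + b 19 + b 20 - b 21,
      -a 10 + a 11 + b 14 + b 17 + b 20 - b 21,
      -a 4 - a 5 - a 9 - a 10 - b 2 + b 3 - b 4,
      -2 * a 3 - 2 * a 6 - a 9 - a 10 - a 11 - a 12 + b 3 - 2 * b 4 + 2 * b 5 - b 6,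
      a 5 - a 6,
      -a 4 + a 5 - 2 * a 6 - 1 / 2 * a 9 - 1 / 2 * a 10 - b 1 - b 4,
      -2 * a 2 - a 5 + a 6 - a 8 + b 8 + b 11,
      -2 * a 1 + 2 * a 2 - a 4 + 2 * a 5 - 3 * a 6 - a 7 + a 8 - b 8 - 2 * b 10 + b 11 - 2 * b 12,
      a 5 - a 6 - b 9 - b 12,
      -1 / 2 * a 4 + 3 / 2 * a 5 - 2 * a 6 + b 7 - b 8 - b 12,
      -2 * a 2 + a 5 - a 6 - a 8 - b 8 - b 11]
  map_add' v w := by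
    simp only [aCoef, bCoef, Pi.add_apply, Matrix.cons_add_cons, Matrix.empty_add_empty]
    repeat' refine congrArg₂ Matrix.vecCons (by ring) ?_
    rfl
  map_smul' r v := by
    simp only [aCoef, bCoef, Pi.smul_apply, smul_eq_mul, RingHom.id_apply, Matrix.smul_cons,
      Matrix.smul_empty]
    repeat' refine congrArg₂ Matrix.vecCons (by ring) ?_
    rfl

/-- The space `V` of solutions of the fifteen relations. -/
noncomputable def V : Submodule ℝ Coeffs := LinearMap.ker relations

/-- The linear map `L` of the vector
`(a₆, a₁₂, b₃, b₄, b₅, b₆, b₇, b₁₀, b₁₁, b₁₂, b₁₃, b₁₄, b₁₆, b₁₇, b₁₈, b₁₉, b₂₀, b₂₁)`. -/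
noncomputable def L : (Fin 18 → ℝ) →ₗ[ℝ] Coeffs where
  toFun p :=
    let a6 := p 0
    let a12 := p 1
    let b3 := p 2
    let b4 := p 3
    let b5 := p 4
    let b6 := p 5
    let b7 := p 6
    let b10 := p 7
    let b11 := p 8
    let b12 := p 9
    let b13 := p 10
    let b14 := p 11
    let b16 := p 12
    let b17 := p 13
    let b18 := p 14
    let b19 := p 15
    let b20 := p 16
    let b21 := p 17
    ![-b7 - b10 - 1 / 2 * (b16 - b17 + b18),
      1 / 4 * (b13 + b17 - b18 - b19),
      -a6 + 1 / 2 * b3 - b4 + b5 - 1 / 2 * (b6 + 3 * b13 - b14) - b17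
        + 1 / 2 * (3 * b18 - b19 + b20 - b21),
      -a6 + 2 * (b7 + b11 - b12),
      a6,
      a6,
      b16 - b17 + b18,
      1 / 2 * (-b13 - b17 + b18 + b19),
      a12 + b13 + b17 - b18 - b19,
      -a12 + b13 + b17 - b18 + b19,
      -a12 + b13 - b14 - b18 + b19 - b20 + b21,
      a12,
      -b4 - 2 * (b7 + b11 - b12) - b13 - b17 + b18,
      b3 - b4 - 2 * (b7 + b11 - b12 + b13 + b17 - b18),
      b3, b4, b5, b6, b7, -b11, -b12, b10, b11, b12, b13, b14, -b18 + b21, b16, b17, b18, b19,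
      b20, b21]
  map_add' p q := by
    simp only [Pi.add_apply, Matrix.cons_add_cons, Matrix.empty_add_empty]
    repeat' refine congrArg₂ Matrix.vecCons (by ring) ?_
    rfl
  map_smul' r p := by
    simp only [Pi.smul_apply, smul_eq_mul, RingHom.id_apply, Matrix.smul_cons,
      Matrix.smul_empty]
    repeat' refine congrArg₂ Matrix.vecCons (by ring) ?_
    rfl

end SpinTwo

/-!
Every monomial of `T₁`, of `d_Q T₁` and of the divergence of the Q-vertex is the metric contraction
of a product of three fields. Such a contraction is encoded by a list of pairs of index slots
(`contract`, `word`), and integral combinations of them (`Combo`) can be manipulated by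
computation: the gauge variation of `h^{μν}` becomes `gauge`, that of `ũ^μ` and the divergence add a
pair to the list (`varyUt`, `divCombo`), and `vanishes` tests whether a combination is zero
by the symmetry of `h^{μν}`, the wave equations and the (anti)commutation of the factors.

The relations are sufficient because the couplings whose gauge variation is the divergence of a
Q-vertex form a subspace (`solvable`), and for each of the 18 columns of `L` an explicit Q-vertex
does it (`solution`, `defect_vanishes`, `range_L_le`). The condition `d_Q ∂_μ T̃^μ = 0` is then
automatic since `d_Q² = 0` (`dQ_dQ`).

That they are necessary is seen on plane waves. Replacing one field by its value on a plane wave of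
null momentum is a graded derivation of the Wick algebra (`Wave.ins`); three of these give a linear
functional (`amplitude`), and the amplitude of a divergence vanishes if the momenta add up to zero
(`amplitude_divergence`). Amplitudes of contractions are products of Minkowski products
(`contract_coef`), so the amplitude of `d_Q T₁` for a ghost wave and two waves of the tensor field
is a linear form in the coefficients of `T₁`. For momenta `p`, `q`, `-p - q` with null vectors `p`,
`q`, `p + q`, fifteen choices of the polarizations give fifteen linear equations
equivalent to the relations (`solvable_le_V`).

The linear independence of the monomials of `T₁` also follows from amplitudes, now with momenta that
need not add up to zero: for each monomial there are three waves on which all others vanish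
(`isolates_H`, `isolates_U`). The statements on `V` and `L` are linear algebra; `range L ≤ V`
follows from the two inclusions `range L ≤ solvable ≤ V`.
-/

namespace SpinTwo

/-! ### Contraction of index slots -/

/-- An assignment of multisets of index values to the index slots of a monomial. In a product of
three fields, the slot `2 i` holds the tensor indices of the `i`-th factor and the slot `2 i + 1`
its derivative indices, where `i = 0, 1, 2`. -/
abbrev Slots := ℕ → Multiset (Fin 4)

/-- Put one more index value into the slot `z`. -/
def put (z : ℕ) (μ : Fin 4) (s : Slots) : Slots :=
  fun y => if y = z then μ ::ₘ s y else s y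

theorem put_comm (x y : ℕ) (μ ν : Fin 4) (s : Slots) :
    put x μ (put y ν s) = put y ν (put x μ s) := by
  funext w
  unfold put
  split_ifs <;> first | rfl | exact Multiset.cons_swap _ _ _

theorem put_of_ne {x z : ℕ} (hxz : x ≠ z) (μ : Fin 4) (s : Slots) : put x μ s z = s z := by
  simp [put, hxz.symm]

section Contract

variable {M N : Type*} [AddCommMonoid M] [Module ℂ M] [AddCommMonoid N] [Module ℂ N]

/-- Contract pairs of indices with the metric: for each pair of slots in the list, a summation index
is put into both slots. -/
noncomputable def contract : List (ℕ × ℕ) → (Slots → M) → M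
  | [], W => W fun _ => 0
  | p :: P, W => ∑ μ, η μ • contract P fun s => W (put p.1 μ (put p.2 μ s))

theorem contract_cons (x y : ℕ) (P : List (ℕ × ℕ)) (W : Slots → M) :
    contract ((x, y) :: P) W =
      ∑ μ, η μ • contract P fun s => W (put x μ (put y μ s)) := rfl

theorem map_contract (φ : M →ₗ[ℂ] N) (P : List (ℕ × ℕ)) (W : Slots → M) :
    φ (contract P W) = contract P fun s => φ (W s) := by
  induction P generalizing W with
  | nil => rfl
  | cons p P ih => simp [contract, ih]

theorem contract_add (P : List (ℕ × ℕ)) (W W' : Slots → M) :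
    (contract P fun s => W s + W' s) = contract P W + contract P W' := by
  induction P generalizing W W' with
  | nil => rfl
  | cons p P ih => simp [contract, ih, Finset.sum_add_distrib]

theorem contract_smul (P : List (ℕ × ℕ)) (r : ℂ) (W : Slots → M) :
    (contract P fun s => r • W s) = r • contract P W :=
  (map_contract (LinearMap.lsmul ℂ M r) P W).symm

theorem contract_zero (P : List (ℕ × ℕ)) : (contract P fun _ => (0 : M)) = 0 := by
  simpa using contract_smul P (0 : ℂ) fun _ => (0 : M)

theorem contract_sum {ι : Type*} (t : Finset ι) (P : List (ℕ × ℕ)) (W : ι → Slots → M) :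
    (contract P fun s => ∑ i ∈ t, W i s) = ∑ i ∈ t, contract P (W i) := by
  induction P generalizing W with
  | nil => rfl
  | cons p P ih => simp only [contract, ih, Finset.smul_sum]; exact Finset.sum_comm

theorem contract_perm {P Q : List (ℕ × ℕ)} (hPQ : P.Perm Q) (W : Slots → M) :
    contract P W = contract Q W := by
  induction hPQ generalizing W with
  | nil => rfl
  | cons p _ ih => simp only [contract, ih]
  | swap p q P =>
    simp only [contract, Finset.smul_sum]
    rw [Finset.sum_comm]
    refine Finset.sum_congr rfl fun μ _ => Finset.sum_congr rfl fun ν _ => ?_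
    rw [smul_comm]
    congr 3
    funext s
    rw [put_comm p.2 q.1, put_comm p.2 q.2, put_comm p.1 q.1, put_comm p.1 q.2]
  | trans _ _ ih₁ ih₂ => rw [ih₁, ih₂]

theorem contract_flip (x y : ℕ) (P : List (ℕ × ℕ)) (W : Slots → M) :
    contract ((x, y) :: P) W = contract ((y, x) :: P) W := by
  simp only [contract, put_comm x y]

theorem contract_map (e : Equiv.Perm ℕ) (P : List (ℕ × ℕ)) (W : Slots → M) :
    contract (P.map (Prod.map e e)) W = contract P fun s => W (s ∘ e.symm) := by
  have hput : ∀ x μ (s : Slots), put (e x) μ (s ∘ e.symm) = put x μ s ∘ e.symm := by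
    intro x μ s
    funext w
    simp [put, Equiv.symm_apply_eq]
  induction P generalizing W with
  | nil => rfl
  | cons p P ih => simp only [contract, List.map_cons, ih, Prod.map_fst, Prod.map_snd, hput]

/-- The number of times that a slot occurs in a list of pairs. -/
def slotCount (z : ℕ) : List (ℕ × ℕ) → ℕ
  | [] => 0
  | p :: P => (if p.1 = z then 1 else 0) + (if p.2 = z then 1 else 0) + slotCount z P

theorem card_put (x z : ℕ) (μ : Fin 4) (s : Slots) :
    (put x μ s z).card = (if x = z then 1 else 0) + (s z).card := by
  by_cases hxz : x = z
  · simp [put, hxz, add_comm]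
  · simp [put, hxz, Ne.symm hxz]

/-- In a contraction, only those fillings of the slots matter which fill every slot as often as it
occurs. -/
theorem contract_congr {P : List (ℕ × ℕ)} {W W' : Slots → M}
    (hW : ∀ s : Slots, (∀ z, (s z).card = slotCount z P) → W s = W' s) :
    contract P W = contract P W' := by
  induction P generalizing W W' with
  | nil => exact hW _ fun z => rfl
  | cons p P ih =>
    simp only [contract]
    refine Finset.sum_congr rfl fun μ _ => ?_
    congr 1
    refine ih fun s hs => hW _ fun z => ?_
    rw [card_put, card_put, hs, slotCount, add_assoc]

end Contract

/-- Induction on the construction of a Wick polynomial from the generators. -/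
theorem wick_induction {motive : Wick → Prop} (scalar : ∀ r, motive (algebraMap ℂ Wick r))
    (gen : ∀ φ s, motive (gen φ s)) (mul : ∀ A B, motive A → motive B → motive (A * B))
    (add : ∀ A B, motive A → motive B → motive (A + B)) (A : Wick) : motive A := by
  obtain ⟨x, rfl⟩ := RingQuot.mkAlgHom_surjective ℂ WickRel A
  induction x using FreeAlgebra.induction with
  | grade0 r => rw [AlgHom.commutes]; exact scalar r
  | grade1 j => exact gen j.1 j.2
  | mul a b ha hb => rw [map_mul]; exact mul _ _ ha hb
  | add a b ha hb => rw [map_add]; exact add _ _ ha hb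

/-! ### Fields -/

/-- The three kinds of fields. -/
inductive Kind where
  | h | u | ut
  deriving DecidableEq

/-- The derivative `∂^{d₁} ⋯ ∂^{dₖ} φ` of the field `φ` of the given kind with the given list of
tensor indices, all indices being upper ones; zero if the number of tensor indices is wrong. -/
noncomputable def fieldList : Kind → List (Fin 4) → Multiset (Fin 4) → Wick
  | .h, [μ, ν], d => (d.map η).prod • gen (.h μ ν) d
  | .u, [μ], d => (d.map η).prod • gen (.u μ) d
  | .ut, [μ], d => (d.map η).prod • gen (.ut μ) d
  | _, _, _ => 0

theorem fieldList_perm (k : Kind) (d : Multiset (Fin 4)) {l l' : List (Fin 4)} (hl : l.Perm l') :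
    fieldList k l d = fieldList k l' d := by
  have hlen := hl.length_eq
  match l, l', hlen with
  | [], [], _ => rfl
  | [a], [b], _ => rw [List.singleton_perm_singleton.1 hl]
  | [a, b], [a', b'], _ =>
    cases k <;> simp only [fieldList]
    rcases List.perm_pair.1 hl with hl | hl <;> obtain ⟨rfl, rfl⟩ : _ ∧ _ := by simpa using hl
    · rfl
    · rw [gen_symm]
  | _ :: _ :: _ :: _, _ :: _ :: _ :: _, _ => cases k <;> rfl

/-- The same with a multiset of tensor indices, by the symmetry of `h^{μν}`. -/
noncomputable def field (k : Kind) (p d : Multiset (Fin 4)) : Wick :=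
  Quotient.liftOn p (fieldList k · d) fun _ _ hl => fieldList_perm k d hl

/-- The product of three fields of the given kinds, with the indices in the slots `0, …, 5`. -/
noncomputable def word (k₀ k₁ k₂ : Kind) (s : Slots) : Wick :=
  field k₀ (s 0) (s 1) * field k₁ (s 2) (s 3) * field k₂ (s 4) (s 5)

/-- The upper-index metric. -/
def metric (μ ν : Fin 4) : ℂ := if μ = ν then η μ else 0

theorem η_mul_self (μ : Fin 4) : η μ * η μ = 1 := by
  unfold η; split_ifs <;> norm_num

theorem field_pair (μ ν : Fin 4) (d : Multiset (Fin 4)) :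
    field .h (μ ::ₘ ν ::ₘ 0) d = (d.map η).prod • gen (.h μ ν) d := rfl

theorem field_u (μ : Fin 4) (d : Multiset (Fin 4)) :
    field .u (μ ::ₘ 0) d = (d.map η).prod • gen (.u μ) d := rfl

/-- Parity of a kind of field. -/
def Kind.parity : Kind → ℕ
  | .h => 0
  | .u => 1
  | .ut => 1

/-- Number of tensor indices of a kind of field. -/
def Kind.rank : Kind → ℕ
  | .h => 2
  | .u => 1
  | .ut => 1

/-- The kind of a field component. -/
def Comp.kind : Comp → Kind
  | .h _ _ => .h
  | .u _ => .u
  | .ut _ => .ut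

/-- The tensor indices of a field component. -/
def Comp.indices : Comp → Multiset (Fin 4)
  | .h μ ν => μ ::ₘ ν ::ₘ 0
  | .u μ => μ ::ₘ 0
  | .ut μ => μ ::ₘ 0

theorem parity_eq (φ : Comp) : parity φ = φ.kind.parity := by cases φ <;> rfl

theorem field_comp (φ : Comp) (d : Multiset (Fin 4)) :
    field φ.kind φ.indices d = (d.map η).prod • gen φ d := by cases φ <;> rfl

/-- A field is a field component, up to raising the derivative indices, or it is zero because of a
wrong number of tensor indices. -/
theorem field_cases (k : Kind) (p : Multiset (Fin 4)) :
    (∃ φ : Comp, φ.kind = k ∧ φ.indices = p) ∨ ∀ d, field k p d = 0 := by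
  induction p using Quotient.inductionOn with | _ l
  match k, l with
  | .h, [μ, ν] => exact .inl ⟨.h μ ν, rfl, rfl⟩
  | .u, [μ] => exact .inl ⟨.u μ, rfl, rfl⟩
  | .ut, [μ] => exact .inl ⟨.ut μ, rfl, rfl⟩
  | .h, [] | .h, [_] | .h, _ :: _ :: _ :: _ | .u, [] | .u, _ :: _ :: _ | .ut, []
  | .ut, _ :: _ :: _ => exact .inr fun d => rfl

theorem field_comm (k k' : Kind) (p d p' d' : Multiset (Fin 4)) :
    field k p d * field k' p' d' =
      (-1 : ℂ) ^ (k.parity * k'.parity) • (field k' p' d' * field k p d) := by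
  rcases field_cases k p with ⟨φ, rfl, rfl⟩ | h0
  · rcases field_cases k' p' with ⟨ψ, rfl, rfl⟩ | h0
    · rw [field_comp, field_comp, smul_mul_smul_comm, smul_mul_smul_comm, gen_comm, smul_comm,
        mul_comm (d.map η).prod, parity_eq, parity_eq]
    · simp [h0]
  · simp [h0]

theorem grading_field (k : Kind) (p d : Multiset (Fin 4)) :
    grading (field k p d) = (-1 : ℂ) ^ k.parity • field k p d := by
  rcases field_cases k p with ⟨φ, rfl, rfl⟩ | h0
  · rw [field_comp, map_smul, grading_gen, smul_comm, parity_eq]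
  · simp [h0]

theorem partialD_field (μ : Fin 4) (k : Kind) (p d : Multiset (Fin 4)) :
    partialD μ (field k p d) = η μ • field k p (μ ::ₘ d) := by
  rcases field_cases k p with ⟨φ, rfl, rfl⟩ | h0
  · rw [field_comp, field_comp, map_smul, partialD_gen, Multiset.map_cons, Multiset.prod_cons,
      smul_smul, ← mul_assoc, η_mul_self, one_mul]
  · simp [h0]

theorem field_wave (k : Kind) (p d : Multiset (Fin 4)) :
    ∑ μ, η μ • field k p (μ ::ₘ μ ::ₘ d) = 0 := by
  rcases field_cases k p with ⟨φ, rfl, rfl⟩ | h0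
  · simp only [field_comp, Multiset.map_cons, Multiset.prod_cons, ← mul_assoc, η_mul_self,
      one_mul, smul_comm (η _), ← Finset.smul_sum, gen_wave, smul_zero]
  · simp [h0]

/-! ### The gauge variation of a field -/

theorem dQ_field_u (p d : Multiset (Fin 4)) : dQ (field .u p d) = 0 := by
  rcases field_cases .u p with ⟨φ, hφ, rfl⟩ | h0
  · rw [← hφ, field_comp, map_smul, dQ_gen]
    cases φ <;> cases hφ
    exact smul_zero _
  · simp [h0]

theorem dQ_field_ut (p d : Multiset (Fin 4)) :
    dQ (field .ut p d) = Complex.I • ∑ ν, η ν • field .h (ν ::ₘ p) (ν ::ₘ d) := by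
  induction p using Quotient.inductionOn with | _ l
  match l with
  | [μ] =>
    have h1 : ∀ ν, field .h (ν ::ₘ (⟦[μ]⟧ : Multiset (Fin 4))) (ν ::ₘ d) =
        (η ν * (d.map η).prod) • gen (.h μ ν) (ν ::ₘ d) := by
      intro ν
      rw [gen_symm, ← Multiset.prod_cons, ← Multiset.map_cons]
      rfl
    change dQ ((d.map η).prod • gen (.ut μ) d) = _
    simp only [h1, smul_smul, ← mul_assoc, η_mul_self, one_mul, map_smul, dQ_gen, dQGen,
      ← Finset.smul_sum]
    rw [mul_comm]
  | [] =>
    refine (map_zero dQ).trans ?_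
    rw [Finset.sum_eq_zero, smul_zero]
    exact fun ν _ => smul_zero _
  | _ :: _ :: _ =>
    refine (map_zero dQ).trans ?_
    rw [Finset.sum_eq_zero, smul_zero]
    exact fun ν _ => smul_zero _

theorem dQ_field_h (μ ν : Fin 4) (d : Multiset (Fin 4)) :
    dQ (field .h (μ ::ₘ ν ::ₘ 0) d) = (-(Complex.I / 2)) •
      (field .u (μ ::ₘ 0) (ν ::ₘ d) + field .u (ν ::ₘ 0) (μ ::ₘ d)
        - metric μ ν • ∑ α, η α • field .u (α ::ₘ 0) (α ::ₘ d)) := by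
  have hg : (if μ = ν then η μ else 0) = metric μ ν := rfl
  simp only [field_pair, field_u, map_smul, dQ_gen, dQGen, Multiset.map_cons, Multiset.prod_cons,
    smul_smul, ← mul_assoc, η_mul_self, one_mul, ← Finset.smul_sum, hg, smul_sub, smul_add]
  congr 2
  · congr 1
    ring
  · congr 1
    ring
  · ring

theorem wick_sub (A B : Wick) : A - B = A + (-1 : ℂ) • B :=
  (sub_eq_add_neg A B).trans (congrArg (A + ·) (neg_one_smul ℂ B).symm)

theorem field_h_comm (p d : Multiset (Fin 4)) (A : Wick) :
    field .h p d * A = A * field .h p d := by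
  rcases field_cases .h p with ⟨φ, hφ, rfl⟩ | h0
  · rw [← hφ, field_comp, smul_mul_assoc, mul_smul_comm]
    congr 1
    induction A using wick_induction with
    | scalar r => exact (Algebra.commutes r _).symm
    | gen ψ s =>
      rw [gen_comm, parity_eq φ, hφ, Kind.parity, zero_mul, pow_zero, one_smul]
    | mul A B hA hB => rw [← mul_assoc, hA, mul_assoc, hB, mul_assoc]
    | add A B hA hB => rw [mul_add, hA, hB, add_mul]
  · simp [h0]

/-! ### Nilpotency of the gauge variation -/

theorem dQ_dQGen (φ : Comp) (s : Multiset (Fin 4)) : dQ (dQGen φ s) = 0 := by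
  cases φ with
  | h μ ν => simp only [dQGen, map_smul, map_sub, map_add, map_sum, dQ_gen, Finset.sum_const_zero,
      smul_zero, add_zero, sub_zero]
  | u μ => exact map_zero dQ
  | ut μ =>
    have h1 : ∑ ν, η ν • gen (.u μ) (ν ::ₘ ν ::ₘ s) = 0 := gen_wave _ s
    have h2 : ∑ ν, (if μ = ν then η μ else 0) • ∑ α, gen (.u α) (α ::ₘ ν ::ₘ s) =
        ∑ ν, η μ • gen (.u ν) (μ ::ₘ ν ::ₘ s) := by
      simp [ite_smul, Finset.smul_sum, Multiset.cons_swap μ]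
    simp only [dQGen, map_smul, map_sum, dQ_gen, ← Finset.smul_sum, Finset.sum_sub_distrib,
      Finset.sum_add_distrib, h1, h2, zero_add, sub_self, smul_zero]

theorem grading_dQGen (φ : Comp) (s : Multiset (Fin 4)) :
    grading (dQGen φ s) = (-1 : ℂ) • (-1 : ℂ) ^ parity φ • dQGen φ s := by
  cases φ with
  | h μ ν =>
    simp only [dQGen, wick_sub, map_smul, map_add, map_sum, grading_gen, parity, pow_one,
      pow_zero, one_mul, ← Finset.smul_sum, smul_add, smul_smul, mul_comm, mul_left_comm]
  | u μ => rw [dQGen, map_zero, smul_zero, smul_zero]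
  | ut μ =>
    simp only [dQGen, map_smul, map_sum, grading_gen, parity, pow_one, pow_zero,
      smul_smul, one_smul, neg_mul, one_mul, neg_neg]

/-- The gauge variation is nilpotent. -/
theorem dQ_dQ (A : Wick) : dQ (dQ A) = 0 := by
  -- The grading anticommutes with `dQ`; this makes the cross terms of the Leibniz rule cancel.
  suffices dQ (dQ A) = 0 ∧ grading (dQ A) = (-1 : ℂ) • dQ (grading A) from this.1
  have cancel (B : Wick) : (-1 : ℂ) • B + B = 0 := by
    nth_rewrite 2 [← one_smul ℂ B]
    rw [← add_smul, neg_add_cancel, zero_smul]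
  induction A using wick_induction with
  | scalar r => simp [dQ, upperRight, grading, Matrix.algebraMap_matrix_apply]
  | gen φ s =>
    rw [dQ_gen, grading_gen, map_smul, dQ_gen]
    exact ⟨dQ_dQGen _ _, grading_dQGen _ _⟩
  | mul A B hA hB =>
    simp only [dQ_mul, grading_mul, map_add, hA.1, hA.2, hB.1, hB.2, zero_mul, mul_zero, add_zero,
      zero_add, smul_mul_assoc, mul_smul_comm, cancel, smul_add, and_self]
  | add A B hA hB =>
    simp only [map_add, hA.1, hA.2, hB.1, hB.2, add_zero, smul_add, and_self]

/-! ### Combinations of contractions and the variation of one factor -/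

section

variable {M : Type*} [AddCommMonoid M] [Module ℂ M]

/-- A formal integral combination of contractions. -/
abbrev Combo := List (ℤ × List (ℕ × ℕ))

/-- The value of a formal combination, for contractions of `W`. -/
noncomputable def Combo.eval (W : Slots → M) : Combo → M
  | [] => 0
  | t :: L => (t.1 : ℂ) • contract t.2 W + Combo.eval W L

theorem Combo.eval_append (W : Slots → M) (L L' : Combo) :
    Combo.eval W (L ++ L') = Combo.eval W L + Combo.eval W L' := by
  induction L with
  | nil => simp [eval]
  | cons t L ih => simp [eval, ih, add_assoc]

/-- Multiply all coefficients by an integer. -/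
def Combo.scale (n : ℤ) (L : Combo) : Combo := L.map fun t => (n * t.1, t.2)

theorem Combo.eval_scale (W : Slots → M) (n : ℤ) (L : Combo) :
    Combo.eval W (Combo.scale n L) = (n : ℂ) • Combo.eval W L := by
  induction L with
  | nil => simp [scale, eval]
  | cons t L ih =>
    change ((n * t.1 : ℤ) : ℂ) • _ + Combo.eval W (Combo.scale n L) = _
    rw [ih, eval, smul_add, smul_smul, Int.cast_mul]

/-- Find the slot that is paired with the slot `z`, and the remaining pairs. -/
def extract (z : ℕ) : List (ℕ × ℕ) → Option (ℕ × List (ℕ × ℕ))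
  | [] => none
  | p :: P =>
    if p.2 = z then some (p.1, P)
    else if p.1 = z then some (p.2, P)
    else (extract z P).map fun r => (r.1, p :: r.2)

theorem contract_extract {z x : ℕ} {P R : List (ℕ × ℕ)} (h : extract z P = some (x, R))
    (W : Slots → M) : contract P W = contract ((x, z) :: R) W := by
  induction P generalizing R W with
  | nil => simp [extract] at h
  | cons p P ih =>
    obtain ⟨y, y'⟩ := p
    rw [extract] at h
    split_ifs at h with h2 h1
    · obtain ⟨rfl, rfl⟩ : _ ∧ _ := by simpa using h
      cases h2
      rfl
    · obtain ⟨rfl, rfl⟩ : _ ∧ _ := by simpa using h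
      cases h1
      exact contract_flip _ _ _ _
    · obtain ⟨⟨x', R'⟩, hR, hx⟩ := Option.map_eq_some_iff.1 h
      obtain ⟨rfl, rfl⟩ : _ ∧ _ := by simpa using hx
      rw [contract_perm (List.Perm.swap _ _ _), contract, contract]
      simp only [ih hR]

/-- Replace the symmetric tensor `h^{μν}` in the slots `z` (tensor indices) and `d` (derivatives)
by `∂^ν u^μ + ∂^μ u^ν - η^{μν} ∂_α u^α`. If both tensor indices are contracted with each other, this
is `(2 - 4) ∂_α u^α`. -/
def gauge (z d : ℕ) (P : List (ℕ × ℕ)) : Combo :=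
  match extract z P with
  | none => []
  | some (x, R) =>
    if x = z then [(-2, (z, d) :: R)]
    else match extract z R with
      | none => []
      | some (y, R) =>
        [(1, (x, z) :: (y, d) :: R), (1, (y, z) :: (x, d) :: R), (-1, (x, y) :: (z, d) :: R)]

/-- The slot `z` occurs exactly twice. -/
def twice (z : ℕ) (P : List (ℕ × ℕ)) : Bool :=
  match extract z P with
  | none => false
  | some (x, R) =>
    if x = z then slotCount z R == 0
    else match extract z R with
      | none => false
      | some (y, R) => y != z && slotCount z R == 0

theorem sum_metric (c : ℂ) (F : Fin 4 → Fin 4 → M) :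
    ∑ μ, η μ • ∑ ν, η ν • c • metric μ ν • F μ ν = c • ∑ μ, η μ • F μ μ := by
  rw [Finset.smul_sum]
  refine Finset.sum_congr rfl fun μ _ => ?_
  rw [Finset.sum_eq_single μ (fun ν _ hν => by simp [metric, hν.symm]) (by simp), metric,
    if_pos rfl, smul_comm (η μ) c, smul_smul (η μ) (η μ), η_mul_self, one_smul, smul_comm]

/-- If filling the slot `z` of `W` with two indices gives the gauge variation of a symmetric tensor,
expressed by `W'`, then the contraction of `W` is that of `W'` according to `gauge`. -/
theorem contract_gauge {z d : ℕ} (hzd : d ≠ z) {κ : ℂ} {W W' : Slots → M}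
    (hW : ∀ s : Slots, s z = 0 → ∀ μ ν, W (put z μ (put z ν s)) = κ •
      (W' (put z μ (put d ν s)) + W' (put z ν (put d μ s)) +
        (-1 : ℂ) • metric μ ν • ∑ α, η α • W' (put z α (put d α s))))
    {P : List (ℕ × ℕ)} (hP : twice z P = true) :
    contract P W = κ • Combo.eval W' (gauge z d P) := by
  have empty : ∀ {R : List (ℕ × ℕ)} {s : Slots}, slotCount z R = 0 →
      (∀ y, (s y).card = slotCount y R) → s z = 0 := fun hR hs =>
    Multiset.card_eq_zero.1 ((hs z).trans hR)
  rw [twice] at hP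
  rcases h1 : extract z P with _ | ⟨x, R⟩
  · simp [h1] at hP
  rw [contract_extract h1]
  simp only [h1] at hP
  by_cases hx : x = z
  · subst hx
    rw [if_pos rfl, beq_iff_eq] at hP
    simp only [gauge, h1, if_pos, Combo.eval, add_zero]
    have : ∀ μ, (contract R fun s => W (put x μ (put x μ s))) =
        κ • ((2 : ℂ) • (contract R fun s => W' (put x μ (put d μ s))) +
          (-1 : ℂ) • η μ • ∑ α, η α • contract R fun s => W' (put x α (put d α s))) := by
      intro μ
      simp only [← contract_smul, ← contract_add, ← contract_sum]
      refine contract_congr fun s hs => ?_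
      rw [hW s (empty hP hs), metric, if_pos rfl, two_smul]
    rw [contract_cons, contract_cons]
    simp only [this]
    -- what remains is `∑ μ, η μ * η μ = 4`
    generalize (fun μ => contract R fun s => W' (put x μ (put d μ s))) = F
    simp only [Fin.sum_univ_four, η]
    simp
    module
  · rw [if_neg hx] at hP
    rcases h2 : extract z R with _ | ⟨y, R'⟩
    · simp [h2] at hP
    simp only [h2, Bool.and_eq_true, bne_iff_ne, ne_eq, beq_iff_eq] at hP
    obtain ⟨hy, hP⟩ := hP
    simp only [gauge, h1, h2, if_neg hx, Combo.eval, add_zero]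
    have key : ∀ μ ν, (contract R' fun s => W (put x μ (put z μ (put y ν (put z ν s))))) =
        κ • ((contract R' fun s => W' (put x μ (put z μ (put y ν (put d ν s))))) +
          (contract R' fun s => W' (put y ν (put z ν (put x μ (put d μ s))))) +
          (-1 : ℂ) • metric μ ν • ∑ α, η α •
            contract R' fun s => W' (put x μ (put y ν (put z α (put d α s))))) := by
      intro μ ν
      simp only [← contract_smul, ← contract_add, ← contract_sum]
      refine contract_congr fun s hs => ?_
      have h0 : put x μ (put y ν s) z = 0 := by rw [put_of_ne hx, put_of_ne hy, empty hP hs]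
      have h3 := hW _ h0 μ ν
      simp only [put_comm] at h3 ⊢
      exact h3
    have e1 : contract ((x, z) :: R) W = contract ((x, z) :: (y, z) :: R') W := by
      rw [contract_cons, contract_cons]
      simp only [contract_extract h2]
    rw [e1]
    simp only [contract_cons, key, smul_comm _ κ, ← Finset.smul_sum, Int.cast_neg, Int.cast_one,
      one_smul]
    congr 1
    -- only the linearity in this scalar matters
    generalize (-1 : ℂ) = c
    simp only [smul_add, Finset.sum_add_distrib]
    rw [sum_metric c fun μ ν => ∑ α, η α •
            contract R' fun s => W' (put x μ (put y ν (put z α (put d α s))))]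
    rw [add_assoc]
    congr 2
    simp only [Finset.smul_sum]
    rw [Finset.sum_comm]
    exact Finset.sum_congr rfl fun ν _ => Finset.sum_congr rfl fun μ _ => smul_comm _ _ _

end

/-! ### Words in the fields -/

/-- The relabelling of the slots that exchanges the factors `i` and `j` of a word. -/
def exch (i j : ℕ) : Equiv.Perm ℕ :=
  Equiv.swap (2 * i) (2 * j) * Equiv.swap (2 * i + 1) (2 * j + 1)

/-- Relabel all slots of a list of pairs. -/
def relabel (e : Equiv.Perm ℕ) (P : List (ℕ × ℕ)) : List (ℕ × ℕ) := P.map (Prod.map e e)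

/-- The variation of the contraction `P` of three factors `h`, in units of `-i/2`, as a combination
of contractions of `u h h`: the varied factor is moved to the front. -/
def varyH (P : List (ℕ × ℕ)) : Combo :=
  gauge 0 1 P ++ (gauge 0 1 (relabel (exch 0 1) P) ++ gauge 0 1 (relabel (exch 0 2) P))

theorem dQ_word_hhh (s : Slots) : dQ (word .h .h .h s) =
    dQ (field .h (s 0) (s 1)) * field .h (s 2) (s 3) * field .h (s 4) (s 5) +
      (dQ (field .h (s 2) (s 3)) * field .h (s 0) (s 1) * field .h (s 4) (s 5) +
        dQ (field .h (s 4) (s 5)) * field .h (s 2) (s 3) * field .h (s 0) (s 1)) := by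
  simp only [word, dQ_mul, grading_mul, grading_field, Kind.parity, pow_zero, one_smul, add_mul]
  rw [field_h_comm (s 0) (s 1) (dQ (field .h (s 2) (s 3))),
    field_h_comm (s 0) (s 1) (field .h (s 2) (s 3)), mul_assoc (field .h (s 2) (s 3)),
    field_h_comm (s 0) (s 1) (dQ (field .h (s 4) (s 5))), ← mul_assoc,
    field_h_comm (s 2) (s 3) (dQ (field .h (s 4) (s 5))), add_assoc]

theorem dQ_word_u_ut_h (s : Slots) : dQ (word .u .ut .h s) =
    (-1 : ℂ) • (field .u (s 0) (s 1) * dQ (field .ut (s 2) (s 3)) * field .h (s 4) (s 5)) +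
      field .u (s 0) (s 1) * field .ut (s 2) (s 3) * dQ (field .h (s 4) (s 5)) := by
  simp only [word, dQ_mul, grading_mul, grading_field, Kind.parity, pow_one, dQ_field_u, zero_mul,
    zero_add, smul_mul_assoc, mul_smul_comm, smul_smul, neg_mul, one_mul, neg_neg, one_smul]

theorem contract_dQ_hhh {P : List (ℕ × ℕ)} (hP : twice 0 P = true) :
    (contract P fun s =>
      dQ (field .h (s 0) (s 1)) * field .h (s 2) (s 3) * field .h (s 4) (s 5)) =
      (-(Complex.I / 2)) • Combo.eval (word .u .h .h) (gauge 0 1 P) := by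
  refine contract_gauge (by decide) (fun s hs μ ν => ?_) hP
  change dQ (field .h (μ ::ₘ ν ::ₘ s 0) (s 1)) * field .h (s 2) (s 3) * field .h (s 4) (s 5) =
    _ • (field .u (μ ::ₘ s 0) (ν ::ₘ s 1) * field .h (s 2) (s 3) * field .h (s 4) (s 5) +
      field .u (ν ::ₘ s 0) (μ ::ₘ s 1) * field .h (s 2) (s 3) * field .h (s 4) (s 5) +
      (-1 : ℂ) • metric μ ν • ∑ α, η α •
        (field .u (α ::ₘ s 0) (α ::ₘ s 1) * field .h (s 2) (s 3) * field .h (s 4) (s 5)))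
  simp only [hs, dQ_field_h, wick_sub, smul_mul_assoc, add_mul, Finset.sum_mul]

theorem contract_dQ_u_ut_h {P : List (ℕ × ℕ)} (hP : twice 4 P = true) :
    (contract P fun s =>
      field .u (s 0) (s 1) * field .ut (s 2) (s 3) * dQ (field .h (s 4) (s 5))) =
      (-(Complex.I / 2)) • Combo.eval (word .u .ut .u) (gauge 4 5 P) := by
  refine contract_gauge (by decide) (fun s hs μ ν => ?_) hP
  change field .u (s 0) (s 1) * field .ut (s 2) (s 3) * dQ (field .h (μ ::ₘ ν ::ₘ s 4) (s 5)) =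
    _ • (field .u (s 0) (s 1) * field .ut (s 2) (s 3) * field .u (μ ::ₘ s 4) (ν ::ₘ s 5) +
      field .u (s 0) (s 1) * field .ut (s 2) (s 3) * field .u (ν ::ₘ s 4) (μ ::ₘ s 5) +
      (-1 : ℂ) • metric μ ν • ∑ α, η α •
        (field .u (s 0) (s 1) * field .ut (s 2) (s 3) * field .u (α ::ₘ s 4) (α ::ₘ s 5)))
  simp only [hs, dQ_field_h, wick_sub, mul_smul_comm, mul_add, Finset.mul_sum]

theorem dQ_contract_hhh {P : List (ℕ × ℕ)} (h0 : twice 0 P = true)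
    (h1 : twice 0 (relabel (exch 0 1) P) = true) (h2 : twice 0 (relabel (exch 0 2) P) = true) :
    dQ (contract P (word .h .h .h)) =
      (-(Complex.I / 2)) • Combo.eval (word .u .h .h) (varyH P) := by
  rw [varyH, Combo.eval_append, Combo.eval_append, smul_add, smul_add, ← contract_dQ_hhh h0,
    ← contract_dQ_hhh h1, ← contract_dQ_hhh h2, relabel, relabel, contract_map, contract_map,
    map_contract]
  simp only [dQ_word_hhh, contract_add]
  rfl

/-- The variation of `ũ` in the contraction `P` of `u ũ h`, in units of `-i/2`. The coefficient
comes from `d_Q ũ^μ = i ∂_ν h^{μν}` and the sign for passing `u`: `-i = 2 (-i/2)`. -/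
def varyUt (P : List (ℕ × ℕ)) : Combo := [(2, (2, 3) :: P)]

theorem dQ_contract_u_ut_h {P : List (ℕ × ℕ)} (hP : twice 4 P = true) :
    dQ (contract P (word .u .ut .h)) = (-(Complex.I / 2)) •
      (Combo.eval (word .u .h .h) (varyUt P) + Combo.eval (word .u .ut .u) (gauge 4 5 P)) := by
  rw [smul_add, ← contract_dQ_u_ut_h hP, map_contract]
  simp only [dQ_word_u_ut_h, contract_add]
  congr 1
  simp only [varyUt, Combo.eval, add_zero, contract_cons, contract_smul, dQ_field_ut,
    mul_smul_comm, smul_mul_assoc, Finset.mul_sum, Finset.sum_mul, contract_sum]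
  rw [smul_smul, smul_smul]
  congr 1
  · push_cast; ring

/-! ### Divergences -/

theorem partialD_word (μ : Fin 4) (k₀ k₁ k₂ : Kind) (s : Slots) :
    partialD μ (word k₀ k₁ k₂ s) = η μ • (word k₀ k₁ k₂ (put 1 μ s) +
      (word k₀ k₁ k₂ (put 3 μ s) + word k₀ k₁ k₂ (put 5 μ s))) := by
  rw [word, partialD_mul, partialD_mul, partialD_field, partialD_field, partialD_field, add_mul,
    smul_mul_assoc, smul_mul_assoc, mul_smul_comm, smul_mul_assoc, mul_smul_comm, ← smul_add,
    ← smul_add, add_assoc]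
  rfl

/-- The divergence of the contraction `P` with free index in the slot `x`. -/
def divCombo (x : ℕ) (P : List (ℕ × ℕ)) : Combo :=
  [(1, (x, 1) :: P), (1, (x, 3) :: P), (1, (x, 5) :: P)]

theorem divergence_contract (k₀ k₁ k₂ : Kind) (x : ℕ) (P : List (ℕ × ℕ)) :
    (divergence fun μ => contract P fun s => word k₀ k₁ k₂ (put x μ s)) =
      Combo.eval (word k₀ k₁ k₂) (divCombo x P) := by
  simp only [divergence, map_contract, partialD_word, contract_smul, contract_add, divCombo,
    Combo.eval, Int.cast_one, one_smul, add_zero, contract_cons, smul_add, Finset.sum_add_distrib]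
  simp only [put_comm]

/-! ### Symmetries of words -/

theorem word_u_h_h_exch (s : Slots) : word .u .h .h (s ∘ (exch 1 2).symm) = word .u .h .h s := by
  change field .u (s 0) (s 1) * field .h (s 4) (s 5) * field .h (s 2) (s 3) = _
  rw [word, mul_assoc, mul_assoc, field_h_comm]

theorem word_u_ut_u_exch (s : Slots) :
    word .u .ut .u (s ∘ (exch 0 2).symm) = (-1 : ℂ) • word .u .ut .u s := by
  change field .u (s 4) (s 5) * field .ut (s 2) (s 3) * field .u (s 0) (s 1) = _
  rw [word, field_comm .u .ut (s 4), smul_mul_assoc, mul_assoc, field_comm .u .u (s 4),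
    mul_smul_comm, ← mul_assoc, field_comm .ut .u (s 2), smul_mul_assoc]
  simp only [Kind.parity, smul_smul]
  congr 1
  norm_num

/-- Contractions with a d'Alembertian on one factor vanish. -/
theorem contract_wave {i : ℕ} (hi : i = 1 ∨ i = 3 ∨ i = 5) (k₀ k₁ k₂ : Kind) {P : List (ℕ × ℕ)}
    (h : (i, i) ∈ P) : contract P (word k₀ k₁ k₂) = 0 := by
  rw [contract_perm (List.perm_cons_erase h), contract_cons]
  simp only [← contract_smul, ← contract_sum]
  convert contract_zero _ with s
  rcases hi with rfl | rfl | rfl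
  · change ∑ μ, η μ • (field k₀ (s 0) (μ ::ₘ μ ::ₘ s 1) * field k₁ (s 2) (s 3) *
      field k₂ (s 4) (s 5)) = 0
    simp only [← smul_mul_assoc, ← Finset.sum_mul, field_wave, zero_mul]
  · change ∑ μ, η μ • (field k₀ (s 0) (s 1) * field k₁ (s 2) (μ ::ₘ μ ::ₘ s 3) *
      field k₂ (s 4) (s 5)) = 0
    have h1 : ∀ μ, η μ • (field k₀ (s 0) (s 1) * field k₁ (s 2) (μ ::ₘ μ ::ₘ s 3) *
        field k₂ (s 4) (s 5)) = field k₀ (s 0) (s 1) *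
        (η μ • field k₁ (s 2) (μ ::ₘ μ ::ₘ s 3)) * field k₂ (s 4) (s 5) := fun μ => by
      rw [mul_smul_comm, smul_mul_assoc]
    simp only [h1, ← Finset.sum_mul, ← Finset.mul_sum, field_wave, mul_zero, zero_mul]
  · change ∑ μ, η μ • (field k₀ (s 0) (s 1) * field k₁ (s 2) (s 3) *
      field k₂ (s 4) (μ ::ₘ μ ::ₘ s 5)) = 0
    simp only [← mul_smul_comm, ← Finset.mul_sum, field_wave, mul_zero]

/-! ### Deciding that a combination of contractions vanishes -/

/-- Sort each pair and then the list of pairs. -/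
def normalForm (P : List (ℕ × ℕ)) : List (ℕ × ℕ) :=
  (P.map fun p => if p.1 ≤ p.2 then p else (p.2, p.1)).insertionSort
    fun p q => 6 * p.1 + p.2 ≤ 6 * q.1 + q.2

theorem contract_normalForm (P : List (ℕ × ℕ)) (W : Slots → Wick) :
    contract (normalForm P) W = contract P W := by
  rw [normalForm, contract_perm (List.perm_insertionSort _ _)]
  induction P generalizing W with
  | nil => rfl
  | cons p P ih =>
    obtain ⟨x, y⟩ := p
    rw [List.map_cons]
    split_ifs
    · simp only [contract, ih]
    · rw [contract_flip]
      simp only [contract, ih]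

/-- Add a term to a combination, merging it with a term for the same list. -/
def addTerm (t : ℤ × List (ℕ × ℕ)) : Combo → Combo
  | [] => [t]
  | t' :: L => if t.2 = t'.2 then (t.1 + t'.1, t'.2) :: L else t' :: addTerm t L

theorem eval_addTerm (W : Slots → Wick) (t : ℤ × List (ℕ × ℕ)) (L : Combo) :
    Combo.eval W (addTerm t L) = (t.1 : ℂ) • contract t.2 W + Combo.eval W L := by
  induction L with
  | nil => rfl
  | cons t' L ih =>
    rw [addTerm]
    split_ifs with h
    · simp only [Combo.eval, h]
      rw [Int.cast_add, add_smul, add_assoc]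
    · rw [Combo.eval, ih, Combo.eval, add_left_comm]

/-- Drop the terms that vanish by the wave equation, and replace every other term by the sum of
its normal form and that of its image under the symmetry `e`, which has the sign `ε`. -/
def symmetrize (e : Equiv.Perm ℕ) (ε : ℤ) : Combo → Combo
  | [] => []
  | t :: L =>
    if (1, 1) ∈ t.2 ∨ (3, 3) ∈ t.2 ∨ (5, 5) ∈ t.2 then symmetrize e ε L
    else addTerm (t.1, normalForm t.2)
      (addTerm (ε * t.1, normalForm (relabel e t.2)) (symmetrize e ε L))

theorem eval_symmetrize {e : Equiv.Perm ℕ} {ε : ℤ} {k₀ k₁ k₂ : Kind}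
    (he : ∀ s, word k₀ k₁ k₂ (s ∘ e.symm) = (ε : ℂ) • word k₀ k₁ k₂ s) (hε : ε * ε = 1)
    (L : Combo) : Combo.eval (word k₀ k₁ k₂) (symmetrize e ε L) =
      (2 : ℂ) • Combo.eval (word k₀ k₁ k₂) L := by
  have hε' : (ε : ℂ) * ε = 1 := by exact_mod_cast hε
  induction L with
  | nil => exact (smul_zero _).symm
  | cons t L ih =>
    rw [symmetrize]
    split_ifs with h
    · have h0 : contract t.2 (word k₀ k₁ k₂) = 0 := by
        rcases h with h | h | h
        · exact contract_wave (.inl rfl) _ _ _ h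
        · exact contract_wave (.inr (.inl rfl)) _ _ _ h
        · exact contract_wave (.inr (.inr rfl)) _ _ _ h
      rw [ih, Combo.eval, h0, smul_zero, zero_add]
    · rw [eval_addTerm, eval_addTerm, contract_normalForm, contract_normalForm, ih, relabel,
        contract_map, Combo.eval]
      simp only [he, contract_smul]
      rw [smul_smul, Int.cast_mul, mul_right_comm, hε', one_mul, ← add_assoc, ← two_smul ℂ,
        ← smul_add]

/-- The test that the combination `L` vanishes. It is applied to twice the combination, so that the
symmetry of the factors need not be built into the normal form. -/
def vanishes (e : Equiv.Perm ℕ) (ε : ℤ) (L : Combo) : Bool :=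
  (symmetrize e ε L).all fun t => t.1 == 0

theorem eval_eq_zero {e : Equiv.Perm ℕ} {ε : ℤ} {k₀ k₁ k₂ : Kind}
    (he : ∀ s, word k₀ k₁ k₂ (s ∘ e.symm) = (ε : ℂ) • word k₀ k₁ k₂ s) (hε : ε * ε = 1)
    {L : Combo} (hL : vanishes e ε L = true) : Combo.eval (word k₀ k₁ k₂) L = 0 := by
  have h0 : ∀ L : Combo, (L.all fun t => t.1 == 0) = true →
      Combo.eval (word k₀ k₁ k₂) L = 0 := by
    intro L
    induction L with
    | nil => exact fun _ => rfl
    | cons t L ih =>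
      intro h
      rw [List.all_cons, Bool.and_eq_true, beq_iff_eq] at h
      rw [Combo.eval, ih h.2, h.1, Int.cast_zero, zero_smul, add_zero]
  have h2 := (eval_symmetrize he hε L).symm.trans (h0 _ hL)
  rw [← one_smul ℂ (Combo.eval _ L), show (1 : ℂ) = 2⁻¹ * 2 by norm_num, ← smul_smul, h2,
    smul_zero]

/-! ### The couplings and the Q-vertex as combinations of contractions -/

/-- The index pairs contracted in the monomials of `T1h`, with the numbers of the coefficients. -/
def tableH : List (ℕ × List (ℕ × ℕ)) :=
  [(1, [(0, 1), (0, 3), (2, 2), (4, 4)]), (2, [(0, 3), (0, 5), (2, 2), (4, 4)]),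
    (3, [(0, 1), (0, 2), (2, 3), (4, 4)]), (4, [(0, 1), (0, 2), (2, 5), (4, 4)]),
    (5, [(0, 3), (0, 2), (2, 5), (4, 4)]), (6, [(0, 3), (0, 2), (1, 2), (4, 4)]),
    (7, [(0, 1), (0, 3), (2, 4), (2, 4)]), (8, [(0, 3), (0, 5), (2, 4), (2, 4)]),
    (9, [(0, 4), (0, 2), (1, 2), (3, 4)]), (10, [(0, 4), (0, 2), (1, 2), (4, 5)]),
    (11, [(0, 4), (0, 2), (2, 3), (4, 5)]), (12, [(0, 4), (0, 2), (2, 5), (3, 4)])]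

/-- The index pairs contracted in the monomials of `T1u`, with the numbers of the coefficients. -/
def tableU : List (ℕ × List (ℕ × ℕ)) :=
  [(1, [(0, 3), (1, 4), (2, 4)]), (2, [(0, 5), (1, 4), (2, 4)]), (3, [(0, 5), (2, 4), (3, 4)]),
    (4, [(0, 1), (2, 4), (3, 4)]), (5, [(0, 1), (2, 4), (4, 5)]), (6, [(0, 3), (2, 4), (4, 5)]),
    (7, [(0, 3), (1, 2), (4, 4)]), (8, [(0, 5), (1, 2), (4, 4)]), (9, [(0, 5), (2, 3), (4, 4)]),
    (10, [(0, 1), (2, 3), (4, 4)]), (11, [(0, 1), (2, 5), (4, 4)]),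
    (12, [(0, 3), (2, 5), (4, 4)]), (13, [(0, 4), (1, 2), (3, 4)]),
    (14, [(0, 4), (1, 2), (4, 5)]), (15, [(0, 4), (2, 3), (4, 5)]),
    (16, [(0, 4), (1, 4), (2, 3)]), (17, [(0, 4), (1, 4), (2, 5)]),
    (18, [(0, 4), (2, 5), (3, 4)]), (19, [(0, 2), (1, 4), (3, 4)]),
    (20, [(0, 2), (1, 4), (4, 5)]), (21, [(0, 2), (3, 4), (4, 5)])]

/-- The monomials of `vertexA`: the number of the constant, the slot of the free index, and the
pairs of contracted indices. -/
def tableVertexA : List (ℕ × ℕ × List (ℕ × ℕ)) :=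
  [(1, 0, [(1, 3), (2, 4), (2, 4)]), (2, 0, [(2, 4), (2, 4), (3, 5)]),
    (5, 3, [(0, 1), (2, 4), (2, 4)]), (6, 5, [(0, 3), (2, 4), (2, 4)]),
    (7, 1, [(0, 3), (2, 4), (2, 4)])]

/-- The monomials of `vertexB`, encoded as in `tableVertexA`. -/
def tableVertexB : List (ℕ × ℕ × List (ℕ × ℕ)) :=
  [(8, 0, [(1, 3), (2, 2), (4, 4)]), (9, 0, [(3, 5), (2, 2), (4, 4)]),
    (12, 3, [(0, 1), (2, 2), (4, 4)]), (13, 5, [(0, 3), (2, 2), (4, 4)]),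
    (14, 1, [(0, 3), (2, 2), (4, 4)])]

/-- The monomials of `vertexC`, encoded as in `tableVertexA`. -/
def tableVertexC : List (ℕ × ℕ × List (ℕ × ℕ)) :=
  [(15, 2, [(0, 2), (1, 3), (4, 4)]), (16, 2, [(0, 2), (1, 5), (4, 4)]),
    (17, 2, [(0, 2), (3, 5), (4, 4)]), (21, 3, [(0, 2), (1, 2), (4, 4)]),
    (22, 5, [(0, 2), (1, 2), (4, 4)]), (23, 5, [(0, 2), (2, 3), (4, 4)]),
    (24, 1, [(0, 2), (2, 3), (4, 4)]), (25, 1, [(0, 2), (2, 5), (4, 4)]),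
    (26, 3, [(0, 2), (2, 5), (4, 4)])]

/-- The monomials of `vertexD`, encoded as in `tableVertexA`. -/
def tableVertexD : List (ℕ × ℕ × List (ℕ × ℕ)) :=
  [(27, 4, [(0, 2), (1, 3), (2, 4)]), (28, 4, [(0, 2), (1, 5), (2, 4)]),
    (29, 4, [(0, 2), (2, 4), (3, 5)]), (33, 3, [(0, 2), (1, 4), (2, 4)]),
    (34, 5, [(0, 2), (1, 4), (2, 4)]), (35, 5, [(0, 2), (2, 4), (3, 4)]),
    (36, 1, [(0, 2), (2, 4), (3, 4)]), (37, 1, [(0, 2), (2, 4), (4, 5)]),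
    (38, 3, [(0, 2), (2, 4), (4, 5)])]

/-- The monomials of `vertexE`, encoded as in `tableVertexA`. -/
def tableVertexE : List (ℕ × ℕ × List (ℕ × ℕ)) :=
  [(39, 4, [(0, 2), (1, 4), (1, 2)]), (40, 4, [(0, 2), (2, 3), (3, 4)]),
    (41, 4, [(0, 2), (2, 5), (4, 5)]), (42, 4, [(0, 2), (1, 4), (2, 3)]),
    (43, 4, [(0, 2), (1, 4), (2, 5)]), (44, 4, [(0, 2), (2, 5), (3, 4)]),
    (45, 4, [(0, 2), (1, 2), (3, 4)]), (46, 4, [(0, 2), (1, 2), (4, 5)]),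
    (47, 4, [(0, 2), (2, 3), (4, 5)]), (48, 2, [(0, 2), (1, 4), (1, 4)]),
    (49, 2, [(0, 2), (3, 4), (3, 4)]), (50, 2, [(0, 2), (4, 5), (4, 5)]),
    (51, 2, [(0, 2), (1, 4), (3, 4)]), (52, 2, [(0, 2), (1, 4), (4, 5)]),
    (53, 2, [(0, 2), (3, 4), (4, 5)])]

/-- The monomials of `vertexF`, encoded as in `tableVertexA`. -/
def tableVertexF : List (ℕ × ℕ × List (ℕ × ℕ)) :=
  [(54, 2, [(0, 1), (1, 4), (2, 4)]), (55, 2, [(0, 3), (2, 4), (3, 4)]),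
    (56, 2, [(0, 5), (2, 4), (4, 5)]), (57, 2, [(0, 3), (1, 4), (2, 4)]),
    (58, 2, [(0, 5), (1, 4), (2, 4)]), (59, 2, [(0, 5), (2, 4), (3, 4)]),
    (60, 2, [(0, 1), (2, 4), (3, 4)]), (61, 2, [(0, 1), (2, 4), (4, 5)]),
    (62, 2, [(0, 3), (2, 4), (4, 5)]), (63, 0, [(1, 2), (1, 4), (2, 4)]),
    (64, 0, [(2, 3), (2, 4), (3, 4)]), (65, 0, [(2, 5), (2, 4), (3, 4)]),
    (66, 0, [(1, 2), (2, 4), (3, 4)]), (67, 0, [(1, 2), (2, 4), (4, 5)]),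
    (68, 0, [(2, 3), (2, 4), (4, 5)])]

/-- The monomials of `vertexG`, encoded as in `tableVertexA`. -/
def tableVertexG : List (ℕ × ℕ × List (ℕ × ℕ)) :=
  [(69, 2, [(0, 1), (1, 2), (4, 4)]), (70, 2, [(0, 3), (2, 3), (4, 4)]),
    (71, 2, [(0, 5), (2, 5), (4, 4)]), (72, 2, [(0, 3), (1, 2), (4, 4)]),
    (73, 2, [(0, 5), (1, 2), (4, 4)]), (74, 2, [(0, 5), (2, 3), (4, 4)]),
    (75, 2, [(0, 1), (2, 3), (4, 4)]), (76, 2, [(0, 1), (2, 5), (4, 4)]),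
    (77, 2, [(0, 3), (2, 5), (4, 4)]), (78, 0, [(1, 2), (1, 2), (4, 4)]),
    (79, 0, [(2, 3), (2, 3), (4, 4)]), (80, 0, [(2, 5), (2, 5), (4, 4)]),
    (81, 0, [(1, 2), (2, 3), (4, 4)]), (82, 0, [(1, 2), (2, 5), (4, 4)]),
    (83, 0, [(2, 3), (2, 5), (4, 4)])]

/-- The monomials of `vertexH`, encoded as in `tableVertexA`. -/
def tableVertexH : List (ℕ × ℕ × List (ℕ × ℕ)) :=
  [(84, 0, [(1, 3), (2, 4)]), (85, 0, [(1, 5), (2, 4)]), (86, 0, [(2, 4), (3, 5)]),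
    (87, 3, [(0, 1), (2, 4)]), (88, 5, [(0, 1), (2, 4)]), (89, 5, [(0, 3), (2, 4)]),
    (90, 1, [(0, 3), (2, 4)]), (91, 1, [(0, 5), (2, 4)]), (92, 3, [(0, 5), (2, 4)])]

/-- The monomials of `vertexJ`, encoded as in `tableVertexA`. -/
def tableVertexJ : List (ℕ × ℕ × List (ℕ × ℕ)) :=
  [(96, 2, [(0, 3), (1, 4)]), (97, 2, [(0, 1), (3, 4)]), (98, 2, [(0, 3), (3, 4)]),
    (99, 2, [(0, 1), (1, 4)]), (100, 4, [(0, 1), (1, 2)]), (101, 4, [(0, 3), (2, 3)]),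
    (102, 4, [(0, 5), (2, 5)]), (103, 4, [(0, 3), (1, 2)]), (104, 4, [(0, 5), (1, 2)]),
    (105, 4, [(0, 5), (2, 3)]), (106, 4, [(0, 1), (2, 3)]), (107, 4, [(0, 1), (2, 5)]),
    (108, 4, [(0, 3), (2, 5)]), (109, 0, [(2, 3), (3, 4)])]

/-- The monomials of `vertexK`, encoded as in `tableVertexA`. -/
def tableVertexK : List (ℕ × ℕ × List (ℕ × ℕ)) :=
  [(110, 2, [(0, 4), (1, 3)]), (112, 3, [(0, 4), (1, 2)]), (113, 5, [(0, 4), (1, 2)]),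
    (114, 1, [(0, 4), (2, 3)])]

section

variable {ι M N : Type*} [AddCommMonoid M] [Module ℂ M] [AddCommMonoid N] [Module ℂ N]

/-- The sum of the terms `a i • F x` over the entries `(i, x)` of a table, as a linear map in the
coefficients `a`. -/
noncomputable def tableSum (F : ι → M) (T : List (ℕ × ι)) : (ℕ → ℂ) →ₗ[ℂ] M :=
  (T.map fun t => (LinearMap.proj t.1 : (ℕ → ℂ) →ₗ[ℂ] ℂ).smulRight (F t.2)).sum

theorem tableSum_nil (F : ι → M) (a : ℕ → ℂ) : tableSum F [] a = 0 := rfl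

theorem tableSum_cons (F : ι → M) (t : ℕ × ι) (T : List (ℕ × ι)) (a : ℕ → ℂ) :
    tableSum F (t :: T) a = a t.1 • F t.2 + tableSum F T a := rfl

theorem tableSum_append (F : ι → M) (T T' : List (ℕ × ι)) (a : ℕ → ℂ) :
    tableSum F (T ++ T') a = tableSum F T a + tableSum F T' a := by
  rw [tableSum, List.map_append, List.sum_append]
  rfl

theorem map_tableSum (φ : M →ₗ[ℂ] N) (F : ι → M) (T : List (ℕ × ι)) (a : ℕ → ℂ) :
    φ (tableSum F T a) = tableSum (fun x => φ (F x)) T a := by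
  induction T with
  | nil => exact map_zero φ
  | cons t T ih => rw [tableSum_cons, map_add, map_smul, ih, tableSum_cons]

theorem tableSum_congr {F G : ι → M} {T : List (ℕ × ι)} (h : ∀ t ∈ T, F t.2 = G t.2)
    (a : ℕ → ℂ) : tableSum F T a = tableSum G T a := by
  rw [tableSum, tableSum, List.map_congr_left fun t ht => by rw [h t ht]]

end

theorem C1_mul (f : Fin 4 → Wick) (A : Wick) : C1 f * A = C1 fun μ => f μ * A := by
  simp only [C1, Finset.sum_mul, smul_mul_assoc]

theorem mul_C1 (A : Wick) (f : Fin 4 → Wick) : A * C1 f = C1 fun μ => A * f μ := by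
  simp only [C1, Finset.mul_sum, mul_smul_comm]

theorem h_symm (μ ν : Fin 4) (d : List (Fin 4)) : h μ ν d = h ν μ d := by
  rw [h, h, gen_symm]

theorem h_swap (μ ν α β : Fin 4) : h μ ν [α, β] = h μ ν [β, α] := by
  change field .h (μ ::ₘ ν ::ₘ 0) (α ::ₘ β ::ₘ 0) = field .h (μ ::ₘ ν ::ₘ 0) (β ::ₘ α ::ₘ 0)
  rw [Multiset.cons_swap α]

theorem u_swap (μ α β : Fin 4) : u μ [α, β] = u μ [β, α] := by
  change field .u (μ ::ₘ 0) (α ::ₘ β ::ₘ 0) = field .u (μ ::ₘ 0) (β ::ₘ α ::ₘ 0)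
  rw [Multiset.cons_swap α]

theorem ut_swap (μ α β : Fin 4) : ut μ [α, β] = ut μ [β, α] := by
  change field .ut (μ ::ₘ 0) (α ::ₘ β ::ₘ 0) = field .ut (μ ::ₘ 0) (β ::ₘ α ::ₘ 0)
  rw [Multiset.cons_swap α]

theorem tr_eq_C1 (d : List (Fin 4)) : tr d = C1 fun μ => h μ μ d := rfl

theorem mul_tr_mul_tr (A : Wick) (d d' : List (Fin 4)) :
    A * tr d * tr d' = C1 fun μ => C1 fun ν => A * h μ μ d * h ν ν d' := by
  simp only [tr_eq_C1, mul_C1, C1_mul]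
  simp only [C1, Finset.smul_sum]
  rw [Finset.sum_comm]
  exact Finset.sum_congr rfl fun μ _ => Finset.sum_congr rfl fun ν _ => smul_comm _ _ _

theorem mul_tr (A B : Wick) (d : List (Fin 4)) :
    A * B * tr d = C1 fun μ => A * B * h μ μ d := mul_C1 _ _

/-- The table for `T1h` is correct. Here and below, the contraction is hidden behind a variable `F`
while the table is expanded; then every term is the defining sum of the monomial. -/
theorem T1h_eq {F : List (ℕ × ℕ) → Wick}
    (hF : ∀ P, contract P (word .h .h .h) = F P) (a : ℕ → ℂ) :
    T1h a = tableSum F tableH a := by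
  simp only [T1h, tableH, tableSum_cons, tableSum_nil, add_zero, add_assoc]
  repeat' refine congrArg₂ HAdd.hAdd (congrArg (HSMul.hSMul _) ?_) ?_
  on_goal -1 => refine congrArg (HSMul.hSMul _) ?_
  all_goals rw [← hF]
  all_goals try simp only [mul_tr_mul_tr]
  all_goals try simp only [mul_tr]
  all_goals rfl

theorem T1u_eq {F : List (ℕ × ℕ) → Wick}
    (hF : ∀ P, contract P (word .u .ut .h) = F P) (a : ℕ → ℂ) :
    T1u a = tableSum F tableU a := by
  simp only [T1u, tableU, tableSum_cons, tableSum_nil, add_zero, add_assoc]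
  repeat' refine congrArg₂ HAdd.hAdd (congrArg (HSMul.hSMul _) ?_) ?_
  on_goal -1 => refine congrArg (HSMul.hSMul _) ?_
  all_goals rw [← hF]
  all_goals try simp only [mul_tr, h_symm]
  all_goals rfl

theorem vertexA_eq {μ : Fin 4} {F : ℕ × List (ℕ × ℕ) → Wick}
    (hF : ∀ q, (contract q.2 fun s => word .u .h .h (put q.1 μ s)) = F q) (c : ℕ → ℂ) :
    vertexA c μ = tableSum F tableVertexA c := by
  simp only [vertexA, tableVertexA, tableSum_cons, tableSum_nil, add_zero, add_assoc]
  repeat' refine congrArg₂ HAdd.hAdd (congrArg (HSMul.hSMul _) ?_) ?_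
  on_goal -1 => refine congrArg (HSMul.hSMul _) ?_
  all_goals rw [← hF]
  all_goals rfl

theorem vertexB_eq {μ : Fin 4} {F : ℕ × List (ℕ × ℕ) → Wick}
    (hF : ∀ q, (contract q.2 fun s => word .u .h .h (put q.1 μ s)) = F q) (c : ℕ → ℂ) :
    vertexB c μ = tableSum F tableVertexB c := by
  simp only [vertexB, tableVertexB, tableSum_cons, tableSum_nil, add_zero, add_assoc]
  repeat' refine congrArg₂ HAdd.hAdd (congrArg (HSMul.hSMul _) ?_) ?_
  on_goal -1 => refine congrArg (HSMul.hSMul _) ?_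
  all_goals rw [← hF]
  all_goals try simp only [mul_tr_mul_tr]
  all_goals rfl

theorem vertexC_eq {μ : Fin 4} {F : ℕ × List (ℕ × ℕ) → Wick}
    (hF : ∀ q, (contract q.2 fun s => word .u .h .h (put q.1 μ s)) = F q) (c : ℕ → ℂ) :
    vertexC c μ = tableSum F tableVertexC c := by
  simp only [vertexC, tableVertexC, tableSum_cons, tableSum_nil, add_zero, add_assoc]
  repeat' refine congrArg₂ HAdd.hAdd (congrArg (HSMul.hSMul _) ?_) ?_
  on_goal -1 => refine congrArg (HSMul.hSMul _) ?_
  all_goals rw [← hF]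
  all_goals try simp only [mul_tr, h_symm]
  all_goals rfl

theorem vertexD_eq {μ : Fin 4} {F : ℕ × List (ℕ × ℕ) → Wick}
    (hF : ∀ q, (contract q.2 fun s => word .u .h .h (put q.1 μ s)) = F q) (c : ℕ → ℂ) :
    vertexD c μ = tableSum F tableVertexD c := by
  simp only [vertexD, tableVertexD, tableSum_cons, tableSum_nil, add_zero, add_assoc]
  repeat' refine congrArg₂ HAdd.hAdd (congrArg (HSMul.hSMul _) ?_) ?_
  on_goal -1 => refine congrArg (HSMul.hSMul _) ?_
  all_goals rw [← hF]
  all_goals try simp only [h_symm]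
  all_goals rfl

theorem vertexE_eq {μ : Fin 4} {F : ℕ × List (ℕ × ℕ) → Wick}
    (hF : ∀ q, (contract q.2 fun s => word .u .h .h (put q.1 μ s)) = F q) (c : ℕ → ℂ) :
    vertexE c μ = tableSum F tableVertexE c := by
  simp only [vertexE, tableVertexE, tableSum_cons, tableSum_nil, add_zero, add_assoc]
  repeat' refine congrArg₂ HAdd.hAdd (congrArg (HSMul.hSMul _) ?_) ?_
  on_goal -1 => refine congrArg (HSMul.hSMul _) ?_
  all_goals rw [← hF]
  all_goals try simp only [h_symm, h_swap]
  all_goals rfl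

theorem vertexF_eq {μ : Fin 4} {F : ℕ × List (ℕ × ℕ) → Wick}
    (hF : ∀ q, (contract q.2 fun s => word .u .h .h (put q.1 μ s)) = F q) (c : ℕ → ℂ) :
    vertexF c μ = tableSum F tableVertexF c := by
  simp only [vertexF, tableVertexF, tableSum_cons, tableSum_nil, add_zero, add_assoc]
  repeat' refine congrArg₂ HAdd.hAdd (congrArg (HSMul.hSMul _) ?_) ?_
  on_goal -1 => refine congrArg (HSMul.hSMul _) ?_
  all_goals rw [← hF]
  all_goals try simp only [h_symm, h_swap, u_swap]
  all_goals rfl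

theorem vertexG_eq {μ : Fin 4} {F : ℕ × List (ℕ × ℕ) → Wick}
    (hF : ∀ q, (contract q.2 fun s => word .u .h .h (put q.1 μ s)) = F q) (c : ℕ → ℂ) :
    vertexG c μ = tableSum F tableVertexG c := by
  simp only [vertexG, tableVertexG, tableSum_cons, tableSum_nil, add_zero, add_assoc]
  repeat' refine congrArg₂ HAdd.hAdd (congrArg (HSMul.hSMul _) ?_) ?_
  on_goal -1 => refine congrArg (HSMul.hSMul _) ?_
  all_goals rw [← hF]
  all_goals try simp only [mul_tr, h_swap, u_swap]
  all_goals rfl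

theorem vertexH_eq {μ : Fin 4} {F : ℕ × List (ℕ × ℕ) → Wick}
    (hF : ∀ q, (contract q.2 fun s => word .u .ut .u (put q.1 μ s)) = F q) (c : ℕ → ℂ) :
    vertexH c μ = tableSum F tableVertexH c := by
  simp only [vertexH, tableVertexH, tableSum_cons, tableSum_nil, add_zero, add_assoc]
  repeat' refine congrArg₂ HAdd.hAdd (congrArg (HSMul.hSMul _) ?_) ?_
  on_goal -1 => refine congrArg (HSMul.hSMul _) ?_
  all_goals rw [← hF]
  all_goals rfl

theorem vertexJ_eq {μ : Fin 4} {F : ℕ × List (ℕ × ℕ) → Wick}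
    (hF : ∀ q, (contract q.2 fun s => word .u .ut .u (put q.1 μ s)) = F q) (c : ℕ → ℂ) :
    vertexJ c μ = tableSum F tableVertexJ c := by
  simp only [vertexJ, tableVertexJ, tableSum_cons, tableSum_nil, add_zero, add_assoc]
  repeat' refine congrArg₂ HAdd.hAdd (congrArg (HSMul.hSMul _) ?_) ?_
  on_goal -1 => refine congrArg (HSMul.hSMul _) ?_
  all_goals rw [← hF]
  all_goals try simp only [u_swap, ut_swap]
  all_goals rfl

theorem vertexK_eq {μ : Fin 4} {F : ℕ × List (ℕ × ℕ) → Wick}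
    (hF : ∀ q, (contract q.2 fun s => word .u .ut .u (put q.1 μ s)) = F q) (c : ℕ → ℂ) :
    vertexK c μ = tableSum F tableVertexK c := by
  simp only [vertexK, tableVertexK, tableSum_cons, tableSum_nil, add_zero, add_assoc]
  repeat' refine congrArg₂ HAdd.hAdd (congrArg (HSMul.hSMul _) ?_) ?_
  on_goal -1 => refine congrArg (HSMul.hSMul _) ?_
  all_goals rw [← hF]
  all_goals rfl

/-! ### Gauge variation of the couplings and divergence of the Q-vertex -/

/-- The integral combination of the combinations `g x`, for the entries `(i, x)` of a table, with
the coefficients `r i`. -/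
def Combo.ofTable {ι : Type*} (r : ℕ → ℤ) (g : ι → Combo) (T : List (ℕ × ι)) : Combo :=
  T.flatMap fun t => if r t.1 = 0 then [] else Combo.scale (r t.1) (g t.2)

theorem Combo.eval_ofTable {ι : Type*} (W : Slots → Wick) (r : ℕ → ℤ) (g : ι → Combo)
    (T : List (ℕ × ι)) : Combo.eval W (Combo.ofTable r g T) =
      tableSum (fun x => Combo.eval W (g x)) T fun i => (r i : ℂ) := by
  induction T with
  | nil => rfl
  | cons t T ih =>
    have h0 : ofTable r g (t :: T) =
      (if r t.1 = 0 then [] else scale (r t.1) (g t.2)) ++ ofTable r g T := rfl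
    rw [h0, eval_append, ih, tableSum_cons]
    congr 1
    split_ifs with h
    · rw [h, Int.cast_zero, zero_smul]
      rfl
    · rw [eval_scale]

/-- The table of the monomials of the Q-vertex with the fields `u h h`. -/
def tableUHH : List (ℕ × ℕ × List (ℕ × ℕ)) :=
  tableVertexA ++ (tableVertexB ++ (tableVertexC ++ (tableVertexD ++ (tableVertexE ++
    (tableVertexF ++ tableVertexG)))))

/-- The table of the monomials of the Q-vertex with the fields `u ũ u`. -/
def tableUUU : List (ℕ × ℕ × List (ℕ × ℕ)) := tableVertexH ++ (tableVertexJ ++ tableVertexK)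

theorem vertex_eq (c : ℕ → ℂ) (μ : Fin 4) : vertex c μ =
    tableSum (fun q => contract q.2 fun s => word .u .h .h (put q.1 μ s)) tableUHH c +
      tableSum (fun q => contract q.2 fun s => word .u .ut .u (put q.1 μ s)) tableUUU c := by
  have hF : ∀ q : ℕ × List (ℕ × ℕ), (contract q.2 fun s => word .u .h .h (put q.1 μ s)) =
    (contract q.2 fun s => word .u .h .h (put q.1 μ s)) := fun _ => rfl
  have hG : ∀ q : ℕ × List (ℕ × ℕ), (contract q.2 fun s => word .u .ut .u (put q.1 μ s)) =
    (contract q.2 fun s => word .u .ut .u (put q.1 μ s)) := fun _ => rfl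
  rw [vertex, vertexA_eq hF, vertexB_eq hF, vertexC_eq hF, vertexD_eq hF, vertexE_eq hF,
    vertexF_eq hF, vertexG_eq hF, vertexH_eq hG, vertexJ_eq hG, vertexK_eq hG, tableUHH, tableUUU]
  simp only [tableSum_append, add_assoc]

theorem divergence_vertex (c : ℕ → ℂ) : divergence (vertex c) =
    tableSum (fun q => Combo.eval (word .u .h .h) (divCombo q.1 q.2)) tableUHH c +
      tableSum (fun q => Combo.eval (word .u .ut .u) (divCombo q.1 q.2)) tableUUU c := by
  have key : ∀ (k₀ k₁ k₂ : Kind) (T : List (ℕ × ℕ × List (ℕ × ℕ))),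
      (∑ μ, partialD μ
        (tableSum (fun q => contract q.2 fun s => word k₀ k₁ k₂ (put q.1 μ s)) T c)) =
      tableSum (fun q => Combo.eval (word k₀ k₁ k₂) (divCombo q.1 q.2)) T c := by
    intro k₀ k₁ k₂ T
    induction T with
    | nil => exact Finset.sum_eq_zero fun μ _ => map_zero _
    | cons t T ih =>
      simp only [tableSum_cons, map_add, Finset.sum_add_distrib, ih, map_smul,
        ← Finset.smul_sum, ← divergence_contract]
      rfl
  simp only [divergence, vertex_eq, map_add, Finset.sum_add_distrib, key]

theorem dQ_tableSum_hhh {T : List (ℕ × List (ℕ × ℕ))} (hT : (T.all fun t => twice 0 t.2 &&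
    twice 0 (relabel (exch 0 1) t.2) && twice 0 (relabel (exch 0 2) t.2)) = true) (a : ℕ → ℂ) :
    dQ (tableSum (fun P => contract P (word .h .h .h)) T a) =
      (-(Complex.I / 2)) • tableSum (fun P => Combo.eval (word .u .h .h) (varyH P)) T a := by
  induction T with
  | nil => rw [tableSum_nil, tableSum_nil, map_zero, smul_zero]
  | cons t T ih =>
    simp only [List.all_cons, Bool.and_eq_true] at hT
    rw [tableSum_cons, map_add, map_smul, ih (by simpa using hT.2),
      dQ_contract_hhh hT.1.1.1 hT.1.1.2 hT.1.2, tableSum_cons, smul_add, smul_comm (a t.1)]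

theorem dQ_tableSum_u_ut_h {T : List (ℕ × List (ℕ × ℕ))}
    (hT : (T.all fun t => twice 4 t.2) = true) (b : ℕ → ℂ) :
    dQ (tableSum (fun P => contract P (word .u .ut .h)) T b) = (-(Complex.I / 2)) •
      (tableSum (fun P => Combo.eval (word .u .h .h) (varyUt P)) T b +
        tableSum (fun P => Combo.eval (word .u .ut .u) (gauge 4 5 P)) T b) := by
  induction T with
  | nil => rw [tableSum_nil, tableSum_nil, tableSum_nil, map_zero, add_zero, smul_zero]
  | cons t T ih =>
    rw [List.all_cons, Bool.and_eq_true] at hT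
    rw [tableSum_cons, map_add, map_smul, ih hT.2, dQ_contract_u_ut_h hT.1, tableSum_cons,
      tableSum_cons, smul_comm (b t.1), ← smul_add, smul_add (b t.1), add_add_add_comm]

theorem dQ_T1h (a : ℕ → ℂ) : dQ (T1h a) =
    (-(Complex.I / 2)) • tableSum (fun P => Combo.eval (word .u .h .h) (varyH P)) tableH a := by
  rw [T1h_eq (fun _ => rfl), dQ_tableSum_hhh (by decide +kernel)]

theorem dQ_T1u (b : ℕ → ℂ) : dQ (T1u b) = (-(Complex.I / 2)) •
    (tableSum (fun P => Combo.eval (word .u .h .h) (varyUt P)) tableU b +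
      tableSum (fun P => Combo.eval (word .u .ut .u) (gauge 4 5 P)) tableU b) := by
  rw [T1u_eq (fun _ => rfl), dQ_tableSum_u_ut_h (by decide +kernel)]

/-! ### Q-vertices for the columns of `L` -/

/-- The map `4 L` over the integers, where all its entries are integral. -/
def intL (p : Fin 18 → ℤ) : Fin 33 → ℤ :=
  let a6 := p 0
  let a12 := p 1
  let b3 := p 2
  let b4 := p 3
  let b5 := p 4
  let b6 := p 5
  let b7 := p 6
  let b10 := p 7
  let b11 := p 8
  let b12 := p 9
  let b13 := p 10
  let b14 := p 11
  let b16 := p 12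
  let b17 := p 13
  let b18 := p 14
  let b19 := p 15
  let b20 := p 16
  let b21 := p 17
  ![-4 * b7 - 4 * b10 - 2 * (b16 - b17 + b18),
    b13 + b17 - b18 - b19,
    -4 * a6 + 2 * b3 - 4 * b4 + 4 * b5 - 2 * (b6 + 3 * b13 - b14) - 4 * b17
      + 2 * (3 * b18 - b19 + b20 - b21),
    -4 * a6 + 8 * (b7 + b11 - b12),
    4 * a6,
    4 * a6,
    4 * (b16 - b17 + b18),
    2 * (-b13 - b17 + b18 + b19),
    4 * (a12 + b13 + b17 - b18 - b19),
    4 * (-a12 + b13 + b17 - b18 + b19),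
    4 * (-a12 + b13 - b14 - b18 + b19 - b20 + b21),
    4 * a12,
    4 * (-b4 - 2 * (b7 + b11 - b12) - b13 - b17 + b18),
    4 * (b3 - b4 - 2 * (b7 + b11 - b12 + b13 + b17 - b18)),
    4 * b3, 4 * b4, 4 * b5, 4 * b6, 4 * b7, -4 * b11, -4 * b12, 4 * b10, 4 * b11, 4 * b12,
    4 * b13, 4 * b14, 4 * (-b18 + b21), 4 * b16, 4 * b17, 4 * b18, 4 * b19, 4 * b20, 4 * b21]

theorem L_intCast (p : Fin 18 → ℤ) :
    L (fun m => (p m : ℝ)) = fun i => (intL p i : ℝ) / 4 := by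
  simp only [L, intL, LinearMap.coe_mk, AddHom.coe_mk]
  funext i
  iterate 33
    refine Fin.cases ?_ (fun i => ?_) i
    · rw [Matrix.cons_val_zero, Matrix.cons_val_zero]; push_cast; ring
    rw [Matrix.cons_val_succ, Matrix.cons_val_succ]
  exact i.elim0

/-- For each of the 18 parameters, the constants of a Q-vertex, in units of `-i/8`, that belongs to
the corresponding column of `L`; the constants that are not listed vanish. -/
def solution : List (List (ℕ × ℤ)) :=
  [[(15, 8), (16, 4), (24, -8), (25, -4), (60, -8), (61, 8), (69, -4), (72, 4), (78, 4),
     (81, -4)],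
    [(27, 4), (28, 8), (36, -4), (37, -8), (42, -4), (43, 4), (51, 4), (52, -4), (54, -4),
     (57, 4), (60, -8), (61, 8), (63, 4), (67, -4)],
    [(62, 8), (68, -4), (85, 4), (86, 4), (88, -4), (89, -4), (99, 4), (102, 4)],
    [(61, 8), (67, -8), (85, -4), (88, 4), (104, 4)],
    [],
    [(68, 4)],
    [(15, -4), (17, -4), (21, 4), (23, 4), (24, 4), (26, 4), (67, -16), (81, 8), (84, 4),
     (85, -4), (87, -4), (88, 4), (90, -4), (91, -4), (104, 8)],
    [(75, 8)],
    [(15, -4), (17, -4), (21, 4), (23, 4), (24, 4), (26, 4), (67, -16), (84, 4), (85, -4),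
     (87, -4), (88, 4), (90, -4), (91, -4), (104, 8), (107, -8)],
    [(15, 4), (17, 4), (21, -4), (23, -4), (24, -4), (26, -4), (67, 16), (74, -8), (83, 8),
     (84, -4), (85, 4), (87, 4), (88, -4), (90, 4), (91, 4), (97, 8), (104, -8), (106, -8)],
    [(2, 2), (6, -4), (9, -1), (13, 2), (29, -4), (33, 4), (35, 4), (38, 4), (39, -4), (48, 4),
     (52, 8), (57, 4), (60, -4), (61, 4), (67, -12), (84, 2), (85, -4), (86, -2), (87, -2),
     (88, 4), (89, 2), (90, -2), (91, -4), (92, 2), (104, 8), (110, -2), (112, 2), (114, 2)],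
    [],
    [(46, 8)],
    [(2, 2), (6, -4), (9, -1), (13, 2), (29, -4), (33, 4), (35, 4), (38, 4), (39, -4), (48, 4),
     (57, 4), (60, -4), (61, 4), (67, -12), (84, 2), (85, -4), (86, -2), (87, -2), (88, 4),
     (89, 2), (90, -2), (91, -4), (92, 2), (104, 4), (107, -4), (110, -2), (112, 2), (113, -4),
     (114, 2)],
    [(2, -2), (6, 4), (9, 1), (13, -2), (29, 4), (33, -4), (35, -4), (38, -4), (39, 4),
     (47, -8), (48, -4), (53, 8), (57, -4), (60, 4), (61, -4), (67, 12), (84, -2), (85, 4),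
     (86, 2), (87, 2), (88, -4), (89, -2), (90, 2), (91, 4), (92, -2), (103, -4), (104, -8),
     (108, -4), (110, -2), (112, -2), (114, 2)],
    [(2, -2), (6, 4), (9, 1), (13, -2), (28, -4), (33, -4), (34, 4), (37, 4), (39, 4), (42, 8),
     (48, -4), (57, -4), (60, 4), (61, -4), (67, 4), (86, 4), (89, -4), (92, -4)],
    [],
    [(47, 8)]]

/-- The constant with number `n` in the `m`-th entry of `solution`. -/
def solutionCoef (m : Fin 18) (n : ℕ) : ℤ :=
  (((solution.getD m []).lookup n).getD 0)

/-- The coefficients `a` in a vector of integral coefficients. -/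
def intA (w : Fin 33 → ℤ) (i : ℕ) : ℤ := w (Fin.ofNat 33 (i - 1))

/-- The coefficients `b` in a vector of integral coefficients. -/
def intB (w : Fin 33 → ℤ) (j : ℕ) : ℤ := w (Fin.ofNat 33 (j + 11))

/-- The part with the fields `u h h` of the difference of `d_Q T₁` and the divergence of the
Q-vertex, in units of `-i/8`. -/
def defectUHH (w : Fin 33 → ℤ) (r : ℕ → ℤ) : Combo :=
  Combo.ofTable (intA w) varyH tableH ++
    (Combo.ofTable (intB w) varyUt tableU ++
      Combo.scale (-1) (Combo.ofTable r (fun q => divCombo q.1 q.2) tableUHH))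

/-- The part with the fields `u ũ u` of the same difference. -/
def defectUUU (w : Fin 33 → ℤ) (r : ℕ → ℤ) : Combo :=
  Combo.ofTable (intB w) (gauge 4 5) tableU ++
    Combo.scale (-1) (Combo.ofTable r (fun q => divCombo q.1 q.2) tableUUU)

/-- The Q-vertices in `solution` solve the problem for the columns of `L`. -/
theorem defect_vanishes (m : Fin 18) :
    vanishes (exch 1 2) 1 (defectUHH (intL (Pi.single m 1)) (solutionCoef m)) = true ∧
      vanishes (exch 0 2) (-1) (defectUUU (intL (Pi.single m 1)) (solutionCoef m)) = true := by
  revert m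
  decide +kernel

/-! ### The relations are sufficient -/

theorem exists_linear_T1h : ∃ Φ : (ℕ → ℂ) →ₗ[ℂ] Wick, ∀ a, T1h a = Φ a :=
  ⟨_, T1h_eq fun _ => rfl⟩

theorem exists_linear_T1u : ∃ Φ : (ℕ → ℂ) →ₗ[ℂ] Wick, ∀ b, T1u b = Φ b :=
  ⟨_, T1u_eq fun _ => rfl⟩

theorem exists_linear_divergence :
    ∃ Φ : (ℕ → ℂ) →ₗ[ℂ] Wick, ∀ c, divergence (vertex c) = Φ c :=
  ⟨tableSum (fun q => Combo.eval (word .u .h .h) (divCombo q.1 q.2)) tableUHH +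
    tableSum (fun q => Combo.eval (word .u .ut .u) (divCombo q.1 q.2)) tableUUU, fun c => by
      rw [LinearMap.add_apply, divergence_vertex]⟩

theorem T1_add (v w : Coeffs) : T1 (v + w) = T1 v + T1 w := by
  obtain ⟨Φ, hΦ⟩ := exists_linear_T1h
  obtain ⟨Ψ, hΨ⟩ := exists_linear_T1u
  have ha : (fun i => (aCoef (v + w) i : ℂ)) =
      (fun i => (aCoef v i : ℂ)) + fun i => (aCoef w i : ℂ) :=
    funext fun _ => Complex.ofReal_add _ _
  have hb : (fun i => (bCoef (v + w) i : ℂ)) =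
      (fun i => (bCoef v i : ℂ)) + fun i => (bCoef w i : ℂ) :=
    funext fun _ => Complex.ofReal_add _ _
  rw [T1, T1, T1, hΦ, hΦ, hΦ, hΨ, hΨ, hΨ, ha, hb, map_add, map_add, add_add_add_comm]

theorem T1_smul (r : ℝ) (v : Coeffs) : T1 (r • v) = (r : ℂ) • T1 v := by
  obtain ⟨Φ, hΦ⟩ := exists_linear_T1h
  obtain ⟨Ψ, hΨ⟩ := exists_linear_T1u
  have ha : (fun i => (aCoef (r • v) i : ℂ)) = (r : ℂ) • fun i => (aCoef v i : ℂ) :=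
    funext fun _ => Complex.ofReal_mul _ _
  have hb : (fun i => (bCoef (r • v) i : ℂ)) = (r : ℂ) • fun i => (bCoef v i : ℂ) :=
    funext fun _ => Complex.ofReal_mul _ _
  rw [T1, T1, hΦ, hΦ, hΨ, hΨ, ha, hb, map_smul, map_smul, smul_add]

/-- The coefficient vectors of the couplings whose gauge variation is the divergence of a
Q-vertex. -/
noncomputable def solvable : Submodule ℝ Coeffs where
  carrier := {v | ∃ c : ℕ → ℂ, dQ (T1 v) = divergence (vertex c)}
  zero_mem' := by
    obtain ⟨Φ, hΦ⟩ := exists_linear_divergence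
    have h0 := T1_smul 0 0
    rw [zero_smul, Complex.ofReal_zero, zero_smul] at h0
    exact ⟨0, by rw [h0, hΦ, map_zero, map_zero]⟩
  add_mem' := by
    rintro v w ⟨c, hc⟩ ⟨d, hd⟩
    obtain ⟨Φ, hΦ⟩ := exists_linear_divergence
    exact ⟨c + d, by rw [T1_add, map_add, hc, hd, hΦ, hΦ, hΦ, map_add]⟩
  smul_mem' := by
    rintro r v ⟨c, hc⟩
    obtain ⟨Φ, hΦ⟩ := exists_linear_divergence
    exact ⟨(r : ℂ) • c, by rw [T1_smul, map_smul, hc, hΦ, hΦ, map_smul]⟩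

theorem defect_cancel {M : Type*} [AddCommGroup M] [Module ℂ M] {A₁ A₂ A₃ B₁ B₂ : M}
    (e₁ : A₁ + (A₂ + ((-1 : ℤ) : ℂ) • B₁) = 0) (e₂ : A₃ + ((-1 : ℤ) : ℂ) • B₂ = 0) :
    (-(Complex.I / 2)) • (4⁻¹ : ℂ) • A₁ +
        (-(Complex.I / 2)) • ((4⁻¹ : ℂ) • A₂ + (4⁻¹ : ℂ) • A₃) =
      (-(Complex.I / 8)) • B₁ + (-(Complex.I / 8)) • B₂ := by
  rw [Int.cast_neg, Int.cast_one] at e₁ e₂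
  linear_combination (norm := module) (-(Complex.I / 8)) • e₁ + (-(Complex.I / 8)) • e₂

/-- Vanishing of the two defects gives the equation between the gauge variation and the divergence;
`4⁻¹` is the unit of `intL`. The tables are variables here, as in other lemmas below, since only the
linear structure matters. -/
theorem ofTable_cancel {TH TU : List (ℕ × List (ℕ × ℕ))} {TX TY : List (ℕ × ℕ × List (ℕ × ℕ))}
    {W W' : Slots → Wick} {g₁ g₂ g₃ : List (ℕ × ℕ) → Combo} {g₄ : ℕ → List (ℕ × ℕ) → Combo}
    {a b r : ℕ → ℤ}
    (e₁ : Combo.eval W (Combo.ofTable a g₁ TH ++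
      (Combo.ofTable b g₂ TU ++ Combo.scale (-1) (Combo.ofTable r (fun q => g₄ q.1 q.2) TX))) = 0)
    (e₂ : Combo.eval W'
      (Combo.ofTable b g₃ TU ++ Combo.scale (-1) (Combo.ofTable r (fun q => g₄ q.1 q.2) TY)) = 0) :
    (-(Complex.I / 2)) •
        tableSum (fun P => Combo.eval W (g₁ P)) TH ((4⁻¹ : ℂ) • fun i => (a i : ℂ)) +
      (-(Complex.I / 2)) •
        (tableSum (fun P => Combo.eval W (g₂ P)) TU ((4⁻¹ : ℂ) • fun i => (b i : ℂ)) +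
          tableSum (fun P => Combo.eval W' (g₃ P)) TU ((4⁻¹ : ℂ) • fun i => (b i : ℂ))) =
      tableSum (fun q => Combo.eval W (g₄ q.1 q.2)) TX
          ((-(Complex.I / 8)) • fun n => (r n : ℂ)) +
        tableSum (fun q => Combo.eval W' (g₄ q.1 q.2)) TY
          ((-(Complex.I / 8)) • fun n => (r n : ℂ)) := by
  rw [Combo.eval_append, Combo.eval_append, Combo.eval_scale, Combo.eval_ofTable,
    Combo.eval_ofTable, Combo.eval_ofTable] at e₁
  rw [Combo.eval_append, Combo.eval_scale, Combo.eval_ofTable, Combo.eval_ofTable] at e₂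
  simp only [map_smul]
  exact defect_cancel e₁ e₂

/-- A Q-vertex with integral constants `r` (in units of `-i/8`) that passes the test shows that an
image of `L` is solvable. -/
theorem mem_solvable {p : Fin 18 → ℤ} {r : ℕ → ℤ}
    (h₁ : vanishes (exch 1 2) 1 (defectUHH (intL p) r) = true)
    (h₂ : vanishes (exch 0 2) (-1) (defectUUU (intL p) r) = true) :
    L (fun m => (p m : ℝ)) ∈ solvable := by
  refine ⟨(-(Complex.I / 8)) • fun n => (r n : ℂ), ?_⟩
  have e₁ := eval_eq_zero (fun s => (word_u_h_h_exch s).trans (by rw [Int.cast_one, one_smul]))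
    (by norm_num) h₁
  have e₂ := eval_eq_zero (fun s => (word_u_ut_u_exch s).trans
    (by rw [Int.cast_neg, Int.cast_one])) (by norm_num) h₂
  rw [defectUHH] at e₁
  rw [defectUUU] at e₂
  have ha : (fun i => (aCoef (L fun m => (p m : ℝ)) i : ℂ)) =
      (4⁻¹ : ℂ) • fun i => (intA (intL p) i : ℂ) := by
    funext i
    rw [aCoef, L_intCast, Pi.smul_apply, smul_eq_mul, intA]
    push_cast
    ring
  have hb : (fun j => (bCoef (L fun m => (p m : ℝ)) j : ℂ)) =
      (4⁻¹ : ℂ) • fun i => (intB (intL p) i : ℂ) := by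
    funext i
    rw [bCoef, L_intCast, Pi.smul_apply, smul_eq_mul, intB]
    push_cast
    ring
  rw [divergence_vertex, T1, map_add, dQ_T1h, dQ_T1u, ha, hb]
  exact ofTable_cancel e₁ e₂

/-- The couplings parametrized by `L` are solvable. -/
theorem range_L_le : LinearMap.range L ≤ solvable := by
  rintro _ ⟨p, rfl⟩
  have hp : L p = ∑ m, p m • L (Pi.single m 1) := by
    conv_lhs => rw [pi_eq_sum_univ' p]
    simp only [map_sum, map_smul]
  rw [hp]
  refine solvable.sum_mem fun m _ => solvable.smul_mem _ ?_
  have h := defect_vanishes m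
  have e : (fun i => ((Pi.single m 1 : Fin 18 → ℤ) i : ℝ)) = Pi.single m 1 := by
    funext i
    by_cases hi : i = m
    · subst hi; simp
    · simp [hi]
  rw [← e]
  exact mem_solvable h.1 h.2

/-! ### Plane waves -/

/-- A plane wave of one kind of field, given by its (complex) polarization vector and momentum. A
wave of the tensor field has the polarization tensor `e ⊗ e`. -/
structure Wave where
  /-- the kind of field -/
  kind : Kind
  /-- the polarization vector -/
  pol : Fin 4 → ℂ
  /-- the momentum -/
  mom : Fin 4 → ℂ
  /-- the momentum is a null vector, as required by the wave equation -/
  null : ∑ μ, η μ * (mom μ * mom μ) = 0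

namespace Wave

/-- The value at the origin of `∂_{s₁} ⋯ ∂_{sₖ} φ` on a plane wave. -/
noncomputable def genCoef (w : Wave) (φ : Comp) (s : Multiset (Fin 4)) : ℂ :=
  if φ.kind = w.kind then (φ.indices.map w.pol).prod * (s.map fun μ => η μ * w.mom μ).prod else 0

theorem genCoef_symm (w : Wave) (μ ν : Fin 4) (s : Multiset (Fin 4)) :
    w.genCoef (.h μ ν) s = w.genCoef (.h ν μ) s := by
  have h : (Comp.h μ ν).indices = (Comp.h ν μ).indices := Multiset.cons_swap μ ν 0
  unfold genCoef
  rw [h]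
  rfl

theorem genCoef_cons (w : Wave) (φ : Comp) (μ : Fin 4) (s : Multiset (Fin 4)) :
    w.genCoef φ (μ ::ₘ s) = η μ * w.mom μ * w.genCoef φ s := by
  unfold genCoef
  split_ifs
  · rw [Multiset.map_cons, Multiset.prod_cons]
    ring
  · rw [mul_zero]

theorem sum_genCoef (w : Wave) (φ : Comp) (s : Multiset (Fin 4)) :
    ∑ μ, η μ * w.genCoef φ (μ ::ₘ μ ::ₘ s) = 0 := by
  have h : ∀ μ, η μ * w.genCoef φ (μ ::ₘ μ ::ₘ s) =
      η μ * (w.mom μ * w.mom μ) * w.genCoef φ s := by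
    intro μ
    rw [genCoef_cons, genCoef_cons]
    linear_combination (η μ * (w.mom μ * w.mom μ) * w.genCoef φ s) * η_mul_self μ
  simp only [h, ← Finset.sum_mul, w.null, zero_mul]

theorem sign_left (w : Wave) (φ ψ : Comp) (t : Multiset (Fin 4)) :
    (-1 : ℂ) ^ (parity φ * w.kind.parity) * w.genCoef ψ t =
      (-1) ^ (parity φ * parity ψ) * w.genCoef ψ t := by
  unfold genCoef
  split_ifs with h
  · rw [parity_eq ψ, h]
  · rw [mul_zero, mul_zero]

/-- The homomorphism belonging to the graded derivation that replaces one field by its value on a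
plane wave. -/
noncomputable def hom (w : Wave) : Wick →ₐ[ℂ] Matrix (Fin 2) (Fin 2) Wick :=
  derHom (fun φ => (-1) ^ (parity φ * w.kind.parity)) (fun φ s => w.genCoef φ s • 1)
    (fun _ _ => rfl) (fun μ ν s => by rw [genCoef_symm])
    (fun φ s => by simp only [smul_smul, ← Finset.sum_smul, sum_genCoef, zero_smul])
    (fun φ ψ s t => by
      have h1 := w.sign_left φ ψ t
      have h2 := w.sign_left ψ φ s
      have h3 : (-1 : ℂ) ^ (parity φ * parity ψ) * (-1) ^ (parity φ * parity ψ) = 1 := by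
        rw [← mul_pow]; norm_num
      rw [mul_comm (parity ψ) (parity φ)] at h2
      simp only [mul_smul_comm, smul_mul_assoc, mul_one, one_mul, smul_add, smul_smul]
      rw [mul_comm (w.genCoef ψ t), h1, mul_comm (w.genCoef φ s), h2, ← mul_assoc, h3, one_mul,
        add_comm])

/-- The graded derivation that replaces one field by its value on a plane wave. -/
noncomputable def ins (w : Wave) : Wick →ₗ[ℂ] Wick := upperRight w.hom

/-- The grading automorphism that belongs to `ins`. -/
noncomputable def sign (w : Wave) : Wick →ₗ[ℂ] Wick where
  toFun A := w.hom A 0 0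
  map_add' A B := by simp
  map_smul' r A := by simp

theorem hom_gen (w : Wave) (φ : Comp) (s : Multiset (Fin 4)) : w.hom (gen φ s) =
    !![(-1 : ℂ) ^ (parity φ * w.kind.parity) • gen φ s, w.genCoef φ s • 1; 0, gen φ s] :=
  derHom_gen φ s

theorem ins_gen (w : Wave) (φ : Comp) (s : Multiset (Fin 4)) :
    w.ins (gen φ s) = w.genCoef φ s • 1 := by
  simp [ins, upperRight, hom_gen]

theorem sign_gen (w : Wave) (φ : Comp) (s : Multiset (Fin 4)) :
    w.sign (gen φ s) = (-1 : ℂ) ^ (parity φ * w.kind.parity) • gen φ s := by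
  simp [sign, hom_gen]

theorem sign_mul (w : Wave) (A B : Wick) : w.sign (A * B) = w.sign A * w.sign B := by
  have hB := lower_entries w.hom (fun φ s => by simp [hom_gen]) B
  simp [sign, Matrix.mul_apply, Fin.sum_univ_two, hB.1]

theorem ins_mul (w : Wave) (A B : Wick) :
    w.ins (A * B) = w.sign A * w.ins B + w.ins A * B := by
  have hB := lower_entries w.hom (fun φ s => by simp [hom_gen]) B
  simp [ins, upperRight, sign, Matrix.mul_apply, Fin.sum_univ_two, hB.2]

theorem ins_algebraMap (w : Wave) (r : ℂ) : w.ins (algebraMap ℂ Wick r) = 0 := by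
  simp [ins, upperRight, Matrix.algebraMap_matrix_apply]

theorem sign_algebraMap (w : Wave) (r : ℂ) :
    w.sign (algebraMap ℂ Wick r) = algebraMap ℂ Wick r := by
  simp [sign, Matrix.algebraMap_matrix_apply]

end Wave

theorem partialD_algebraMap (μ : Fin 4) (r : ℂ) : partialD μ (algebraMap ℂ Wick r) = 0 := by
  simp [partialD, upperRight, Matrix.algebraMap_matrix_apply]

namespace Wave

theorem sign_partialD (w : Wave) (μ : Fin 4) (A : Wick) :
    w.sign (partialD μ A) = partialD μ (w.sign A) := by
  induction A using wick_induction with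
  | scalar r => rw [partialD_algebraMap, sign_algebraMap, partialD_algebraMap, map_zero]
  | gen φ s => rw [partialD_gen, sign_gen, sign_gen, map_smul, partialD_gen]
  | mul A B hA hB => rw [partialD_mul, map_add, sign_mul, sign_mul, hA, hB, sign_mul, partialD_mul]
  | add A B hA hB => rw [map_add, map_add, map_add, map_add, hA, hB]

/-- Inserting a plane wave of momentum `k` turns `∂_μ` into `∂_μ + k_μ`. -/
theorem ins_partialD (w : Wave) (μ : Fin 4) (A : Wick) :
    w.ins (partialD μ A) = partialD μ (w.ins A) + (η μ * w.mom μ) • w.ins A := by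
  induction A using wick_induction with
  | scalar r => rw [partialD_algebraMap, ins_algebraMap, map_zero, map_zero, smul_zero, add_zero]
  | gen φ s =>
    have h1 : partialD μ (1 : Wick) = 0 := by
      have h := partialD_algebraMap μ 1
      rwa [map_one] at h
    rw [partialD_gen, ins_gen, ins_gen, map_smul, h1, smul_zero, zero_add, genCoef_cons, smul_smul]
  | mul A B hA hB =>
    rw [partialD_mul, map_add, ins_mul, ins_mul, hA, hB, ins_mul, sign_partialD, map_add,
      partialD_mul, partialD_mul, mul_add, add_mul, smul_add, mul_smul_comm, smul_mul_assoc]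
    abel
  | add A B hA hB =>
    rw [map_add, map_add, map_add, map_add, hA, hB, smul_add]
    abel

/-- The value of the field of kind `k` with indices `p` and derivative indices `d` on the plane
wave. -/
noncomputable def coef (w : Wave) (k : Kind) (p d : Multiset (Fin 4)) : ℂ :=
  if k = w.kind ∧ p.card = k.rank then (p.map w.pol).prod * (d.map w.mom).prod else 0

/-- `coef` refers to upper derivative indices, `genCoef` to lower ones. -/
theorem coef_comp (w : Wave) (φ : Comp) (d : Multiset (Fin 4)) :
    w.coef φ.kind φ.indices d = (d.map η).prod * w.genCoef φ d := by
  have h : φ.indices.card = φ.kind.rank := by cases φ <;> rfl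
  have hd : (d.map w.mom).prod = (d.map η).prod * (d.map fun μ => η μ * w.mom μ).prod := by
    rw [Multiset.prod_map_mul, ← mul_assoc, ← Multiset.prod_map_mul]
    simp only [η_mul_self, Multiset.map_const', Multiset.prod_replicate, one_pow, one_mul]
  unfold coef genCoef
  split_ifs with h1 h2 h2
  · rw [hd]; ring
  · exact absurd h1.1 h2
  · exact absurd ⟨h2, h⟩ h1
  · rw [mul_zero]

theorem ins_field (w : Wave) (k : Kind) (p d : Multiset (Fin 4)) :
    w.ins (field k p d) = w.coef k p d • 1 := by
  by_cases hp : p.card = k.rank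
  · obtain ⟨φ, rfl, rfl⟩ : ∃ φ : Comp, φ.kind = k ∧ φ.indices = p := by
      cases k
      · obtain ⟨μ, ν, rfl⟩ := Multiset.card_eq_two.1 hp
        exact ⟨.h μ ν, rfl, rfl⟩
      · obtain ⟨μ, rfl⟩ := Multiset.card_eq_one.1 hp
        exact ⟨.u μ, rfl, rfl⟩
      · obtain ⟨μ, rfl⟩ := Multiset.card_eq_one.1 hp
        exact ⟨.ut μ, rfl, rfl⟩
    rw [field_comp, map_smul, ins_gen, coef_comp, smul_smul]
  · rcases field_cases k p with ⟨φ, rfl, rfl⟩ | h0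
    · exact absurd (by cases φ <;> rfl) hp
    · rw [h0, map_zero, coef, if_neg fun h => hp h.2, zero_smul]

theorem sign_field (w : Wave) (k : Kind) (p d : Multiset (Fin 4)) :
    w.sign (field k p d) = (-1 : ℂ) ^ (k.parity * w.kind.parity) • field k p d := by
  rcases field_cases k p with ⟨φ, rfl, rfl⟩ | h0
  · rw [field_comp, map_smul, sign_gen, smul_comm, parity_eq]
  · rw [h0, map_zero, smul_zero]

theorem coef_of_ne (w : Wave) {k : Kind} (h : k ≠ w.kind) (p d : Multiset (Fin 4)) :
    w.coef k p d = 0 := if_neg fun h' => h h'.1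

end Wave

/-- The algebra homomorphism that sends all fields to zero. -/
noncomputable def vacuum : Wick →ₐ[ℂ] ℂ :=
  RingQuot.liftAlgHom ℂ ⟨FreeAlgebra.lift ℂ fun _ => 0, by
    intro x y hxy
    cases hxy <;> simp⟩

theorem vacuum_gen (φ : Comp) (s : Multiset (Fin 4)) : vacuum (gen φ s) = 0 := by
  simp [vacuum, gen]

theorem vacuum_partialD (μ : Fin 4) (A : Wick) : vacuum (partialD μ A) = 0 := by
  induction A using wick_induction with
  | scalar r => rw [partialD_algebraMap, map_zero]
  | gen φ s => rw [partialD_gen, vacuum_gen]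
  | mul A B hA hB => rw [partialD_mul, map_add, map_mul, map_mul, hA, hB, zero_mul, mul_zero,
      add_zero]
  | add A B hA hB => rw [map_add, map_add, hA, hB, add_zero]

/-- The amplitude of a Wick polynomial for three plane waves: each wave replaces one field, and all
other fields are set to zero. -/
noncomputable def amplitude (w₀ w₁ w₂ : Wave) : Wick →ₗ[ℂ] ℂ :=
  vacuum.toLinearMap ∘ₗ w₀.ins ∘ₗ w₁.ins ∘ₗ w₂.ins

theorem amplitude_apply (w₀ w₁ w₂ : Wave) (A : Wick) :
    amplitude w₀ w₁ w₂ A = vacuum (w₀.ins (w₁.ins (w₂.ins A))) := rfl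

/-- By conservation of momentum the amplitude of a divergence vanishes. -/
theorem amplitude_divergence {w₀ w₁ w₂ : Wave} (h : ∀ μ, w₀.mom μ + w₁.mom μ + w₂.mom μ = 0)
    (T : Fin 4 → Wick) : amplitude w₀ w₁ w₂ (divergence T) = 0 := by
  rw [divergence, map_sum]
  refine Finset.sum_eq_zero fun μ _ => ?_
  simp only [amplitude_apply, Wave.ins_partialD, map_add, map_smul, vacuum_partialD, zero_add,
    smul_eq_mul]
  linear_combination (η μ * vacuum (w₀.ins (w₁.ins (w₂.ins (T μ))))) * h μ

theorem amplitude_hhh (w₀ : Wave) {w₁ w₂ : Wave} (h₁ : w₁.kind = .h) (h₂ : w₂.kind = .h)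
    (p₀ d₀ p₁ d₁ p₂ d₂ : Multiset (Fin 4)) :
    amplitude w₀ w₁ w₂ (field .h p₀ d₀ * field .h p₁ d₁ * field .h p₂ d₂) =
      w₀.coef .h p₀ d₀ * w₁.coef .h p₁ d₁ * w₂.coef .h p₂ d₂ +
      w₀.coef .h p₀ d₀ * w₁.coef .h p₂ d₂ * w₂.coef .h p₁ d₁ +
      w₀.coef .h p₁ d₁ * w₁.coef .h p₀ d₀ * w₂.coef .h p₂ d₂ +
      w₀.coef .h p₁ d₁ * w₁.coef .h p₂ d₂ * w₂.coef .h p₀ d₀ +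
      w₀.coef .h p₂ d₂ * w₁.coef .h p₀ d₀ * w₂.coef .h p₁ d₁ +
      w₀.coef .h p₂ d₂ * w₁.coef .h p₁ d₁ * w₂.coef .h p₀ d₀ := by
  simp only [amplitude_apply, Wave.ins_mul, Wave.sign_mul, Wave.ins_field, Wave.sign_field, h₁,
    h₂, Kind.parity, pow_zero, mul_zero, one_smul, map_add, map_smul, mul_smul_comm,
    smul_mul_assoc, mul_one, one_mul, map_one, smul_eq_mul, add_mul, smul_add]
  ring

theorem amplitude_u_h_h (w₀ : Wave) {w₁ w₂ : Wave} (h₁ : w₁.kind = .h) (h₂ : w₂.kind = .h)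
    (p₀ d₀ p₁ d₁ p₂ d₂ : Multiset (Fin 4)) :
    amplitude w₀ w₁ w₂ (field .u p₀ d₀ * field .h p₁ d₁ * field .h p₂ d₂) =
      w₀.coef .u p₀ d₀ * w₁.coef .h p₁ d₁ * w₂.coef .h p₂ d₂ +
      w₀.coef .u p₀ d₀ * w₁.coef .h p₂ d₂ * w₂.coef .h p₁ d₁ := by
  have e₁ := w₁.coef_of_ne (k := .u) (by rw [h₁]; decide)
  have e₂ := w₂.coef_of_ne (k := .u) (by rw [h₂]; decide)
  simp only [amplitude_apply, Wave.ins_mul, Wave.sign_mul, Wave.ins_field, Wave.sign_field, h₁,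
    h₂, Kind.parity, pow_zero, mul_zero, zero_mul, one_smul, map_add, map_smul, mul_smul_comm,
    smul_mul_assoc, mul_one, map_zero, map_one, smul_eq_mul, add_mul, smul_add, e₁, e₂, zero_smul]
  ring

/-- The sign arises because the insertion of the wave `w₁` has to pass the field `u`. -/
theorem amplitude_u_ut_h (w₀ : Wave) {w₁ w₂ : Wave} (h₁ : w₁.kind = .ut) (h₂ : w₂.kind = .h)
    (p₀ d₀ p₁ d₁ p₂ d₂ : Multiset (Fin 4)) :
    amplitude w₀ w₁ w₂ (field .u p₀ d₀ * field .ut p₁ d₁ * field .h p₂ d₂) =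
      -(w₀.coef .u p₀ d₀ * w₁.coef .ut p₁ d₁ * w₂.coef .h p₂ d₂) := by
  have e₁ := w₁.coef_of_ne (k := .u) (by rw [h₁]; decide)
  have e₂ := w₂.coef_of_ne (k := .u) (by rw [h₂]; decide)
  have e₃ := w₂.coef_of_ne (k := .ut) (by rw [h₂]; decide)
  simp only [amplitude_apply, Wave.ins_mul, Wave.sign_mul, Wave.ins_field, Wave.sign_field, h₁,
    h₂, Kind.parity, pow_zero, mul_zero, zero_mul, one_smul, map_add, map_smul, mul_smul_comm,
    mul_one, map_zero, map_one, smul_eq_mul, add_mul, smul_add, e₁, e₂, e₃, zero_smul, pow_one]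
  ring

theorem amplitude_u_ut_u (w₀ w₁ : Wave) {w₂ : Wave} (h₂ : w₂.kind = .h)
    (p₀ d₀ p₁ d₁ p₂ d₂ : Multiset (Fin 4)) :
    amplitude w₀ w₁ w₂ (field .u p₀ d₀ * field .ut p₁ d₁ * field .u p₂ d₂) = 0 := by
  have e₂ := w₂.coef_of_ne (k := .u) (by rw [h₂]; decide)
  have e₃ := w₂.coef_of_ne (k := .ut) (by rw [h₂]; decide)
  simp only [amplitude_apply, Wave.ins_mul, Wave.ins_field, e₂, e₃, zero_smul, mul_zero, zero_mul,
    add_zero, map_zero]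

theorem amplitude_u_ut_h_eq_zero (w₀ : Wave) {w₁ w₂ : Wave} (h₁ : w₁.kind = .h)
    (h₂ : w₂.kind = .h) (p₀ d₀ p₁ d₁ p₂ d₂ : Multiset (Fin 4)) :
    amplitude w₀ w₁ w₂ (field .u p₀ d₀ * field .ut p₁ d₁ * field .h p₂ d₂) = 0 := by
  have e₀ := w₁.coef_of_ne (k := .u) (by rw [h₁]; decide)
  have e₁ := w₁.coef_of_ne (k := .ut) (by rw [h₁]; decide)
  have e₂ := w₂.coef_of_ne (k := .u) (by rw [h₂]; decide)
  have e₃ := w₂.coef_of_ne (k := .ut) (by rw [h₂]; decide)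
  simp only [amplitude_apply, Wave.ins_mul, Wave.sign_mul, Wave.ins_field, Wave.sign_field,
    e₀, e₁, e₂, e₃, zero_smul, smul_zero, mul_zero, zero_mul, mul_smul_comm, smul_mul_assoc,
    map_smul, mul_one, add_zero, map_zero]

theorem amplitude_hhh_eq_zero (w₀ : Wave) {w₁ : Wave} (w₂ : Wave) (h₁ : w₁.kind ≠ .h)
    (p₀ d₀ p₁ d₁ p₂ d₂ : Multiset (Fin 4)) :
    amplitude w₀ w₁ w₂ (field .h p₀ d₀ * field .h p₁ d₁ * field .h p₂ d₂) = 0 := by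
  have e₁ := w₁.coef_of_ne h₁.symm
  simp only [amplitude_apply, Wave.ins_mul, Wave.sign_mul, Wave.ins_field, Wave.sign_field,
    e₁, zero_smul, smul_zero, mul_zero, zero_mul, mul_smul_comm, smul_mul_assoc,
    map_smul, map_add, mul_one, one_mul, add_zero, map_zero]

/-! ### Amplitudes of contractions -/

/-- If a vector is inserted for every index, a contraction becomes a product of Minkowski
products. -/
theorem contract_prod (v : ℕ → Fin 4 → ℂ) {n : ℕ} {P : List (ℕ × ℕ)}
    (hP : ∀ p ∈ P, p.1 < n ∧ p.2 < n) :
    (contract P fun s => ∏ z ∈ Finset.range n, ((s z).map (v z)).prod) =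
      (P.map fun p => ∑ μ, η μ * (v p.1 μ * v p.2 μ)).prod := by
  have hput : ∀ (x : ℕ) (μ : Fin 4) (s : Slots), x < n →
      ∏ z ∈ Finset.range n, ((put x μ s z).map (v z)).prod =
        v x μ * ∏ z ∈ Finset.range n, ((s z).map (v z)).prod := by
    intro x μ s hx
    rw [← Finset.mul_prod_erase _ _ (Finset.mem_range.2 hx),
      ← Finset.mul_prod_erase _ _ (Finset.mem_range.2 hx), ← mul_assoc]
    congr 1
    · simp [put]
    · refine Finset.prod_congr rfl fun z hz => ?_
      rw [put_of_ne (Finset.ne_of_mem_erase hz).symm]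
  induction P with
  | nil => exact Finset.prod_eq_one fun z _ => rfl
  | cons p P ih =>
    obtain ⟨h1, h2⟩ := hP p List.mem_cons_self
    rw [contract, List.map_cons, List.prod_cons, ← ih fun q hq => hP q (List.mem_cons_of_mem _ hq),
      Finset.sum_mul]
    refine Finset.sum_congr rfl fun μ _ => ?_
    simp only [hput _ _ _ h1, hput _ _ _ h2, ← smul_eq_mul, contract_smul]
    simp only [smul_eq_mul, mul_assoc]

/-- A complex vector of the form `(a + b/2, c - d/2, i (c + d/2), a - b/2)` with integers `a`, `b`,
`c`, `d`, given by `(a, b, c, d)`. The four basis vectors are null. -/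
abbrev NullVec := ℤ × ℤ × ℤ × ℤ

/-- The vector given by null coordinates. -/
noncomputable def NullVec.toVec (v : NullVec) : Fin 4 → ℂ :=
  ![v.1 + v.2.1 / 2, v.2.2.1 - v.2.2.2 / 2, Complex.I * (v.2.2.1 + v.2.2.2 / 2), v.1 - v.2.1 / 2]

/-- The Minkowski product in null coordinates. -/
def NullVec.dot (v w : NullVec) : ℤ :=
  v.1 * w.2.1 + v.2.1 * w.1 + v.2.2.1 * w.2.2.2 + v.2.2.2 * w.2.2.1

theorem NullVec.sum_toVec (v w : NullVec) :
    ∑ μ, η μ * (v.toVec μ * w.toVec μ) = (v.dot w : ℂ) := by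
  have hI := Complex.I_mul_I
  simp only [Fin.sum_univ_four, toVec, η, dot, Matrix.cons_val, Fin.isValue, if_true, one_ne_zero,
    if_false, Fin.reduceEq]
  push_cast
  linear_combination (-(v.2.2.1 + v.2.2.2 / 2 : ℂ) * (w.2.2.1 + w.2.2.2 / 2)) * hI

theorem NullVec.toVec_add (v w : NullVec) : (v + w).toVec = v.toVec + w.toVec := by
  funext μ
  fin_cases μ <;> simp [toVec] <;> ring

theorem NullVec.toVec_zero : NullVec.toVec 0 = 0 := by
  funext μ
  fin_cases μ <;> simp [toVec]

/-- Polarization and momentum vectors of three plane waves: the vector at the position `z` belongs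
to the slot `z` of a word, so that polarizations and momenta alternate. -/
abbrev Config := List NullVec

namespace Config

/-- The vector that belongs to the slot `z`. -/
def vec (V : Config) (z : ℕ) : NullVec := V.getD z 0

/-- The momenta are null vectors. -/
def null (V : Config) : Bool :=
  (V.vec 1).dot (V.vec 1) == 0 && (V.vec 3).dot (V.vec 3) == 0 && (V.vec 5).dot (V.vec 5) == 0

/-- The sum of the momenta vanishes. -/
def conserved (V : Config) : Bool := V.vec 1 + V.vec 3 + V.vec 5 == 0

/-- The product of the Minkowski products of the paired vectors. -/
def value (V : Config) (P : List (ℕ × ℕ)) : ℤ :=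
  (P.map fun p => (V.vec p.1).dot (V.vec p.2)).prod

/-- The plane wave that belongs to the factor `i` of a word. -/
noncomputable def wave (V : Config) (k : Kind) (i : ℕ)
    (h : (V.vec (2 * i + 1)).dot (V.vec (2 * i + 1)) = 0) : Wave where
  kind := k
  pol := (V.vec (2 * i)).toVec
  mom := (V.vec (2 * i + 1)).toVec
  null := by rw [NullVec.sum_toVec, h, Int.cast_zero]

end Config

/-- The contraction `P` is well-formed: it refers only to the slots of a word in three fields and
fills the slots of the tensor indices with the right number of indices. -/
def fits (k₀ k₁ k₂ : Kind) (P : List (ℕ × ℕ)) : Bool :=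
  (P.all fun p => decide (p.1 < 6) && decide (p.2 < 6)) && slotCount 0 P == k₀.rank &&
    slotCount 2 P == k₁.rank && slotCount 4 P == k₂.rank

/-- The contraction of the values of three plane waves is a product of Minkowski products. -/
theorem contract_coef {V : Config} {k₀ k₁ k₂ : Kind} (h₀ h₁ h₂) {P : List (ℕ × ℕ)}
    (hP : fits k₀ k₁ k₂ P = true) :
    (contract P fun s => (V.wave k₀ 0 h₀).coef k₀ (s 0) (s 1) *
      (V.wave k₁ 1 h₁).coef k₁ (s 2) (s 3) * (V.wave k₂ 2 h₂).coef k₂ (s 4) (s 5)) =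
      (V.value P : ℂ) := by
  simp only [fits, Bool.and_eq_true, List.all_eq_true, beq_iff_eq, decide_eq_true_eq] at hP
  obtain ⟨⟨⟨h, e₀⟩, e₁⟩, e₂⟩ := hP
  have hc := contract_prod (fun z => (V.vec z).toVec) h
  simp only [NullVec.sum_toVec] at hc
  have hv : (V.value P : ℂ) =
      (P.map fun p => (((V.vec p.1).dot (V.vec p.2) : ℤ) : ℂ)).prod := by
    rw [Config.value, Int.cast_list_prod, List.map_map]
    rfl
  rw [hv, ← hc]
  refine contract_congr fun s hs => ?_
  rw [Wave.coef, Wave.coef, Wave.coef, if_pos ⟨rfl, (hs 0).trans e₀⟩,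
    if_pos ⟨rfl, (hs 2).trans e₁⟩, if_pos ⟨rfl, (hs 4).trans e₂⟩]
  simp only [Finset.prod_range_succ, Finset.prod_range_zero, one_mul, ← mul_assoc]
  rfl

/-- The amplitude for a ghost wave and two waves of the tensor field. -/
theorem exists_amplitude_u_h_h {V : Config} (hV : V.null = true) (hV' : V.conserved = true) :
    ∃ Λ : Wick →ₗ[ℂ] ℂ, (∀ T, Λ (divergence T) = 0) ∧
      (∀ P, (fits .u .h .h P && fits .u .h .h (relabel (exch 1 2) P)) = true →
        Λ (contract P (word .u .h .h)) = ((V.value P + V.value (relabel (exch 1 2) P) : ℤ) : ℂ)) ∧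
      ∀ P, Λ (contract P (word .u .ut .u)) = 0 := by
  simp only [Config.null, Bool.and_eq_true, beq_iff_eq] at hV
  obtain ⟨⟨n₀, n₁⟩, n₂⟩ := hV
  refine ⟨amplitude (V.wave .u 0 n₀) (V.wave .h 1 n₁) (V.wave .h 2 n₂), fun T => ?_, fun P hP => ?_,
    fun P => ?_⟩
  · refine amplitude_divergence (fun μ => ?_) T
    have h := congrArg NullVec.toVec (beq_iff_eq.1 hV')
    rw [NullVec.toVec_add, NullVec.toVec_add, NullVec.toVec_zero] at h
    exact congrFun h μ
  · rw [Bool.and_eq_true] at hP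
    simp only [map_contract, word]
    simp only [amplitude_u_h_h _ (w₁ := V.wave .h 1 n₁) (w₂ := V.wave .h 2 n₂) rfl rfl,
      contract_add]
    rw [Int.cast_add, contract_coef n₀ n₁ n₂ hP.1, ← contract_coef n₀ n₁ n₂ hP.2]
    congr 1
    rw [relabel, contract_map]
    rfl
  · simp only [map_contract, word]
    simp only [amplitude_u_ut_u _ _ (w₂ := V.wave .h 2 n₂) rfl, contract_zero]

/-- The amplitude for three waves of the tensor field. -/
theorem exists_amplitude_hhh {V : Config} (hV : V.null = true) :
    ∃ Λ : Wick →ₗ[ℂ] ℂ,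
      (∀ P, (fits .h .h .h P && fits .h .h .h (relabel (exch 1 2) P) &&
          fits .h .h .h (relabel (exch 0 1) P) &&
          fits .h .h .h (relabel (exch 1 2) (relabel (exch 0 1) P)) &&
          fits .h .h .h (relabel (exch 0 1) (relabel (exch 1 2) P)) &&
          fits .h .h .h (relabel (exch 0 2) P)) = true →
        Λ (contract P (word .h .h .h)) = ((V.value P + V.value (relabel (exch 1 2) P) +
          V.value (relabel (exch 0 1) P) + V.value (relabel (exch 1 2) (relabel (exch 0 1) P)) +
          V.value (relabel (exch 0 1) (relabel (exch 1 2) P)) +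
          V.value (relabel (exch 0 2) P) : ℤ) : ℂ)) ∧
      ∀ P, Λ (contract P (word .u .ut .h)) = 0 := by
  simp only [Config.null, Bool.and_eq_true, beq_iff_eq] at hV
  obtain ⟨⟨n₀, n₁⟩, n₂⟩ := hV
  refine ⟨amplitude (V.wave .h 0 n₀) (V.wave .h 1 n₁) (V.wave .h 2 n₂), fun P hP => ?_, fun P => ?_⟩
  · simp only [Bool.and_eq_true] at hP
    obtain ⟨⟨⟨⟨⟨h₀, h₁⟩, h₂⟩, h₃⟩, h₄⟩, h₅⟩ := hP
    simp only [map_contract, word]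
    simp only [amplitude_hhh _ (w₁ := V.wave .h 1 n₁) (w₂ := V.wave .h 2 n₂) rfl rfl,
      contract_add]
    simp only [Int.cast_add]
    rw [← contract_coef n₀ n₁ n₂ h₀, ← contract_coef n₀ n₁ n₂ h₁, ← contract_coef n₀ n₁ n₂ h₂,
      ← contract_coef n₀ n₁ n₂ h₃, ← contract_coef n₀ n₁ n₂ h₄, ← contract_coef n₀ n₁ n₂ h₅]
    simp only [relabel, contract_map]
    rfl
  · simp only [map_contract, word]
    simp only [amplitude_u_ut_h_eq_zero _ (w₁ := V.wave .h 1 n₁) (w₂ := V.wave .h 2 n₂) rfl rfl,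
      contract_zero]

/-- The amplitude for a ghost wave, an anti-ghost wave and a wave of the tensor field. -/
theorem exists_amplitude_u_ut_h {V : Config} (hV : V.null = true) :
    ∃ Λ : Wick →ₗ[ℂ] ℂ,
      (∀ P, fits .u .ut .h P = true →
        Λ (contract P (word .u .ut .h)) = ((-V.value P : ℤ) : ℂ)) ∧
      ∀ P, Λ (contract P (word .h .h .h)) = 0 := by
  simp only [Config.null, Bool.and_eq_true, beq_iff_eq] at hV
  obtain ⟨⟨n₀, n₁⟩, n₂⟩ := hV
  refine ⟨amplitude (V.wave .u 0 n₀) (V.wave .ut 1 n₁) (V.wave .h 2 n₂), fun P hP => ?_,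
    fun P => ?_⟩
  · simp only [map_contract, word]
    simp only [amplitude_u_ut_h _ (w₁ := V.wave .ut 1 n₁) (w₂ := V.wave .h 2 n₂) rfl rfl]
    rw [Int.cast_neg, ← contract_coef n₀ n₁ n₂ hP]
    exact (map_contract (-LinearMap.id) P _).symm
  · have hk : (V.wave .ut 1 n₁).kind ≠ .h := (by decide : Kind.ut ≠ .h)
    simp only [map_contract, word]
    simp only [amplitude_hhh_eq_zero _ _ hk, contract_zero]

/-! ### Linear equations for the coefficients -/

/-- The row of an integral linear equation: the coefficients `g x` for the entries `(i, x)` of a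
table, without the zeros. -/
def row {ι : Type*} (g : ι → ℤ) (T : List (ℕ × ι)) : List (ℕ × ℤ) :=
  (T.map fun t => (t.1, g t.2)).filter fun t => t.2 != 0

/-- The value of the linear form with the given coefficients. -/
def rowSum (a : ℕ → ℝ) (R : List (ℕ × ℤ)) : ℝ := (R.map fun t => (t.2 : ℝ) * a t.1).sum

theorem rowSum_nil (a : ℕ → ℝ) : rowSum a [] = 0 := rfl

theorem rowSum_cons (a : ℕ → ℝ) (t : ℕ × ℤ) (R : List (ℕ × ℤ)) :
    rowSum a (t :: R) = t.2 * a t.1 + rowSum a R := rfl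

theorem tableSum_row {ι : Type*} (g : ι → ℤ) (T : List (ℕ × ι)) (a : ℕ → ℝ) :
    tableSum (fun x => (g x : ℂ)) T (fun i => (a i : ℂ)) = (rowSum a (row g T) : ℂ) := by
  induction T with
  | nil => rw [tableSum_nil]; exact Complex.ofReal_zero.symm
  | cons t T ih =>
    have h : row g (t :: T) = if g t.2 = 0 then row g T else (t.1, g t.2) :: row g T := by
      by_cases h0 : g t.2 = 0 <;> simp [row, h0]
    rw [tableSum_cons, ih, h]
    split_ifs with h0
    · rw [h0, Int.cast_zero, smul_zero, zero_add]
    · rw [rowSum_cons, smul_eq_mul]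
      push_cast
      ring

theorem apply_tableSum {ι M : Type*} [AddCommGroup M] [Module ℂ M] (Λ : M →ₗ[ℂ] ℂ) {F : ι → M}
    {g : ι → ℤ} {T : List (ℕ × ι)} (h : ∀ t ∈ T, Λ (F t.2) = g t.2) (a : ℕ → ℝ) :
    Λ (tableSum F T fun i => (a i : ℂ)) = (rowSum a (row g T) : ℂ) := by
  rw [map_tableSum, tableSum_congr (G := fun x => (g x : ℂ)) h, tableSum_row]

/-- A linear functional that vanishes on the gauge variation of the couplings with coefficients `a`,
`b`, and on all contractions of `u ũ u` (for which `K` stands), gives a linear equation for these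
coefficients. -/
theorem apply_variation {M : Type*} [AddCommGroup M] [Module ℂ M] (Λ : M →ₗ[ℂ] ℂ)
    {F G K : List (ℕ × ℕ) → M} {g k : List (ℕ × ℕ) → ℤ} {T U : List (ℕ × List (ℕ × ℕ))}
    (hF : ∀ t ∈ T, Λ (F t.2) = g t.2) (hG : ∀ t ∈ U, Λ (G t.2) = k t.2) (hK : ∀ P, Λ (K P) = 0)
    {a b : ℕ → ℝ} (h : Λ ((-(Complex.I / 2)) • tableSum F T (fun i => (a i : ℂ)) +
      (-(Complex.I / 2)) • (tableSum G U (fun i => (b i : ℂ)) + tableSum K U fun i => (b i : ℂ))) =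
        0) :
    rowSum a (row g T) + rowSum b (row k U) = 0 := by
  have h0 : Λ (tableSum K U fun i => (b i : ℂ)) = 0 := by
    rw [apply_tableSum Λ (g := fun _ => 0) fun t _ => (hK t.2).trans Int.cast_zero.symm]
    have e : row (fun _ : List (ℕ × ℕ) => 0) U = [] := by
      simp only [row, List.filter_map, List.map_eq_nil_iff]
      exact List.filter_eq_nil_iff.2 fun t _ => Bool.false_ne_true
    rw [e]
    exact Complex.ofReal_zero
  rw [← smul_add, map_smul, smul_eq_mul, map_add, map_add, h0, add_zero, apply_tableSum Λ hF,
    apply_tableSum Λ hG] at h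
  have hI : -(Complex.I / 2) ≠ 0 := by simp
  exact_mod_cast (mul_eq_zero.1 h).resolve_left hI

/-- Every term of the combination is a well-formed contraction of `u h h`. -/
def Combo.fits (C : Combo) : Bool :=
  C.all fun t => SpinTwo.fits .u .h .h t.2 && SpinTwo.fits .u .h .h (relabel (exch 1 2) t.2)

/-- The amplitude of a combination of contractions of `u h h`. -/
def Config.amplitude (V : Config) (C : Combo) : ℤ :=
  (C.map fun t => t.1 * (V.value t.2 + V.value (relabel (exch 1 2) t.2))).sum

theorem apply_eval {V : Config} {Λ : Wick →ₗ[ℂ] ℂ}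
    (hΛ : ∀ P, (fits .u .h .h P && fits .u .h .h (relabel (exch 1 2) P)) = true →
      Λ (contract P (word .u .h .h)) = ((V.value P + V.value (relabel (exch 1 2) P) : ℤ) : ℂ))
    {C : Combo} (hC : C.fits = true) :
    Λ (Combo.eval (word .u .h .h) C) = (V.amplitude C : ℂ) := by
  induction C with
  | nil => exact (map_zero Λ).trans Int.cast_zero.symm
  | cons t C ih =>
    rw [Combo.fits, List.all_cons, Bool.and_eq_true] at hC
    rw [Combo.eval, map_add, map_smul, hΛ _ hC.1, ih hC.2, Config.amplitude, Config.amplitude,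
      List.map_cons, List.sum_cons, smul_eq_mul]
    push_cast
    rfl

theorem apply_eval_eq_zero {Λ : Wick →ₗ[ℂ] ℂ} {W : Slots → Wick}
    (hΛ : ∀ P, Λ (contract P W) = 0) (C : Combo) : Λ (Combo.eval W C) = 0 := by
  induction C with
  | nil => exact map_zero Λ
  | cons t C ih => rw [Combo.eval, map_add, map_smul, hΛ, ih, smul_zero, add_zero]

theorem fits_varyH : ∀ t ∈ tableH, (varyH t.2).fits = true := by decide +kernel

theorem fits_varyUt : ∀ t ∈ tableU, (varyUt t.2).fits = true := by decide +kernel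

theorem dQ_T1 (v : Coeffs) : dQ (T1 v) =
    (-(Complex.I / 2)) • tableSum (fun P => Combo.eval (word .u .h .h) (varyH P)) tableH
      (fun i => (aCoef v i : ℂ)) +
    (-(Complex.I / 2)) • (tableSum (fun P => Combo.eval (word .u .h .h) (varyUt P)) tableU
        (fun i => (bCoef v i : ℂ)) +
      tableSum (fun P => Combo.eval (word .u .ut .u) (gauge 4 5 P)) tableU
        fun i => (bCoef v i : ℂ)) := by
  rw [T1, map_add, dQ_T1h, dQ_T1u]

theorem rowSum_of_variation {V : Config} (hV : (V.null && V.conserved) = true) {A : Wick}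
    {T : Fin 4 → Wick} {TH TU : List (ℕ × List (ℕ × ℕ))} {a b : ℕ → ℝ}
    (hH : ∀ t ∈ TH, (varyH t.2).fits = true) (hU : ∀ t ∈ TU, (varyUt t.2).fits = true)
    (hd : A =
      (-(Complex.I / 2)) • tableSum (fun P => Combo.eval (word .u .h .h) (varyH P)) TH
        (fun i => (a i : ℂ)) +
      (-(Complex.I / 2)) • (tableSum (fun P => Combo.eval (word .u .h .h) (varyUt P)) TU
          (fun i => (b i : ℂ)) +
        tableSum (fun P => Combo.eval (word .u .ut .u) (gauge 4 5 P)) TU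
          fun i => (b i : ℂ)))
    (hc : A = divergence T) {R S : List (ℕ × ℤ)}
    (hR : row (fun P => V.amplitude (varyH P)) TH = R)
    (hS : row (fun P => V.amplitude (varyUt P)) TU = S) :
    rowSum a R + rowSum b S = 0 := by
  rw [Bool.and_eq_true] at hV
  obtain ⟨Λ, h0, h1, h2⟩ := exists_amplitude_u_h_h hV.1 hV.2
  subst hR hS
  have h := congrArg Λ hc
  rw [h0, hd] at h
  exact apply_variation Λ (fun t ht => apply_eval h1 (hH t ht))
    (fun t ht => apply_eval h1 (hU t ht)) (fun P => apply_eval_eq_zero h2 _) h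

/-- The vanishing of an amplitude of the gauge variation, as a linear equation for the
coefficients. -/
theorem rowSum_add_rowSum_eq_zero {v : Coeffs} (hv : v ∈ solvable) {V : Config}
    (hV : (V.null && V.conserved) = true) {R S : List (ℕ × ℤ)}
    (hR : row (fun P => V.amplitude (varyH P)) tableH = R)
    (hS : row (fun P => V.amplitude (varyUt P)) tableU = S) :
    rowSum (aCoef v) R + rowSum (bCoef v) S = 0 := by
  obtain ⟨c, hc⟩ := hv
  exact rowSum_of_variation hV fits_varyH fits_varyUt (dQ_T1 v) hc hR hS

/-! ### The relations are necessary -/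

/-- Three plane waves with the given polarization vectors and with momenta `p`, `q`, `-p - q` for
two basis vectors `p`, `q`, all of which are null. -/
def gaugeConfig (e₀ e₁ e₂ : NullVec) : Config :=
  [e₀, (1, 0, 0, 0), e₁, (0, 0, 1, 0), e₂, (-1, 0, -1, 0)]

theorem mem_V_iff (v : Coeffs) : v ∈ V ↔ relations v = 0 := LinearMap.mem_ker

/-- Fifteen amplitudes give equations equivalent to the relations. -/
theorem solvable_le_V : solvable ≤ V := by
  intro v hv
  have e1 := rowSum_add_rowSum_eq_zero hv
    (V := gaugeConfig (-1, -1, 0, 0) (0, 0, -1, -1) (0, 0, -1, 1))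
    (R := []) (S := [(9, -4), (12, -4)])
    (by decide +kernel) (by decide +kernel) (by decide +kernel)
  have e2 := rowSum_add_rowSum_eq_zero hv
    (V := gaugeConfig (0, 0, -1, -1) (0, -1, 0, 0) (0, 0, 1, -1))
    (R := [(5, -4), (6, 4)]) (S := [])
    (by decide +kernel) (by decide +kernel) (by decide +kernel)
  have e3 := rowSum_add_rowSum_eq_zero hv
    (V := gaugeConfig (-1, 1, 0, 0) (0, 0, 0, 1) (-1, 0, 0, -1))
    (R := []) (S := [(15, -2), (18, -2), (21, 2)])
    (by decide +kernel) (by decide +kernel) (by decide +kernel)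
  have e4 := rowSum_add_rowSum_eq_zero hv
    (V := gaugeConfig (-1, 0, -1, 0) (1, -1, 0, 0) (0, 1, 0, -1))
    (R := [(8, 4), (9, 2), (12, -2)]) (S := [])
    (by decide +kernel) (by decide +kernel) (by decide +kernel)
  have e5 := rowSum_add_rowSum_eq_zero hv
    (V := gaugeConfig (-1, 0, -1, 0) (0, 0, 0, -1) (0, -1, 0, 1))
    (R := [(9, 1), (10, -1), (12, -2)]) (S := [(19, 2)])
    (by decide +kernel) (by decide +kernel) (by decide +kernel)
  have e6 := rowSum_add_rowSum_eq_zero hv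
    (V := gaugeConfig (-1, -1, 0, 0) (0, 0, 0, 1) (0, -1, 0, 1))
    (R := [(7, 2)]) (S := [(16, -2), (17, 2), (18, -2)])
    (by decide +kernel) (by decide +kernel) (by decide +kernel)
  have e7 := rowSum_add_rowSum_eq_zero hv
    (V := gaugeConfig (0, 1, 0, 0) (0, 0, 1, -1) (0, 1, 0, 0))
    (R := [(1, -4), (7, -2)]) (S := [(7, -4), (10, -4)])
    (by decide +kernel) (by decide +kernel) (by decide +kernel)
  have e8 := rowSum_add_rowSum_eq_zero hv
    (V := gaugeConfig (-1, 0, 0, -1) (0, 1, 0, 0) (0, 1, -1, 0))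
    (R := [(7, 2), (9, 1), (10, 1)]) (S := [(13, -2), (16, -2)])
    (by decide +kernel) (by decide +kernel) (by decide +kernel)
  have e9 := rowSum_add_rowSum_eq_zero hv
    (V := gaugeConfig (0, 0, 0, -1) (-1, 0, 0, 1) (0, 1, 0, 1))
    (R := [(9, -1), (10, -1)]) (S := [(1, 2), (2, -2), (3, 2)])
    (by decide +kernel) (by decide +kernel) (by decide +kernel)
  have e10 := rowSum_add_rowSum_eq_zero hv
    (V := gaugeConfig (-1, -1, 0, 0) (0, 0, 1, 1) (1, -1, 0, 0))
    (R := [(4, 2), (5, 2)]) (S := [(7, -4), (9, -4), (11, -4)])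
    (by decide +kernel) (by decide +kernel) (by decide +kernel)
  have e11 := rowSum_add_rowSum_eq_zero hv
    (V := gaugeConfig (0, -1, 0, 1) (-1, -1, 0, 0) (0, -1, 0, 1))
    (R := [(2, -8), (5, -4), (6, 4), (9, 2), (12, -2)]) (S := [])
    (by decide +kernel) (by decide +kernel) (by decide +kernel)
  have e12 := rowSum_add_rowSum_eq_zero hv
    (V := gaugeConfig (0, -1, -1, 0) (0, 1, -1, 0) (1, -1, 0, 0))
    (R := [(2, 8), (4, 2), (5, 2)]) (S := [(1, 2), (4, 2), (19, 2)])
    (by decide +kernel) (by decide +kernel) (by decide +kernel)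
  have e13 := rowSum_add_rowSum_eq_zero hv
    (V := gaugeConfig (0, 0, -1, -1) (0, 0, 1, -1) (-1, 1, 0, 0))
    (R := [(4, -2), (5, 2), (6, -4)]) (S := [(7, 4), (8, -4), (12, -4)])
    (by decide +kernel) (by decide +kernel) (by decide +kernel)
  have e14 := rowSum_add_rowSum_eq_zero hv
    (V := gaugeConfig (-1, 0, -1, 0) (0, 1, 0, -1) (0, 0, -1, 1))
    (R := [(9, -1), (10, 1), (11, -2)]) (S := [(13, 2), (14, -2), (15, 2), (20, -2)])
    (by decide +kernel) (by decide +kernel) (by decide +kernel)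
  have e15 := rowSum_add_rowSum_eq_zero hv
    (V := gaugeConfig (0, -1, -1, 0) (1, 0, 0, -1) (0, -1, 0, 0))
    (R := [(3, 4), (4, -2), (5, 2), (11, 2), (12, 2)]) (S := [(2, -2), (4, 2), (5, -4), (6, 2)])
    (by decide +kernel) (by decide +kernel) (by decide +kernel)
  simp only [rowSum_cons, rowSum_nil, Int.cast_ofNat, Int.cast_neg, Int.cast_one]
    at e1 e2 e3 e4 e5 e6 e7 e8 e9 e10 e11 e12 e13 e14 e15
  rw [mem_V_iff]
  simp only [relations, LinearMap.coe_mk, AddHom.coe_mk]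
  funext i
  iterate 15
    refine Fin.cases ?_ (fun i => ?_) i
    · rw [Matrix.cons_val_zero]
      simp only [Pi.zero_apply]
      linarith
    rw [Matrix.cons_val_succ]
  exact i.elim0

/-! ### Linear independence of the monomials -/

/-- For each monomial of `T1h`, plane waves on which only this monomial has a nonzero amplitude. -/
def configsH : List Config :=
  [[(0, -1, 0, 0), (-1, 0, 0, 1), (0, 0, -1, -1), (0, 1, -1, 0),
      (0, 0, 1, -1), (1, 0, 0, 0)],
    [(0, 0, 0, -1), (-1, 0, 0, 1), (1, -1, 0, 0), (-1, 0, -1, 0),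
      (1, 1, 0, 0), (0, 1, 1, 0)],
    [(0, 0, 0, 1), (0, 0, 1, 0), (0, 0, 1, 1), (0, 0, 0, 1),
      (1, 1, 0, 0), (0, -1, 0, 0)],
    [(1, 1, 0, 0), (0, 0, 0, -1), (0, 0, -1, 1), (0, 0, 1, 0),
      (0, 0, 1, 0), (-1, 0, 0, 0)],
    [(0, 0, -1, 1), (0, 1, 0, 0), (-1, 1, 0, 0), (0, 0, 0, 1),
      (1, 0, 0, 0), (1, 0, 0, 0)],
    [(-1, 1, 0, 0), (0, -1, 0, 0), (0, 0, 1, -1), (0, 0, 0, -1),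
      (0, 0, -1, 0), (0, 0, -1, 0)],
    [(-1, 0, -1, 0), (0, 1, -1, 0), (1, 0, 0, 0), (0, 1, -1, 0),
      (1, 0, 0, -1), (1, 0, 1, 0)],
    [(0, -1, 1, 0), (1, 0, 0, 0), (1, 0, 0, 1), (0, 1, 0, 1),
      (0, 1, 0, 0), (1, 0, -1, 0)],
    [(-1, 0, 0, 1), (-1, 0, 0, 0), (0, 0, 0, 1), (0, -1, 0, 0),
      (0, 0, -1, 0), (0, 1, 1, 0)],
    [(-1, -1, 0, 0), (0, 0, -1, 0), (0, 1, 1, 0), (-1, 0, 0, 0),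
      (1, 0, 0, -1), (1, 0, 0, -1)],
    [(-1, 0, -1, 0), (0, 1, 0, 0), (0, -1, 0, 1), (0, 0, 1, 0),
      (0, 1, 1, 0), (0, 1, -1, 0)],
    [(0, -1, -1, 0), (0, -1, -1, 0), (-1, -1, 0, 0), (0, 0, -1, 0),
      (0, -1, 0, -1), (0, 1, 0, 0)]]

/-- For each monomial of `T1u`, plane waves on which only this monomial has a nonzero amplitude. -/
def configsU : List Config :=
  [[(1, 0, 1, 0), (0, 1, 1, 0), (0, -1, 0, 0), (-1, 0, 0, 1),
      (-1, 0, 0, 0), (-1, 0, -1, 0)],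
    [(0, -1, -1, 0), (0, -1, 0, -1), (0, 0, 1, 0), (1, 0, 0, -1),
      (-1, 0, 0, 1), (1, 0, 0, 0)],
    [(0, 0, 0, -1), (0, 1, 0, 0), (-1, 0, 0, -1), (-1, 0, 0, -1),
      (0, 1, 0, -1), (0, 1, 1, 0)],
    [(-1, 0, 0, 1), (0, 0, -1, 0), (-1, 0, 0, 0), (1, 0, -1, 0),
      (0, -1, 1, 0), (-1, 0, 0, -1)],
    [(0, -1, -1, 0), (0, 0, 0, -1), (0, 1, 0, 1), (1, 0, 0, -1),
      (1, 0, 0, -1), (0, 0, -1, 0)],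
    [(0, -1, 0, -1), (0, -1, 0, 0), (0, 0, 1, -1), (1, 0, 0, 1),
      (0, 0, 0, -1), (0, 0, -1, 0)],
    [(0, 0, 1, 0), (-1, 0, 0, 0), (-1, -1, 0, 0), (0, -1, 0, -1),
      (-1, 1, 0, 0), (0, 0, -1, 0)],
    [(0, 0, 0, 1), (0, -1, 1, 0), (-1, -1, 0, 0), (0, 0, 0, 1),
      (1, -1, 0, 0), (0, 0, -1, 0)],
    [(0, 0, 1, 0), (0, 0, -1, 0), (-1, -1, 0, 0), (-1, 0, 1, 0),
      (-1, 1, 0, 0), (-1, 0, 0, -1)],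
    [(-1, -1, 0, 0), (0, 1, 0, 0), (0, 0, 0, 1), (0, -1, 1, 0),
      (-1, 1, 0, 0), (0, 0, 0, 1)],
    [(0, -1, -1, 0), (1, 0, 0, 0), (0, 0, 1, -1), (0, 1, 0, 0),
      (0, 0, -1, -1), (0, -1, 1, 0)],
    [(0, 0, 1, 1), (0, 1, 0, 0), (0, -1, 0, -1), (1, 0, 0, -1),
      (0, 0, -1, 1), (-1, 0, 0, 0)],
    [(-1, 0, -1, 0), (0, 1, 0, 1), (1, 0, 0, 0), (1, 0, -1, 0),
      (-1, 0, 0, 1), (0, 0, 0, 1)],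
    [(0, 0, -1, -1), (0, 1, 0, 1), (-1, -1, 0, 0), (0, 0, 0, 1),
      (0, 0, 0, -1), (0, 0, -1, 0)],
    [(-1, 0, -1, 0), (0, -1, -1, 0), (0, 0, -1, 0), (0, 0, 0, -1),
      (0, 1, -1, 0), (-1, 0, 1, 0)],
    [(1, 1, 0, 0), (1, 0, 0, 0), (0, -1, 1, 0), (0, -1, 0, 1),
      (0, -1, 0, 0), (0, -1, 1, 0)],
    [(0, 1, 1, 0), (0, 1, -1, 0), (1, 0, 0, -1), (0, 0, 0, 1),
      (0, 0, 0, 1), (0, 1, 0, -1)],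
    [(-1, 0, -1, 0), (-1, 0, 0, 0), (-1, 0, 0, 1), (0, 0, 1, 0),
      (0, 0, 0, -1), (0, 1, 0, 0)],
    [(-1, 0, -1, 0), (-1, 0, 0, 0), (1, 0, 0, -1), (0, 0, 1, 0),
      (0, 1, 0, -1), (-1, 0, -1, 0)],
    [(0, 0, -1, -1), (-1, 0, -1, 0), (0, 0, -1, 0), (0, -1, 0, 1),
      (0, -1, 0, 0), (-1, 0, -1, 0)],
    [(-1, 0, 1, 0), (1, 0, 1, 0), (1, -1, 0, 0), (0, 0, 0, -1),
      (0, 0, 1, 0), (-1, 0, 0, 1)]]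

/-- The amplitude of a contraction of `h h h`: the sum over the permutations of the factors. -/
def Config.amplitudeH (V : Config) (P : List (ℕ × ℕ)) : ℤ :=
  V.value P + V.value (relabel (exch 1 2) P) + V.value (relabel (exch 0 1) P) +
    V.value (relabel (exch 1 2) (relabel (exch 0 1) P)) +
    V.value (relabel (exch 0 1) (relabel (exch 1 2) P)) + V.value (relabel (exch 0 2) P)

/-- The contraction `P` of `h h h` is well-formed after every permutation of the factors. -/
def fitsH (P : List (ℕ × ℕ)) : Bool :=
  fits .h .h .h P && fits .h .h .h (relabel (exch 1 2) P) && fits .h .h .h (relabel (exch 0 1) P) &&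
    fits .h .h .h (relabel (exch 1 2) (relabel (exch 0 1) P)) &&
    fits .h .h .h (relabel (exch 0 1) (relabel (exch 1 2) P)) &&
    fits .h .h .h (relabel (exch 0 2) P)

theorem fitsH_tableH : ∀ t ∈ tableH, fitsH t.2 = true := by decide +kernel

theorem fits_tableU : ∀ t ∈ tableU, fits .u .ut .h t.2 = true := by decide +kernel

theorem apply_tableSum_eq_zero {M : Type*} [AddCommGroup M] [Module ℂ M] {Λ : M →ₗ[ℂ] ℂ}
    {F : List (ℕ × ℕ) → M} (h : ∀ P, Λ (F P) = 0) (T : List (ℕ × List (ℕ × ℕ))) (a : ℕ → ℂ) :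
    Λ (tableSum F T a) = 0 := by
  induction T with
  | nil => rw [tableSum_nil, map_zero]
  | cons t T ih => rw [tableSum_cons, map_add, map_smul, h, smul_zero, zero_add, ih]

theorem T1_eq (v : Coeffs) : T1 v =
    tableSum (fun P => contract P (word .h .h .h)) tableH (fun i => (aCoef v i : ℂ)) +
      tableSum (fun P => contract P (word .u .ut .h)) tableU fun i => (bCoef v i : ℂ) := by
  rw [T1, T1h_eq fun _ => rfl, T1u_eq fun _ => rfl]

theorem rowSum_amplitudeH_eq_zero {V : Config} (hV : V.null = true)
    {TH TU : List (ℕ × List (ℕ × ℕ))} (hT : ∀ t ∈ TH, fitsH t.2 = true) {a b : ℕ → ℝ}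
    (h : tableSum (fun P => contract P (word .h .h .h)) TH (fun i => (a i : ℂ)) +
      tableSum (fun P => contract P (word .u .ut .h)) TU (fun i => (b i : ℂ)) = 0) :
    rowSum a (row V.amplitudeH TH) = 0 := by
  obtain ⟨Λ, h1, h2⟩ := exists_amplitude_hhh hV
  have h0 := congrArg Λ h
  rw [map_add, apply_tableSum_eq_zero h2, add_zero, map_zero,
    apply_tableSum Λ (g := V.amplitudeH) fun t ht => h1 _ (hT t ht)] at h0
  exact_mod_cast h0

theorem rowSum_value_eq_zero {V : Config} (hV : V.null = true) {TH TU : List (ℕ × List (ℕ × ℕ))}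
    (hT : ∀ t ∈ TU, fits .u .ut .h t.2 = true) {a b : ℕ → ℝ}
    (h : tableSum (fun P => contract P (word .h .h .h)) TH (fun i => (a i : ℂ)) +
      tableSum (fun P => contract P (word .u .ut .h)) TU (fun i => (b i : ℂ)) = 0) :
    rowSum b (row (fun P => -V.value P) TU) = 0 := by
  obtain ⟨Λ, h1, h2⟩ := exists_amplitude_u_ut_h hV
  have h0 := congrArg Λ h
  rw [map_add, apply_tableSum_eq_zero h2, zero_add, map_zero,
    apply_tableSum Λ (g := fun P => -V.value P) fun t ht => h1 _ (hT t ht)] at h0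
  exact_mod_cast h0

/-- The row has a single entry, which belongs to the `i`-th coefficient. -/
def isolates (i : ℕ) (R : List (ℕ × ℤ)) : Bool :=
  match R with
  | [t] => t.1 == i && t.2 != 0
  | _ => false

theorem eq_zero_of_isolates {i : ℕ} {R : List (ℕ × ℤ)} (hR : isolates i R = true) {a : ℕ → ℝ}
    (h : rowSum a R = 0) : a i = 0 := by
  match R with
  | [t] =>
    simp only [isolates, Bool.and_eq_true, beq_iff_eq, bne_iff_ne] at hR
    rw [rowSum_cons, rowSum_nil, add_zero, hR.1] at h
    exact (mul_eq_zero.1 h).resolve_left (Int.cast_ne_zero.2 hR.2)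

theorem isolates_H : ∀ i : Fin 12, ∃ V ∈ configsH,
    (V.null && isolates (i + 1) (row V.amplitudeH tableH)) = true := by decide +kernel

theorem isolates_U : ∀ i : Fin 21, ∃ V ∈ configsU,
    (V.null && isolates (i + 1) (row (fun P => -V.value P) tableU)) = true := by decide +kernel

theorem aCoef_eq_zero {v : Coeffs} (hv : T1 v = 0) (i : Fin 12) : aCoef v (i + 1) = 0 := by
  obtain ⟨V, _, hV⟩ := isolates_H i
  rw [Bool.and_eq_true] at hV
  rw [T1_eq] at hv
  exact eq_zero_of_isolates hV.2 (rowSum_amplitudeH_eq_zero hV.1 fitsH_tableH hv)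

theorem bCoef_eq_zero {v : Coeffs} (hv : T1 v = 0) (i : Fin 21) : bCoef v (i + 1) = 0 := by
  obtain ⟨V, _, hV⟩ := isolates_U i
  rw [Bool.and_eq_true] at hV
  rw [T1_eq] at hv
  exact eq_zero_of_isolates hV.2 (rowSum_value_eq_zero hV.1 fits_tableU hv)

theorem eq_zero_of_T1 {v : Coeffs} (hv : T1 v = 0) : v = 0 := by
  have h : ∀ i : Fin (12 + 21), v i = 0 := by
    intro i
    refine Fin.addCases (fun i => ?_) (fun i => ?_) i
    · have e : Fin.castAdd 21 i = Fin.ofNat 33 i := Fin.ext (Nat.mod_eq_of_lt (by omega)).symm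
      rw [e]
      exact aCoef_eq_zero hv i
    · have e : Fin.natAdd 12 i = Fin.ofNat 33 (i + 1 + 11) :=
        Fin.ext ((Nat.add_comm 12 i).trans (Nat.mod_eq_of_lt (by omega)).symm)
      rw [e]
      exact bCoef_eq_zero hv i
  exact funext h

theorem T1_injective : Function.Injective T1 := by
  intro v w h
  refine sub_eq_zero.1 (eq_zero_of_T1 ?_)
  have h0 : T1 (w - w) = 0 := by
    rw [sub_self, ← zero_smul ℝ w, T1_smul, Complex.ofReal_zero, zero_smul]
  rw [sub_eq_add_neg, T1_add, h, ← T1_add, ← sub_eq_add_neg, h0]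

/-! ### The space of solutions -/

/-- The coefficients that parametrize the solutions. -/
def freeCoef (v : Coeffs) : Fin 18 → ℝ :=
  ![aCoef v 6, aCoef v 12, bCoef v 3, bCoef v 4, bCoef v 5, bCoef v 6, bCoef v 7, bCoef v 10,
    bCoef v 11, bCoef v 12, bCoef v 13, bCoef v 14, bCoef v 16, bCoef v 17, bCoef v 18, bCoef v 19,
    bCoef v 20, bCoef v 21]

theorem freeCoef_L (p : Fin 18 → ℝ) : freeCoef (L p) = p := by
  funext m
  fin_cases m <;> rfl

theorem L_injective : Function.Injective L := fun p q h => by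
  rw [← freeCoef_L p, h, freeCoef_L]

theorem V_le_range_L : V ≤ LinearMap.range L := by
  intro v hv
  refine ⟨freeCoef v, ?_⟩
  rw [mem_V_iff] at hv
  simp only [relations, LinearMap.coe_mk, AddHom.coe_mk] at hv
  have h0 := congrFun hv 0
  have h1 := congrFun hv 1
  have h2 := congrFun hv 2
  have h3 := congrFun hv 3
  have h4 := congrFun hv 4
  have h5 := congrFun hv 5
  have h6 := congrFun hv 6
  have h7 := congrFun hv 7
  have h8 := congrFun hv 8
  have h9 := congrFun hv 9
  have h10 := congrFun hv 10
  have h11 := congrFun hv 11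
  have h12 := congrFun hv 12
  have h13 := congrFun hv 13
  have h14 := congrFun hv 14
  simp only [Matrix.cons_val, Pi.zero_apply] at h0 h1 h2 h3 h4 h5 h6 h7 h8 h9 h10 h11 h12 h13 h14
  have hv' : v = ![aCoef v 1, aCoef v 2, aCoef v 3, aCoef v 4, aCoef v 5, aCoef v 6, aCoef v 7,
        aCoef v 8,
        aCoef v 9, aCoef v 10, aCoef v 11, aCoef v 12, bCoef v 1, bCoef v 2, bCoef v 3, bCoef v 4,
        bCoef v 5, bCoef v 6, bCoef v 7, bCoef v 8, bCoef v 9, bCoef v 10, bCoef v 11, bCoef v 12,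
        bCoef v 13, bCoef v 14, bCoef v 15, bCoef v 16, bCoef v 17, bCoef v 18, bCoef v 19,
        bCoef v 20, bCoef v 21] := by
    funext i
    fin_cases i <;> rfl
  refine Eq.trans ?_ hv'.symm
  simp only [L, LinearMap.coe_mk, AddHom.coe_mk, freeCoef, Matrix.cons_val]
  funext i
  -- the entries after `b₁₅` agree literally
  iterate 27
    refine Fin.cases ?_ (fun i => ?_) i
    · rw [Matrix.cons_val_zero, Matrix.cons_val_zero] <;> linarith
    rw [Matrix.cons_val_succ, Matrix.cons_val_succ]

theorem range_L : LinearMap.range L = V :=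
  le_antisymm (range_L_le.trans solvable_le_V) V_le_range_L

theorem solvable_eq_V : solvable = V :=
  le_antisymm solvable_le_V (V_le_range_L.trans range_L_le)

theorem finrank_V : Module.finrank ℝ V = 18 := by
  rw [← range_L, LinearMap.finrank_range_of_inj L_injective, Module.finrank_fin_fun]

end SpinTwo

open SpinTwo in
theorem proposition1 :
    Function.LeftInverse f T1 ∧
    Module.finrank ℝ V = 18 ∧
    Function.Injective L ∧
    LinearMap.range L = V ∧
    ∀ v : Coeffs,
      (∃ c : ℕ → ℂ, dQ (T1 v) = divergence (vertex c) ∧ dQ (divergence (vertex c)) = 0) ↔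
        f (T1 v) ∈ V := by
  have hf : Function.LeftInverse f T1 := Function.leftInverse_invFun T1_injective
  refine ⟨hf, finrank_V, L_injective, range_L, fun v => ?_⟩
  rw [hf v, ← solvable_eq_V]
  exact ⟨fun ⟨c, hc, _⟩ => ⟨c, hc⟩, fun ⟨c, hc⟩ => ⟨c, hc, by rw [← hc, dQ_dQ]⟩⟩
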